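/- Let $\widetilde X=\mathbb A^2\setminus\{0\}$ be the base affine space of $SL_2(\mathbb C)$ with coordinates $x_1,x_2$, let $U=\{x_2\neq 0\}$ with inclusion $j$, and let $n\ge 2$. For an open chart $W\subseteq\mathbb A^2$ on which some of the coordinates are inverted (so $W=\mathbb A^2$, or one of the charts $\{x_1\ne0\},\{x_2\neq0\}$ covering $\widetilde X$, or their intersection), $D$-modules on $W$ are modules over the ring $\mathcal D(W)$ of differential operators, $j_+$ is the push-forward along $j:W\cap U\to W$, and $j_!=\mathbb D\, j_+\,\mathbb D$ with $\mathbb D=\mathrm{Ext}^2_{\mathcal D}(-,\mathcal D)$. Let $f^s\mathcal O_U^{(n)}=(\mathcal O_U\otimes\mathbb C[s]/s^n)\,t^s$ with $\partial_1t^s=0$, $\partial_2t^s=s x_2^{-1}t^s$, let $\mathrm{can}:j_!f^s\mathcal O_U^{(n)}\to j_+f^s\mathcal O_U^{(n)}$ be a canonical map (a $\mathcal D$-linear map commuting with $s$ and restricting to an isomorphism on $W\cap U$), and let $\Xi=\mathrm{coker}(s\circ\mathrm{can})$, with its endomorphism $s$. Global sections over $\widetilde X$ are understood as the corresponding $\mathcal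 D(\mathbb A^2)$-modules, with $\mathfrak{sl}_2$ acting by $L_e=-x_2\partial_1$, $L_f=-x_1\partial_2$, $L_h=-x_1\partial_1+x_2\partial_2$; for an integer $\lambda$, the $\lambda$-part is the eigenspace of the Euler operator $R_h=x_1\partial_1+x_2\partial_2$ for $\lambda$ (on modules annihilated by $s$), and $\{v: R_hv=(\lambda+s)v\}$ in the deformed case. (1) On every such $W$: the reduction $f^s\mathcal O_U^{(n)}\to\mathcal O_U$ induces $j_!f^s\mathcal O_U^{(n)}/s\,j_!f^s\mathcal O_U^{(n)}\cong j_!\mathcal O_U$. A map $\mathrm{can}$ exists and is unique up to units of $\mathbb C[s]/s^n$. It descends to an injective map $\overline{\mathrm{can}}:j_!\mathcal O_U\cong j_!f^s\mathcal O_U^{(n)}/s\,j_!f^s\mathcal O_U^{(n)}\to\Xi$ with image $\ker(s:\Xi\to\Xi)$. The endomorphism $s$ of $\Xi$ is nilpotent and has a unique monodromy filtration $\mu^\bullet$, i.e. a finite increasing filtration with $s\mu^m\subseteq\mu^{m-2}$ and $s^k:\mathrm{gr}^k_\mu\xrightarrow{\sim}\mathrm{gr}^{-k}_\mu$ for $k\geq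 0$. If $F^i$ denotes the image in $j_!f^s\mathcal O_U^{(n)}/s$ of $\mathrm{can}^{-1}(s^ij_+f^s\mathcal O_U^{(n)})$ (the algebraic Jantzen filtration), then for all $i\ge0$ $$\overline{\mathrm{can}}(F^i)=\ker s\cap\mu^{-i}=\ker s\cap s^i\,\Xi$$ (the geometric Jantzen filtration). (2) Let $A=\mathbb C[s]_{(s)}$, let $\lambda$ be an integer, let $M_A(\lambda)=U(\mathfrak g)\otimes_{U(\mathfrak b)}A_\lambda$ be the deformed Verma module of $\mathfrak g=\mathfrak{sl}_2(\mathbb C)$ (where $h$ acts on $A_\lambda=A$ by $\lambda+s$), and let $I_A(\lambda)$ be the deformed dual Verma module (the sum of the deformed weight spaces of $\mathrm{Hom}_{U(\bar{\mathfrak b})}(U(\mathfrak g),A_\lambda)$). There is exactly one homomorphism $\psi_{A,\lambda}:M_A(\lambda)\to I_A(\lambda)$ of $(\mathfrak g,A)$-bimodules with $\psi_{A,\lambda}(1\otimes1)(1)=1$. Let $M(\lambda)^i\subseteq M(\lambda)$ be the image of $\{m\in M_A(\lambda):\psi_{A,\lambda}(m)\in s^iI_A(\lambda)\}$ under $s\mapsto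 0$. Set $\varepsilon=0$ if $\lambda\ge0$ and $\varepsilon=1$ if $\lambda<0$. Then, compatibly with the actions of $\mathfrak g$ and $s$, $M_A(\lambda)/s^n$ and $I_A(\lambda)/s^n$ are identified with the $\lambda$-parts of the global sections of $j_!f^s\mathcal O_U^{(n)}$ and $j_+f^s\mathcal O_U^{(n)}$ in such a way that $\mathrm{can}$ becomes $s^{\varepsilon}\psi_{A,\lambda}$. The induced isomorphism of the Verma module $M(\lambda)$ with the $\lambda$-part of the global sections of $j_!\mathcal O_U$ carries $M(\lambda)^i$ onto the $\lambda$-part of $F^{i+\varepsilon}$, and its composition with $\overline{\mathrm{can}}$ carries $M(\lambda)^i$ onto the $\lambda$-part of $\ker s\cap\mu^{-(i+\varepsilon)}$, for all $i\ge0$. In particular, for $\lambda\geq0$ the algebraic Jantzen filtration of the Verma module $M(\lambda)$ coincides with the geometric Jantzen filtration. -/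

import Mathlib

open CategoryTheory
open scoped TensorProduct Polynomial

noncomputable section

namespace Jantzen

/-! ## Toric charts, their differential operators, and `D`-modules on them

All varieties below are open subvarieties of the affine plane with coordinates `x₁ = x 0` and
`x₂ = x 1`.  For an affine variety, (quasi-coherent) `D`-modules are modules over the ring of
global differential operators. -/

/-- A chart `W` is the open subset of `𝔸²` on which the coordinates `x i` with `W i = true` are
invertible. -/
abbrev Chart : Type := Fin 2 → Bool

/-- The affine plane `𝔸²`, the affine closure of the base affine space `X̃ = 𝔸² ∖ {0}` of `SL₂`;
one has `Γ(X̃, 𝒪) = Γ(𝔸², 𝒪)` and `Γ(X̃, 𝒟) = Γ(𝔸², 𝒟)`. -/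
def Chart.plane : Chart := fun _ => false

/-- The intersection of a chart `W` with the open set `U = {x₂ ≠ 0}`. -/
def Chart.meetU (W : Chart) : Chart := Function.update W 1 true

lemma Chart.le_meetU (W : Chart) (i : Fin 2) (h : W i = true) : W.meetU i = true := by
  unfold Chart.meetU
  by_cases hi : i = 1
  · subst hi; simp
  · simpa [Function.update_of_ne hi] using h

/-- Generators of the ring of differential operators on the chart `W`: the coordinates, the
partial derivatives, and the inverses of the coordinates that are invertible on `W`. -/
inductive Gen (W : Chart) : Type
  | x (i : Fin 2) : Gen W
  | d (i : Fin 2) : Gen W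
  | y (i : Fin 2) (h : W i = true) : Gen W

/-- The defining relations of the ring of differential operators on the chart `W`. -/
inductive Rel (W : Chart) : FreeAlgebra ℂ (Gen W) → FreeAlgebra ℂ (Gen W) → Prop
  | x_comm (i j : Fin 2) : Rel W
      (FreeAlgebra.ι ℂ (Gen.x i) * FreeAlgebra.ι ℂ (Gen.x j))
      (FreeAlgebra.ι ℂ (Gen.x j) * FreeAlgebra.ι ℂ (Gen.x i))
  | d_comm (i j : Fin 2) : Rel W
      (FreeAlgebra.ι ℂ (Gen.d i) * FreeAlgebra.ι ℂ (Gen.d j))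
      (FreeAlgebra.ι ℂ (Gen.d j) * FreeAlgebra.ι ℂ (Gen.d i))
  | d_x (i j : Fin 2) : Rel W
      (FreeAlgebra.ι ℂ (Gen.d i) * FreeAlgebra.ι ℂ (Gen.x j))
      (FreeAlgebra.ι ℂ (Gen.x j) * FreeAlgebra.ι ℂ (Gen.d i) + if i = j then 1 else 0)
  | x_y (i : Fin 2) (h : W i = true) : Rel W
      (FreeAlgebra.ι ℂ (Gen.x i) * FreeAlgebra.ι ℂ (Gen.y i h)) 1
  | y_x (i : Fin 2) (h : W i = true) : Rel W
      (FreeAlgebra.ι ℂ (Gen.y i h) * FreeAlgebra.ι ℂ (Gen.x i)) 1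

/-- The ring `𝒟(W)` of global differential operators on the chart `W`: the Weyl algebra in two
variables, with the coordinates that are nonzero on `W` inverted. -/
def Diff (W : Chart) : Type := RingQuot (Rel W)

instance (W : Chart) : Ring (Diff W) := inferInstanceAs (Ring (RingQuot (Rel W)))

instance (W : Chart) : Algebra ℂ (Diff W) := inferInstanceAs (Algebra ℂ (RingQuot (Rel W)))

/-- The quotient map from the free algebra. -/
def Diff.mk (W : Chart) : FreeAlgebra ℂ (Gen W) →ₐ[ℂ] Diff W := RingQuot.mkAlgHom ℂ (Rel W)

lemma Diff.mk_rel {W : Chart} {a b : FreeAlgebra ℂ (Gen W)} (h : Rel W a b) :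
    Diff.mk W a = Diff.mk W b :=
  RingQuot.mkAlgHom_rel ℂ h

lemma Diff.mk_surjective (W : Chart) : Function.Surjective (Diff.mk W) :=
  RingQuot.mkAlgHom_surjective ℂ (Rel W)

/-- The image of a generator in `𝒟(W)`. -/
def Diff.gen {W : Chart} (g : Gen W) : Diff W := Diff.mk W (FreeAlgebra.ι ℂ g)

/-- The coordinate function `x i`, as a differential operator. -/
def Diff.x {W : Chart} (i : Fin 2) : Diff W := Diff.gen (Gen.x i)

/-- The partial derivative `∂ i`. -/
def Diff.d {W : Chart} (i : Fin 2) : Diff W := Diff.gen (Gen.d i)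

/-- The universal property of `𝒟(W)`: an algebra homomorphism out of it is given by images of the
generators that satisfy the relations. -/
def Diff.lift {W : Chart} {B : Type*} [Semiring B] [Algebra ℂ B] (F : Gen W → B)
    (h : ∀ a b, Rel W a b → FreeAlgebra.lift ℂ F a = FreeAlgebra.lift ℂ F b) : Diff W →ₐ[ℂ] B :=
  RingQuot.liftAlgHom ℂ ⟨FreeAlgebra.lift ℂ F, fun a b hab => h a b hab⟩

lemma Diff.lift_gen {W : Chart} {B : Type*} [Semiring B] [Algebra ℂ B] (F : Gen W → B)
    (h : ∀ a b, Rel W a b → FreeAlgebra.lift ℂ F a = FreeAlgebra.lift ℂ F b) (g : Gen W) :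
    Diff.lift F h (Diff.gen g) = F g := by
  have := RingQuot.liftAlgHom_mkAlgHom_apply ℂ (FreeAlgebra.lift ℂ F)
    (fun a b hab => h a b hab) (FreeAlgebra.ι ℂ g)
  rw [FreeAlgebra.lift_ι_apply] at this
  exact this

/-- The image of a generator under restriction to `W ∩ U`. -/
def Gen.toMeetU {W : Chart} : Gen W → Gen W.meetU
  | .x i => .x i
  | .d i => .d i
  | .y i h => .y i (W.le_meetU i h)

/-- The restriction homomorphism `𝒟(W) → 𝒟(W ∩ U)`. -/
def Diff.res (W : Chart) : Diff W →ₐ[ℂ] Diff W.meetU :=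
  Diff.lift (fun g => Diff.gen g.toMeetU) (by
    have key : ∀ a b, Rel W.meetU a b → Diff.mk W.meetU a = Diff.mk W.meetU b :=
      fun a b hab => Diff.mk_rel hab
    intro a b hab
    cases hab with
    | x_comm i j => simpa [Diff.gen, Gen.toMeetU] using key _ _ (Rel.x_comm i j)
    | d_comm i j => simpa [Diff.gen, Gen.toMeetU] using key _ _ (Rel.d_comm i j)
    | d_x i j =>
      have := key _ _ (Rel.d_x i j)
      split_ifs at this ⊢ <;> simpa [Diff.gen, Gen.toMeetU] using this
    | x_y i h => simpa [Diff.gen, Gen.toMeetU] using key _ _ (Rel.x_y i (W.le_meetU i h))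
    | y_x i h => simpa [Diff.gen, Gen.toMeetU] using key _ _ (Rel.y_x i (W.le_meetU i h)))

/-! ## Duality and the two push-forwards along `j : W ∩ U → W` -/

section Duality

variable (R : Type) [Ring R]

/-- Right multiplication by `r`, an endomorphism of the left `R`-module `R`. -/
def rmul (r : R) : ModuleCat.of R R ⟶ ModuleCat.of R R :=
  ModuleCat.ofHom (LinearMap.toSpanSingleton R R r)

/-- The abelian group `Ext²_R(M, R)`. -/
abbrev ExtTwo (M : ModuleCat.{0} R) : Type := Abelian.Ext M (ModuleCat.of R R) 2

/-- The right `R`-module structure on `Ext²_R(M, R)`, induced by right multiplication on the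
coefficients `R`. -/
instance (M : ModuleCat.{0} R) : Module Rᵐᵒᵖ (ExtTwo R M) where
  smul r α := Abelian.Ext.comp (Y := ModuleCat.of R R) α
    (Abelian.Ext.mk₀ (rmul R r.unop)) (add_zero 2)
  one_smul α := by
    have : rmul R (1 : Rᵐᵒᵖ).unop = 𝟙 _ := by ext; simp [rmul]
    change Abelian.Ext.comp (Y := ModuleCat.of R R) α
      (Abelian.Ext.mk₀ (rmul R (1 : Rᵐᵒᵖ).unop)) (add_zero 2) = α
    rw [this]; exact Abelian.Ext.comp_mk₀_id α
  mul_smul r t α := by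
    have : rmul R (r * t).unop = rmul R t.unop ≫ rmul R r.unop := by
      ext; simp [rmul]
    change Abelian.Ext.comp (Y := ModuleCat.of R R) α
      (Abelian.Ext.mk₀ (rmul R (r * t).unop)) (add_zero 2) =
      Abelian.Ext.comp (Y := ModuleCat.of R R)
        (Abelian.Ext.comp (Y := ModuleCat.of R R) α
          (Abelian.Ext.mk₀ (rmul R t.unop)) (add_zero 2))
        (Abelian.Ext.mk₀ (rmul R r.unop)) (add_zero 2)
    rw [this, ← Abelian.Ext.mk₀_comp_mk₀, Abelian.Ext.comp_assoc_of_third_deg_zero]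
  smul_zero r := Abelian.Ext.zero_comp _ _ _ _ (add_zero 2)
  smul_add r α β := Abelian.Ext.add_comp _ _ _ (add_zero 2)
  add_smul r t α := by
    have : rmul R (r + t).unop = rmul R r.unop + rmul R t.unop := by
      ext; simp [rmul]
    change Abelian.Ext.comp (Y := ModuleCat.of R R) α
      (Abelian.Ext.mk₀ (rmul R (r + t).unop)) (add_zero 2) = _
    rw [this, Abelian.Ext.mk₀_add]; exact Abelian.Ext.comp_add _ _ _ _
  zero_smul α := by
    have : rmul R (0 : Rᵐᵒᵖ).unop = 0 := by ext; simp [rmul]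
    change Abelian.Ext.comp (Y := ModuleCat.of R R) α
      (Abelian.Ext.mk₀ (rmul R (0 : Rᵐᵒᵖ).unop)) (add_zero 2) = 0
    rw [this, Abelian.Ext.mk₀_zero]; exact Abelian.Ext.comp_zero _ _ _ _ _

/-- The duality `𝔻(M) = Ext²_R(M, R)` (a right `R`-module), for `R` the ring of differential
operators of an affine surface and `M` holonomic. -/
def dual (M : ModuleCat.{0} R) : ModuleCat.{0} Rᵐᵒᵖ := ModuleCat.of Rᵐᵒᵖ (ExtTwo R M)

/-- Functoriality of the duality: precomposition. -/
def dualMap {M N : ModuleCat.{0} R} (f : M ⟶ N) : dual R N ⟶ dual R M :=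
  ModuleCat.ofHom (X := ExtTwo R N) (Y := ExtTwo R M)
    { toFun := fun α => Abelian.Ext.comp (Abelian.Ext.mk₀ f) α (zero_add 2)
      map_add' := fun _ _ => Abelian.Ext.comp_add _ _ _ _
      map_smul' := fun r α => (Abelian.Ext.comp_assoc (Abelian.Ext.mk₀ f) α
        (Abelian.Ext.mk₀ (rmul R r.unop)) (zero_add 2) (add_zero 2) rfl).symm }

end Duality

/-- The `+`-pushforward `j₊` along the affine open embedding `j : W ∩ U → W`: restriction of
scalars along `𝒟(W) → 𝒟(W ∩ U)`. -/
def jPlus (W : Chart) (M : ModuleCat.{0} (Diff W.meetU)) : ModuleCat.{0} (Diff W) :=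
  (ModuleCat.restrictScalars (Diff.res W).toRingHom).obj M

/-- `j₊` on morphisms. -/
def jPlusMap (W : Chart) {M N : ModuleCat.{0} (Diff W.meetU)} (f : M ⟶ N) :
    jPlus W M ⟶ jPlus W N :=
  (ModuleCat.restrictScalars (Diff.res W).toRingHom).map f

/-- The `!`-pushforward `j_! = 𝔻_W ∘ j₊ ∘ 𝔻_{W ∩ U}` along `j : W ∩ U → W`.  The inner dual is a
right `𝒟(W ∩ U)`-module, `j₊` restricts it to a right `𝒟(W)`-module, and the outer dual is a
left `𝒟(W)`-module. -/
def jShriek (W : Chart) (M : ModuleCat.{0} (Diff W.meetU)) : ModuleCat.{0} (Diff W) :=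
  (ModuleCat.restrictScalars (RingEquiv.opOp (Diff W)).toRingHom).obj
    (dual (Diff W)ᵐᵒᵖ
      ((ModuleCat.restrictScalars (RingHom.op (Diff.res W).toRingHom)).obj
        (dual (Diff W.meetU) M)))

/-- `j_!` on morphisms. -/
def jShriekMap (W : Chart) {M N : ModuleCat.{0} (Diff W.meetU)} (f : M ⟶ N) :
    jShriek W M ⟶ jShriek W N :=
  (ModuleCat.restrictScalars (RingEquiv.opOp (Diff W)).toRingHom).map
    (dualMap (Diff W)ᵐᵒᵖ
      ((ModuleCat.restrictScalars (RingHom.op (Diff.res W).toRingHom)).map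
        (dualMap (Diff W.meetU) f)))

/-! ## The deformed structure sheaf -/

/-- Exponents of the monomials `x₁^a x₂^b` that are regular on the chart `W`. -/
abbrev Expo (W : Chart) : Type := {e : Fin 2 → ℤ // ∀ i, W i = false → 0 ≤ e i}

/-- Raise the exponent of `x i` by one. -/
def Expo.up {W : Chart} (i : Fin 2) (e : Expo W) : Expo W :=
  ⟨e.1 + Pi.single i 1, fun k hk => by
    have h0 := e.2 k hk
    have h1 : (0 : ℤ) ≤ (Pi.single i 1 : Fin 2 → ℤ) k := by
      by_cases h : k = i
      · subst h; simp
      · simp [h]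
    simpa using add_nonneg h0 h1⟩

/-- Lower the exponent of `x i` by one when the result is regular on `W`, and leave it unchanged
otherwise (in the formulas below the second case occurs with coefficient `0` only). -/
def Expo.down {W : Chart} (i : Fin 2) (e : Expo W) : Expo W :=
  if h : W i = false → 1 ≤ e.1 i then
    ⟨e.1 - Pi.single i 1, fun k hk => by
      by_cases hki : k = i
      · subst hki
        have := h hk
        simp only [Pi.sub_apply, Pi.single_eq_same]
        omega
      · simpa [hki] using e.2 k hk⟩
  else e

lemma Expo.down_up {W : Chart} (i : Fin 2) (e : Expo W) : (e.up i).down i = e := by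
  have h : W i = false → 1 ≤ (e.up i).1 i := fun hi => by
    have := e.2 i hi
    simp only [Expo.up, Pi.add_apply, Pi.single_eq_same]
    omega
  rw [Expo.down, dif_pos h]
  apply Subtype.ext
  simp [Expo.up]

lemma Expo.up_down {W : Chart} (i : Fin 2) (e : Expo W) (h : W i = false → 1 ≤ e.1 i) :
    (e.down i).up i = e := by
  rw [Expo.down, dif_pos h]
  apply Subtype.ext
  simp [Expo.up]

lemma Expo.up_comm {W : Chart} (i j : Fin 2) (e : Expo W) :
    (e.up i).up j = (e.up j).up i := by
  apply Subtype.ext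
  simp [Expo.up, add_right_comm]

lemma Expo.down_up_of_ne {W : Chart} {i j : Fin 2} (hij : i ≠ j) (e : Expo W) :
    (e.up j).down i = (e.down i).up j := by
  have hc : (e.up j).1 i = e.1 i := by simp [Expo.up, hij]
  by_cases h : W i = false → 1 ≤ e.1 i
  · have h' : W i = false → 1 ≤ (e.up j).1 i := by rwa [hc]
    rw [Expo.down, dif_pos h', Expo.down, dif_pos h]
    apply Subtype.ext
    simp [Expo.up, sub_add_eq_add_sub]
  · have h' : ¬ (W i = false → 1 ≤ (e.up j).1 i) := by rwa [hc]
    rw [Expo.down, dif_neg h', Expo.down, dif_neg h]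

lemma Expo.down_apply_of_ne {W : Chart} {i j : Fin 2} (hij : i ≠ j) (e : Expo W) :
    (e.down i).1 j = e.1 j := by
  unfold Expo.down
  split_ifs
  · simp [Ne.symm hij]
  · rfl

lemma Expo.down_pos {W : Chart} {i : Fin 2} {e : Expo W} (h : W i = false → 1 ≤ e.1 i) :
    (e.down i).1 = e.1 - Pi.single i 1 := by
  rw [Expo.down, dif_pos h]

lemma Expo.down_neg {W : Chart} {i : Fin 2} {e : Expo W} (h : ¬ (W i = false → 1 ≤ e.1 i)) :
    e.down i = e := by
  rw [Expo.down, dif_neg h]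

lemma Expo.down_comm {W : Chart} (i j : Fin 2) (e : Expo W) :
    (e.down i).down j = (e.down j).down i := by
  by_cases hij : i = j
  · rw [hij]
  by_cases hi : W i = false → 1 ≤ e.1 i <;> by_cases hj : W j = false → 1 ≤ e.1 j
  · have hi' : W i = false → 1 ≤ (e.down j).1 i := by rwa [Expo.down_apply_of_ne (Ne.symm hij)]
    have hj' : W j = false → 1 ≤ (e.down i).1 j := by rwa [Expo.down_apply_of_ne hij]
    apply Subtype.ext
    rw [Expo.down_pos hj', Expo.down_pos hi', Expo.down_pos hi, Expo.down_pos hj]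
    abel
  · have hj' : ¬ (W j = false → 1 ≤ (e.down i).1 j) := by rwa [Expo.down_apply_of_ne hij]
    rw [Expo.down_neg hj', Expo.down_neg hj]
  · have hi' : ¬ (W i = false → 1 ≤ (e.down j).1 i) := by
      rwa [Expo.down_apply_of_ne (Ne.symm hij)]
    rw [Expo.down_neg hi', Expo.down_neg hi]
  · rw [Expo.down_neg hi, Expo.down_neg hj, Expo.down_neg hi]

section Twist

variable (W : Chart) (B : Type) [CommRing B] [Algebra ℂ B] (σ : B)

/-- The free rank one `𝒪(W ∩ U) ⊗ B`-module `(𝒪(W ∩ U) ⊗ B) t^σ`, for a `ℂ`-algebra `B` and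
`σ ∈ B`: finite sums of terms `b x₁^a x₂^c t^σ`, with `b ∈ B` and `x₁^a x₂^c` regular on `W ∩ U`.
Its `𝒟(W ∩ U)`-module structure below is the one with `∂₁ t^σ = 0` and
`∂₂ t^σ = σ x₂⁻¹ t^σ`. -/
@[nolint unusedArguments]
def Twist (_σ : B) : Type := Expo W.meetU →₀ B

instance : AddCommGroup (Twist W B σ) := inferInstanceAs (AddCommGroup (Expo W.meetU →₀ B))

/-- The action of the generators of `𝒟(W ∩ U)` on `(𝒪(W ∩ U) ⊗ B) t^σ`: a derivative `∂ i` sends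
the term `b x₁^a x₂^c t^σ` with exponent `e = (a, c)` to `(e i + σ) b` (for `i = 1`), resp.
`(e i) b` (for `i = 0`), times the monomial with `e i` lowered by one. -/
def twistGen : Gen W.meetU → Module.End ℂ (Expo W.meetU →₀ B)
  | .x i => Finsupp.lmapDomain B ℂ (Expo.up i)
  | .y i _ => Finsupp.lmapDomain B ℂ (Expo.down i)
  | .d i => Finsupp.lsum ℂ fun e =>
      (Finsupp.lsingle (Expo.down i e)).comp
        (LinearMap.mulLeft ℂ ((e.1 i : B) + if i = 1 then σ else 0))

lemma twistGen_x (i : Fin 2) (e : Expo W.meetU) (c : B) :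
    twistGen W B σ (.x i) (Finsupp.single e c) = Finsupp.single (e.up i) c := by
  simp [twistGen, Finsupp.mapDomain_single]

lemma twistGen_y (i : Fin 2) (h : W.meetU i = true) (e : Expo W.meetU) (c : B) :
    twistGen W B σ (.y i h) (Finsupp.single e c) = Finsupp.single (e.down i) c := by
  simp [twistGen, Finsupp.mapDomain_single]

lemma twistGen_d (i : Fin 2) (e : Expo W.meetU) (c : B) :
    twistGen W B σ (.d i) (Finsupp.single e c) =
      Finsupp.single (e.down i) (((e.1 i : B) + if i = 1 then σ else 0) * c) := by
  simp only [twistGen, Finsupp.lsum_single, LinearMap.comp_apply, LinearMap.mulLeft_apply,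
    Finsupp.lsingle_apply]

/-- The action of `𝒟(W ∩ U)` on `(𝒪(W ∩ U) ⊗ B) t^σ`. -/
def twistHom : Diff W.meetU →ₐ[ℂ] Module.End ℂ (Expo W.meetU →₀ B) :=
  Diff.lift (twistGen W B σ) (by
    intro a b hab
    cases hab with
    | x_comm i j =>
      refine Finsupp.lhom_ext fun e c => ?_
      simp only [map_mul, FreeAlgebra.lift_ι_apply, Module.End.mul_apply, twistGen_x,
        Expo.up_comm i j]
    | d_comm i j =>
      refine Finsupp.lhom_ext fun e c => ?_
      by_cases hij : i = j
      · rw [hij]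
      simp only [map_mul, FreeAlgebra.lift_ι_apply, Module.End.mul_apply, twistGen_d,
        Expo.down_comm i j, Expo.down_apply_of_ne hij, Expo.down_apply_of_ne (Ne.symm hij)]
      rw [mul_left_comm]
    | d_x i j =>
      refine Finsupp.lhom_ext fun e c => ?_
      by_cases hij : i = j
      · subst hij
        have hup : ((e.up i).1 i : B) = e.1 i + 1 := by simp [Expo.up]
        simp only [map_mul, map_add, if_true, map_one, FreeAlgebra.lift_ι_apply,
          Module.End.mul_apply, LinearMap.add_apply, Module.End.one_apply, twistGen_x, twistGen_d,
          Expo.down_up, hup]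
        by_cases h : W.meetU i = false → 1 ≤ e.1 i
        · rw [Expo.up_down i e h, ← Finsupp.single_add]
          congr 1
          ring
        · push Not at h
          have hi : i ≠ 1 := by
            rintro rfl
            simp [Chart.meetU] at h
          have h0 : e.1 i = 0 := by
            have := e.2 i h.1
            omega
          simp [hi, h0]
      · have hup : (e.up j).1 i = e.1 i := by simp [Expo.up, hij]
        simp only [map_mul, add_zero, if_neg hij, FreeAlgebra.lift_ι_apply,
          Module.End.mul_apply, twistGen_x, twistGen_d, Expo.down_up_of_ne hij, hup]
    | x_y i h =>
      refine Finsupp.lhom_ext fun e c => ?_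
      have := Expo.up_down i e (fun h' => by simp [h] at h')
      simp only [map_mul, map_one, FreeAlgebra.lift_ι_apply, Module.End.mul_apply,
        Module.End.one_apply, twistGen_x, twistGen_y, this]
    | y_x i h =>
      refine Finsupp.lhom_ext fun e c => ?_
      simp only [map_mul, map_one, FreeAlgebra.lift_ι_apply, Module.End.mul_apply,
        Module.End.one_apply, twistGen_x, twistGen_y, Expo.down_up])

instance : Module (Diff W.meetU) (Twist W B σ) :=
  Module.compHom (Expo W.meetU →₀ B) (twistHom W B σ).toRingHom

lemma twistHom_gen (g : Gen W.meetU) : twistHom W B σ (Diff.gen g) = twistGen W B σ g :=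
  Diff.lift_gen _ _ g

variable {B σ} {B' : Type} [CommRing B'] [Algebra ℂ B'] {σ' : B'}

lemma twist_coeff_comm (f : B →ₗ[ℂ] B') (hf : ∀ b, f (σ * b) = σ' * f b) (θ : Diff W.meetU)
    (v : Expo W.meetU →₀ B) :
    Finsupp.mapRange.linearMap f (twistHom W B σ θ v) =
      twistHom W B' σ' θ (Finsupp.mapRange.linearMap f v) := by
  obtain ⟨a, rfl⟩ := Diff.mk_surjective W.meetU θ
  induction a using FreeAlgebra.induction generalizing v with
  | grade0 r => simp [map_smul, Algebra.algebraMap_eq_smul_one]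
  | grade1 g =>
    have h1 : Diff.mk W.meetU (FreeAlgebra.ι ℂ g) = Diff.gen g := rfl
    rw [h1, twistHom_gen, twistHom_gen]
    induction v using Finsupp.induction_linear with
    | zero => simp
    | add v w hv hw => simp only [map_add, hv, hw]
    | single e c =>
      cases g with
      | x i => simp [twistGen_x]
      | y i h => simp [twistGen_y]
      | d i =>
        have hz : f ((e.1 i : B) * c) = (e.1 i : B') * f c := by
          rw [← zsmul_eq_mul, ← zsmul_eq_mul, map_zsmul]
        simp only [twistGen_d, Finsupp.mapRange.linearMap_apply, Finsupp.mapRange_single]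
        by_cases hi : i = 1
        · rw [if_pos hi, if_pos hi, add_mul, add_mul, map_add, hz, hf]
        · rw [if_neg hi, if_neg hi, add_zero, add_zero, hz]
  | mul a b ha hb => simp only [map_mul, Module.End.mul_apply, ha, hb]
  | add a b ha hb => simp only [map_add, LinearMap.add_apply, ha, hb]

/-- A `ℂ`-linear map `f : B → B'` of coefficients with `f (σ b) = σ' f b` induces a map
`(𝒪(W ∩ U) ⊗ B) t^σ → (𝒪(W ∩ U) ⊗ B') t^σ'` of `𝒟(W ∩ U)`-modules. -/
def twistMap (f : B →ₗ[ℂ] B') (hf : ∀ b, f (σ * b) = σ' * f b) :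
    Twist W B σ →ₗ[Diff W.meetU] Twist W B' σ' where
  toFun v := Finsupp.mapRange.linearMap (α := Expo W.meetU) f v
  map_add' v w := map_add (Finsupp.mapRange.linearMap (α := Expo W.meetU) f) v w
  map_smul' θ v := twist_coeff_comm W f hf θ v

end Twist

/-- The truncated polynomial ring `ℂ[s]/s^n`. -/
abbrev Trunc (n : ℕ) : Type := ℂ[X] ⧸ Ideal.span {(Polynomial.X : ℂ[X]) ^ n}

/-- The element `s` of `ℂ[s]/s^n`. -/
def Trunc.s (n : ℕ) : Trunc n := Ideal.Quotient.mk _ Polynomial.X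

/-- The evaluation `ℂ[s]/s^n → ℂ`, `s ↦ 0`, for `n ≠ 0`. -/
def Trunc.eval (n : ℕ) (hn : n ≠ 0) : Trunc n →ₐ[ℂ] ℂ :=
  Ideal.Quotient.liftₐ _ (Polynomial.aeval (0 : ℂ)) (fun a ha => by
    obtain ⟨q, rfl⟩ := Ideal.mem_span_singleton'.1 ha
    simp [hn])

/-- The structure sheaf `𝒪_U`, restricted to the chart `W`. -/
def OU (W : Chart) : ModuleCat.{0} (Diff W.meetU) := ModuleCat.of _ (Twist W ℂ 0)

/-- The deformed structure sheaf `f^s 𝒪_U^{(n)} = (𝒪_U ⊗ ℂ[s]/s^n) t^s` for `f = x₂`, restricted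
to the chart `W`. -/
def fsO (W : Chart) (n : ℕ) : ModuleCat.{0} (Diff W.meetU) :=
  ModuleCat.of _ (Twist W (Trunc n) (Trunc.s n))

/-- Multiplication by `b ∈ ℂ[s]/s^n` on `f^s 𝒪_U^{(n)}`. -/
def fsMul (W : Chart) (n : ℕ) (b : Trunc n) : fsO W n ⟶ fsO W n :=
  ModuleCat.ofHom (twistMap W (LinearMap.mulLeft ℂ b) (fun c => by simp [mul_left_comm]))

/-- Reduction modulo `s`, `f^s 𝒪_U^{(n)} → 𝒪_U`. -/
def fsRed (W : Chart) (n : ℕ) (hn : n ≠ 0) : fsO W n ⟶ OU W :=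
  ModuleCat.ofHom (twistMap W (Trunc.eval n hn).toLinearMap (fun c => by
    simp [Trunc.eval, Trunc.s]))

/-- Multiplication by `b ∈ ℂ[s]/s^n` on `j_! f^s 𝒪_U^{(n)}`. -/
def mulShriek (W : Chart) (n : ℕ) (b : Trunc n) :
    jShriek W (fsO W n) →ₗ[Diff W] jShriek W (fsO W n) :=
  (jShriekMap W (fsMul W n b)).hom

/-- Multiplication by `b ∈ ℂ[s]/s^n` on `j₊ f^s 𝒪_U^{(n)}`. -/
def mulPlus (W : Chart) (n : ℕ) (b : Trunc n) :
    jPlus W (fsO W n) →ₗ[Diff W] jPlus W (fsO W n) :=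
  (jPlusMap W (fsMul W n b)).hom

/-- The endomorphism `s` of `j_! f^s 𝒪_U^{(n)}`. -/
def sShriek (W : Chart) (n : ℕ) : jShriek W (fsO W n) →ₗ[Diff W] jShriek W (fsO W n) :=
  mulShriek W n (Trunc.s n)

/-- The endomorphism `s` of `j₊ f^s 𝒪_U^{(n)}`. -/
def sPlus (W : Chart) (n : ℕ) : jPlus W (fsO W n) →ₗ[Diff W] jPlus W (fsO W n) :=
  mulPlus W n (Trunc.s n)

/-- The reduction map `j_! f^s 𝒪_U^{(n)} → j_! 𝒪_U`. -/
def redShriek (W : Chart) (n : ℕ) (hn : n ≠ 0) :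
    jShriek W (fsO W n) →ₗ[Diff W] jShriek W (OU W) :=
  (jShriekMap W (fsRed W n hn)).hom

/-! ## The canonical map, the maximal extension and the two filtrations -/

/-- A canonical map `can : j_! f^s 𝒪_U^{(n)} → j₊ f^s 𝒪_U^{(n)}`: a `𝒟(W)`-linear map that
commutes with `s` and restricts to an isomorphism on `W ∩ U = {x₂ ≠ 0}`, i.e. whose kernel and
cokernel are `x₂`-power torsion.  The map which restricts to the identity of `f^s 𝒪_U^{(n)}` is
one of these, and these maps are unique up to the automorphisms of `f^s 𝒪_U^{(n)}`, that is, up to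
units of `ℂ[s]/s^n`. -/
structure CanonicalMap (W : Chart) (n : ℕ) where
  toLin : jShriek W (fsO W n) →ₗ[Diff W] jPlus W (fsO W n)
  comm : ∀ v, toLin (sShriek W n v) = sPlus W n (toLin v)
  torsion_ker : ∀ v, toLin v = 0 → ∃ k : ℕ, (Diff.x 1 : Diff W) ^ k • v = 0
  torsion_coker : ∀ w, ∃ (k : ℕ) (v : jShriek W (fsO W n)), toLin v = (Diff.x 1 : Diff W) ^ k • w

/-- The quotient `j_! f^s 𝒪_U^{(n)} / s j_! f^s 𝒪_U^{(n)}`. -/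
abbrev ShriekModS (W : Chart) (n : ℕ) : Type :=
  (jShriek W (fsO W n)) ⧸ LinearMap.range (sShriek W n)

namespace CanonicalMap

variable {W : Chart} {n : ℕ} (can : CanonicalMap W n)

/-- The map `s¹(n) = s ∘ can`. -/
def s1 : jShriek W (fsO W n) →ₗ[Diff W] jPlus W (fsO W n) := sPlus W n ∘ₗ can.toLin

/-- The cokernel `Ξ` of `s¹(n)`; for `n ≥ 2` this is the maximal extension of `𝒪_U`. -/
abbrev Xi : Type := (jPlus W (fsO W n)) ⧸ LinearMap.range can.s1

/-- The endomorphism `s` of `Ξ`. -/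
def sXi : can.Xi →ₗ[Diff W] can.Xi :=
  Submodule.mapQ _ _ (sPlus W n) (by
    rintro _ ⟨v, rfl⟩
    exact ⟨sShriek W n v, by simp [s1, can.comm]⟩)

/-- The map `j_! f^s 𝒪_U^{(n)} / s j_! f^s 𝒪_U^{(n)} → Ξ` induced by `can`. -/
def canBar : ShriekModS W n →ₗ[Diff W] can.Xi :=
  Submodule.mapQ _ _ can.toLin (by
    rintro _ ⟨v, rfl⟩
    exact ⟨v, by simp [s1, can.comm]⟩)

/-- The algebraic Jantzen filtration of `j_! f^s 𝒪_U^{(n)} / s j_! f^s 𝒪_U^{(n)}`: pull back the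
filtration of `j₊ f^s 𝒪_U^{(n)}` by powers of `s` along `can`, and take images in the quotient. -/
def algFiltration (i : ℕ) : Submodule (Diff W) (ShriekModS W n) :=
  ((LinearMap.range (sPlus W n ^ i)).comap can.toLin).map (Submodule.mkQ _)

end CanonicalMap

/-- `μ` is a monodromy filtration of the (nilpotent) endomorphism `s` of `M`: a finite increasing
filtration by submodules with `s μ^n ⊆ μ^{n-2}`, such that for all `k ∈ ℕ` the map
`s^k : μ^k / μ^{k-1} → μ^{-k} / μ^{-k-1}` is injective and surjective. -/
structure IsMonodromyFiltration {R M : Type} [Ring R] [AddCommGroup M] [Module R M]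
    (s : M →ₗ[R] M) (μ : ℤ → Submodule R M) : Prop where
  mono : Monotone μ
  exists_eq_bot : ∃ m, μ m = ⊥
  exists_eq_top : ∃ m, μ m = ⊤
  map_le : ∀ m, (μ m).map s ≤ μ (m - 2)
  gr_injective : ∀ k : ℕ, ∀ v ∈ μ k, (s ^ k) v ∈ μ (-k - 1) → v ∈ μ (k - 1)
  gr_surjective : ∀ k : ℕ, ∀ w ∈ μ (-k), ∃ v ∈ μ k, w - (s ^ k) v ∈ μ (-k - 1)

/-! ## The action of `𝔰𝔩₂` on global sections -/

/-- The Lie algebra `𝔰𝔩₂(ℂ)`. -/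
abbrev G : Type := LieAlgebra.SpecialLinear.sl (Fin 2) ℂ

/-- The universal enveloping algebra of `𝔰𝔩₂(ℂ)`. -/
abbrev UG : Type := UniversalEnvelopingAlgebra ℂ G

/-- The inclusion of `𝔰𝔩₂(ℂ)` in its enveloping algebra. -/
def toUG (X : G) : UG := UniversalEnvelopingAlgebra.ι ℂ X

/-- The vector field `L_X` on the plane obtained by differentiating the action of `SL₂`, i.e.
`(L_X φ)(v) = d/dt φ(exp(-tX) v)` at `t = 0`.  Thus `L_e = -x₂ ∂₁`, `L_f = -x₁ ∂₂` and
`L_h = -x₁ ∂₁ + x₂ ∂₂`. -/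
def vf (X : G) : Diff Chart.plane := -∑ i, ∑ j, X.1 i j • (Diff.x j * Diff.d i)

/-- The Euler operator `R_h = x₁ ∂₁ + x₂ ∂₂`, obtained by differentiating the right action of the
torus `H` on `X̃`. -/
def euler : Diff Chart.plane := ∑ i, Diff.x i * Diff.d i

/-! ## Deformed Verma modules and deformed dual Verma modules -/

section Verma

variable (B : Type) [CommRing B] [Algebra ℂ B] (σ : B) (lam : ℂ)

/-- The value at `X` of the weight `lam + σ` of `𝔥` with values in `B` (that is, `h ↦ lam + σ`),
extended to the Borel subalgebras by reading off the diagonal part of `X`. -/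
def wt (X : G) : B := algebraMap ℂ B (X.1 0 0) * (algebraMap ℂ B lam + σ)

/-- The left ideal of `B ⊗ U(𝔤)` generated by the elements `X - (lam + σ)(X)`, for `X` in the
upper triangular Borel subalgebra `𝔟`. -/
def vermaIdeal : Ideal (B ⊗[ℂ] UG) :=
  Ideal.span {z | ∃ X : G, X.1 1 0 = 0 ∧ z = 1 ⊗ₜ[ℂ] toUG X - wt B σ lam X ⊗ₜ[ℂ] 1}

/-- The deformed Verma module `U(𝔤) ⊗_{U(𝔟)} B_lam`, where `𝔟` acts on `B_lam = B` through
`h ↦ lam + σ`.  A `(𝔤, B)`-bimodule is a module over `B ⊗ U(𝔤)`, and the tensor product over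
`U(𝔟)` is the quotient of `B ⊗ U(𝔤)` by the left ideal above. -/
abbrev Verma : Type := (B ⊗[ℂ] UG) ⧸ vermaIdeal B σ lam

/-- The highest weight generator `1 ⊗ 1`. -/
def Verma.gen : Verma B σ lam := Submodule.Quotient.mk 1

variable {B σ lam} in
/-- The action of `X ∈ 𝔤` on a deformed Verma module. -/
def lieVerma (X : G)
    (m : Verma B σ lam) : Verma B σ lam :=
  ((1 : B) ⊗ₜ[ℂ] toUG X) • m

variable {B σ lam} in
/-- The action of coefficients `b ∈ B` on a deformed Verma module. -/
def coeffVerma (b : B)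
    (m : Verma B σ lam) : Verma B σ lam :=
  (b ⊗ₜ[ℂ] (1 : UG)) • m

/-- `Hom_{U(𝔟̄)}(U(𝔤), B_lam)`, where the lower triangular Borel subalgebra `𝔟̄` acts on
`B_lam = B` through `h ↦ lam + σ`. -/
def coinduced : Submodule B (UG →ₗ[ℂ] B) where
  carrier := {φ | ∀ X : G, X.1 0 1 = 0 → ∀ u, φ (toUG X * u) = wt B σ lam X * φ u}
  add_mem' := fun hφ hφ' X hX u => by simp [hφ X hX u, hφ' X hX u, mul_add]
  zero_mem' := fun X _ u => by simp
  smul_mem' := fun b φ hφ X hX u => by simp [hφ X hX u, mul_left_comm]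

/-- The deformed weight space of weight `μ` in the coinduced module, whose `𝔤`-action is
`(X φ)(u) = φ(u X)`: the elements `φ` with `(H - μ(H)) φ = μ₀(H) σ φ` for `H ∈ 𝔥`, where
`μ₀(h) = 1`. -/
def weightSpace (μ : ℂ) : Submodule B (UG →ₗ[ℂ] B) where
  carrier := {φ | φ ∈ coinduced B σ lam ∧
    ∀ H : G, H.1 0 1 = 0 → H.1 1 0 = 0 → ∀ u, φ (u * toUG H) = wt B σ μ H * φ u}
  add_mem' := fun hφ hφ' => ⟨add_mem hφ.1 hφ'.1, fun H h1 h2 u => by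
    simp [hφ.2 H h1 h2 u, hφ'.2 H h1 h2 u, mul_add]⟩
  zero_mem' := ⟨zero_mem _, fun H _ _ u => by simp⟩
  smul_mem' := fun b φ hφ => ⟨Submodule.smul_mem _ b hφ.1, fun H h1 h2 u => by
    simp [hφ.2 H h1 h2 u, mul_left_comm]⟩

/-- The deformed dual Verma module: the sum of the deformed weight spaces of the coinduced
module. -/
def dualVerma : Submodule B (UG →ₗ[ℂ] B) := ⨆ μ : ℂ, weightSpace B σ lam μ

/-- `ψ` is the canonical homomorphism of `(𝔤, B)`-bimodules from the deformed Verma module to the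
deformed dual Verma module: the one that corresponds to `1` under the isomorphism `Hom ≃ B` given
by `ψ ↦ ψ(1 ⊗ 1)(1)`. -/
structure IsCanonicalHom (ψ : Verma B σ lam →+ dualVerma B σ lam) : Prop where
  map_coeff : ∀ b m, ψ (coeffVerma b m) = b • ψ m
  map_lie : ∀ X m u, (ψ (lieVerma X m)).1 u = (ψ m).1 (u * toUG X)
  map_gen : (ψ (Verma.gen B σ lam)).1 1 = 1

variable {B σ}

/-- Change of coefficients between deformed Verma modules. -/
def Verma.baseChange {B' : Type} [CommRing B'] [Algebra ℂ B'] {σ' : B'} (f : B →ₐ[ℂ] B')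
    (hf : f σ = σ') :
    Verma B σ lam →ₛₗ[(Algebra.TensorProduct.map f (AlgHom.id ℂ UG)).toRingHom]
      Verma B' σ' lam :=
  Submodule.mapQ _ _ (RingHom.toSemilinearMap
      (Algebra.TensorProduct.map f (AlgHom.id ℂ UG)).toRingHom) (by
    refine Submodule.span_le.2 ?_
    rintro _ ⟨X, hX, rfl⟩
    refine Submodule.subset_span ⟨X, hX, ?_⟩
    change (Algebra.TensorProduct.map f (AlgHom.id ℂ UG)) _ = _
    rw [map_sub, Algebra.TensorProduct.map_tmul, Algebra.TensorProduct.map_tmul]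
    simp [wt, hf])

end Verma

instance : (Ideal.span {(Polynomial.X : ℂ[X])}).IsPrime :=
  (Ideal.span_singleton_prime Polynomial.X_ne_zero).2 Polynomial.prime_X

/-- The local ring `A = ℂ[s]_{(s)}`. -/
abbrev A : Type := Localization.AtPrime (Ideal.span {(Polynomial.X : ℂ[X])})

/-- The parameter `s` of `A`. -/
def A.s : A := algebraMap ℂ[X] A Polynomial.X

/-- The reduction `A → ℂ`, `s ↦ 0`. -/
def A.eval : A →ₐ[ℂ] ℂ :=
  IsLocalization.liftAlgHom (M := (Ideal.span {(Polynomial.X : ℂ[X])}).primeCompl)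
    (f := Polynomial.aeval (0 : ℂ)) (by
      rintro ⟨y, hy⟩
      refine IsUnit.mk0 _ fun h => hy (Ideal.mem_span_singleton.2 ?_)
      rw [Polynomial.X_dvd_iff, Polynomial.coeff_zero_eq_aeval_zero]
      exact h)

lemma A.eval_s : A.eval A.s = 0 := by
  simp [A.eval, A.s]

/-- The Verma module `M(lam) = U(𝔤) ⊗_{U(𝔟)} ℂ_lam`. -/
abbrev M (lam : ℂ) : Type := Verma ℂ 0 lam

/-- The deformed Verma module `M_A(lam)`. -/
abbrev MA (lam : ℂ) : Type := Verma A A.s lam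

/-- The deformed dual Verma module `I_A(lam)`. -/
abbrev IA (lam : ℂ) : Type := dualVerma A A.s lam

/-- The reduction map `red : M_A(lam) → M(lam)`, `s ↦ 0`. -/
def redVerma (lam : ℂ) (m : MA lam) : M lam := Verma.baseChange lam A.eval A.eval_s m

/-- The algebraic Jantzen filtration of `M(lam)` obtained from a homomorphism
`ψ : M_A(lam) → I_A(lam)`: the image under `red` of `{m | ψ m ∈ s^i I_A(lam)}`. -/
def jantzen {lam : ℂ} (ψ : MA lam →+ IA lam) (i : ℕ) : Set (M lam) :=
  redVerma lam '' {m | ∃ φ : IA lam, ψ m = A.s ^ i • φ}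

end Jantzen

/-!
Every construction in the statement has an explicit form on the affine charts.

**The push-forward `j_!`.** For `B = ℂ[s] / s^n` with `σ` the class of `s`, the module `(𝒪(W ∩ U)
⊗ B) t^σ` is `𝒟 / (𝒟 ∂₁ + 𝒟 θ₂ⁿ)` with `θ₂ = x₂ ∂₂` and `𝒟 = 𝒟(W ∩ U)`. The elements `∂₁` and
`θ₂ⁿ` commute and form a regular sequence, so the Koszul complex is a free resolution
(`KoszulPresentation`, `twistKoszul`), and `Ext²` into `𝒟` is `𝒟 / (∂₁ 𝒟 + θ₂ⁿ 𝒟)`. Transposition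
of differential operators turns this into the left module generated by `x₂⁻¹ t^σ`. Since the
operators `x₂^k` and `∂₂^k` move `x₂⁻¹ t^σ` to multiples of the other monomials by units of `B`,
this module is still cyclic over `𝒟(W)`, with the same two relations (`dualKoszul`). Dualizing
once more gives `j_! f^s 𝒪_U^{(n)} = 𝒟(W) / (𝒟(W) ∂₁ + 𝒟(W) θ₂ⁿ)` (`toShriek_eq_zero_iff`).

**Lifting to `A = ℂ[s]_{(s)}`.** Let `L = (𝒪(W ∩ U) ⊗ A) t^s`. The module `j₊ f^s 𝒪_U^{(n)}` is `L
/ s^n L`. The generator `t^s` satisfies `∂₂ t^s = s x₂⁻¹ t^s`, and repeated differentiation only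
adds the units `s - 1, s - 2, …` of `A`; so where `x₂` is not inverted the submodule generated by
`t^s` is the `lattice` of those elements of `L` whose coefficients at negative powers of `x₂` are
divisible by `s`. By the presentation above, `j_! f^s 𝒪_U^{(n)}` is `lattice / s^n lattice`
(`latticeProj_eq_zero_iff`). A canonical map must send `t^s` to a multiple of `t^s`, which is a
unit multiple because the map is an isomorphism over `U`; hence it is the inclusion of the lattice
in `L`, up to a unit of `ℂ[s] / s^n` (`CanonicalMap.exists_unit_latticeProj`).

**The monodromy filtration.** From `s L ⊆ lattice ⊆ L` it follows that `s² = 0` on `Ξ`. The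
monodromy filtration of an endomorphism of square zero is `0 ⊆ im s ⊆ ker s ⊆ Ξ` in degrees `-2,
-1, 0, 1` (`IsMonodromyFiltration.eq_squareZero`), and the image of the algebraic Jantzen
filtration is `ker s`, `im s` and `0` in degrees `0`, `1` and above
(`CanonicalMap.Tame.map_algFiltration`).

**Verma modules.** Over the plane, let `line A l` be the submodule of `L` spanned by the monomials
`x₁^k x₂^(l-k) t^s`. Sending `v` to the function `u ↦ (coefficient of x₂^l t^s in u v)` identifies
it with the deformed dual Verma module (`lineEquiv`), and sending the generator to `x₂^l t^s` maps
the deformed Verma module to it (`vermaFun`); the composite is the canonical homomorphism `ψ`. As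
`f^k x₂^l t^s` is the product of the `-(l - j + s)` for `j < k` times `x₁^k x₂^(l-k) t^s`, and
only the factor with `j = l` is not a unit, the Verma module embeds onto `lattice ∩ line A l` when
`l ≥ 0`; when `l < 0` all the factors are units and this holds after multiplication by `s`
(`exists_unit_fCoeff`, `exists_vermaFun_eq`). So in these terms the canonical map is `s^ε ψ`.
Modulo `s^n`, every eigenvector of the Euler operator for `l + s` comes from `line A l`, because
`d - l` is invertible in `A` for the degrees `d ≠ l` (`exists_line_part`). This identifies the
`l`-parts of the global sections with `lattice ∩ line A l` and `line A l` modulo `s^n`, and the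
Jantzen filtrations are compared by divisibility of coefficients.
-/

namespace Jantzen

/-! ### Koszul presentations and the second Ext group -/

/-- A presentation of a left `R`-module `M` as `R / (R P + R Q)` for commuting elements `P`, `Q`
that form a regular sequence under right multiplication, so that the Koszul complex
`0 → R → R² → R → M → 0` is exact. -/
structure KoszulPresentation (R : Type) [Ring R] (M : ModuleCat.{0} R) where
  P : R
  Q : R
  π : R →ₗ[R] M
  comm : P * Q = Q * P
  regular_left : ∀ r, r * P = 0 → r = 0
  regular_right : ∀ r b, r * Q = b * P → ∃ b', r = b' * P
  surj : Function.Surjective π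
  ker : ∀ r, π r = 0 ↔ ∃ a b, r = a * P + b * Q

namespace KoszulPresentation

open Abelian

variable {R : Type} [Ring R] {M : ModuleCat.{0} R} (K : KoszulPresentation R M)

/-- The map `R² → R P + R Q` of the Koszul complex. -/
def d₁ : (R × R) →ₗ[R] LinearMap.ker K.π :=
  LinearMap.codRestrict _ ((LinearMap.toSpanSingleton R R K.P).coprod
    (LinearMap.toSpanSingleton R R K.Q)) (fun c => (K.ker _).2 ⟨c.1, c.2, by simp⟩)

/-- The map `R → R²` of the Koszul complex. -/
def d₂ : R →ₗ[R] (R × R) :=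
  (LinearMap.toSpanSingleton R R K.Q).prod (-(LinearMap.toSpanSingleton R R K.P))

/-- The short exact sequence `0 → R P + R Q → R → M → 0`. -/
abbrev S₁ : ShortComplex (ModuleCat.{0} R) :=
  ShortComplex.mk (ModuleCat.ofHom (LinearMap.ker K.π).subtype) (ModuleCat.ofHom (Y := M) K.π)
    (by ext x; exact x.2)

/-- The short exact sequence `0 → R → R² → R P + R Q → 0`. -/
abbrev S₂ : ShortComplex (ModuleCat.{0} R) :=
  ShortComplex.mk (ModuleCat.ofHom K.d₂) (ModuleCat.ofHom K.d₁) (by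
    refine ModuleCat.hom_ext (LinearMap.ext fun (x : R) => Subtype.ext ?_)
    change (x * K.Q) * K.P + (-(x * K.P)) * K.Q = 0
    rw [mul_assoc, ← K.comm]; noncomm_ring)

lemma shortExact₁ : K.S₁.ShortExact where
  exact := (ShortComplex.moduleCat_exact_iff _).2 fun x hx => ⟨⟨x, hx⟩, rfl⟩
  mono_f := (ModuleCat.mono_iff_injective _).2 Subtype.val_injective
  epi_g := (ModuleCat.epi_iff_surjective _).2 K.surj

lemma shortExact₂ : K.S₂.ShortExact where
  exact := (ShortComplex.moduleCat_exact_iff _).2 (by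
    rintro ⟨a, b⟩ hx
    have h : a * K.P + b * K.Q = 0 := congrArg Subtype.val hx
    obtain ⟨b', rfl⟩ := K.regular_right b (-a) (by
      rw [neg_mul]; exact eq_neg_of_add_eq_zero_right h)
    have ha : a + b' * K.Q = 0 := K.regular_left _ (by
      rw [add_mul, mul_assoc, ← K.comm, ← mul_assoc, h])
    refine ⟨-b', Prod.ext ?_ ?_⟩
    · change (-b') * K.Q = a
      rw [neg_mul]; exact (eq_neg_of_add_eq_zero_left ha).symm
    · change -((-b') * K.P) = _
      simp)
  mono_f := (ModuleCat.mono_iff_injective _).2 (by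
    refine (injective_iff_map_eq_zero K.d₂).2 fun r hr => K.regular_left r ?_
    simpa [d₂] using congrArg Prod.snd hr)
  epi_g := (ModuleCat.epi_iff_surjective _).2 (by
    rintro ⟨x, hx⟩
    obtain ⟨a, b, rfl⟩ := (K.ker x).1 hx
    exact ⟨(a, b), Subtype.ext rfl⟩)

/-- The class in `Ext²(M, R)` of an endomorphism of the last term of the Koszul complex. -/
def classHom (φ : ModuleCat.of R R ⟶ ModuleCat.of R R) : ExtTwo R M :=
  K.shortExact₁.extClass.comp (K.shortExact₂.extClass.comp (Ext.mk₀ φ) (add_zero 1)) rfl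

lemma classHom_add (φ ψ : ModuleCat.of R R ⟶ ModuleCat.of R R) :
    K.classHom (φ + ψ) = K.classHom φ + K.classHom ψ := by
  rw [classHom, Ext.mk₀_add, Ext.comp_add, Ext.comp_add]; rfl

lemma classHom_surjective : Function.Surjective K.classHom := by
  intro x
  have : Projective K.S₁.X₂ := inferInstanceAs (Projective (ModuleCat.of R R))
  have : Projective K.S₂.X₂ := inferInstanceAs (Projective (ModuleCat.of R (R × R)))
  obtain ⟨y, rfl⟩ := Ext.contravariant_sequence_exact₃ K.shortExact₁ (ModuleCat.of R R) x
    (Ext.eq_zero_of_projective _) (n₀ := 1) rfl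
  obtain ⟨z, rfl⟩ := Ext.contravariant_sequence_exact₃ K.shortExact₂ (ModuleCat.of R R) y
    (Ext.eq_zero_of_projective _) (n₀ := 0) rfl
  obtain ⟨φ, rfl⟩ := (Ext.mk₀_bijective _ _).2 z
  exact ⟨φ, rfl⟩

lemma classHom_eq_zero_iff (φ : ModuleCat.of R R ⟶ ModuleCat.of R R) :
    K.classHom φ = 0 ↔ ∃ g : ModuleCat.of R (R × R) ⟶ ModuleCat.of R R,
      φ = ModuleCat.ofHom K.d₂ ≫ g := by
  constructor
  · intro h
    have : Projective K.S₁.X₂ := inferInstanceAs (Projective (ModuleCat.of R R))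
    obtain ⟨y, hy⟩ := Ext.contravariant_sequence_exact₁ K.shortExact₁ (ModuleCat.of R R) _ rfl h
    rw [Ext.eq_zero_of_projective y, Ext.comp_zero] at hy
    obtain ⟨z, hz⟩ := Ext.contravariant_sequence_exact₁ K.shortExact₂ (ModuleCat.of R R) _
      (add_zero 1) hy.symm
    obtain ⟨g, rfl⟩ := (Ext.mk₀_bijective _ _).2 z
    rw [Ext.mk₀_comp_mk₀] at hz
    exact ⟨g, ((Ext.mk₀_bijective _ _).1 hz).symm⟩
  · rintro ⟨g, rfl⟩
    rw [classHom, ← Ext.mk₀_comp_mk₀]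
    erw [K.shortExact₂.extClass_comp_assoc]
    exact Ext.comp_zero _ _ _ _ _

/-- The map `R → Ext²(M, R)` that identifies `Ext²(M, R)` with `R / (P R + Q R)`. -/
def toExt : R →+ ExtTwo R M where
  toFun r := K.classHom (rmul R r)
  map_zero' := by
    have : rmul R (0 : R) = ModuleCat.ofHom K.d₂ ≫ 0 := by ext; simp [rmul]
    exact (K.classHom_eq_zero_iff _).2 ⟨0, this⟩
  map_add' r t := by
    rw [← classHom_add]; congr 1; ext; simp [rmul]

lemma toExt_mul (r t : R) : K.toExt (r * t) = MulOpposite.op t • K.toExt r := by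
  have h : rmul R (r * t) = rmul R r ≫ rmul R t := by ext; simp [rmul]
  change K.classHom _ = Ext.comp (Y := ModuleCat.of R R) (K.classHom (rmul R r))
    (Ext.mk₀ (rmul R t)) (add_zero 2)
  rw [h, classHom, ← Ext.mk₀_comp_mk₀, classHom, Ext.comp_assoc_of_third_deg_zero,
    Ext.comp_assoc_of_third_deg_zero]

lemma exists_rmul (φ : ModuleCat.of R R ⟶ ModuleCat.of R R) : ∃ r, φ = rmul R r :=
  ⟨φ.hom 1, by ext; simp [rmul]⟩

lemma toExt_surjective : Function.Surjective K.toExt := fun x => by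
  obtain ⟨φ, rfl⟩ := K.classHom_surjective x
  obtain ⟨r, rfl⟩ := exists_rmul φ
  exact ⟨r, rfl⟩

lemma toExt_eq_zero_iff (r : R) : K.toExt r = 0 ↔ ∃ a b, r = K.P * a + K.Q * b := by
  refine (K.classHom_eq_zero_iff _).trans ⟨?_, ?_⟩
  · rintro ⟨g, hg⟩
    have h := congrArg (fun f => f.hom (1 : R)) hg
    refine ⟨-(g.hom ((0 : R), (1 : R))), g.hom ((1 : R), (0 : R)), ?_⟩
    have e : ((K.Q, -K.P) : R × R) = K.Q • ((1 : R), (0 : R)) + (-K.P) • ((0 : R), (1 : R)) := by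
      simp
    have h2 : r = g.hom (K.Q, -K.P) := by simpa [rmul, d₂] using h
    rw [h2, e, map_add, map_smul, map_smul]
    simp only [smul_eq_mul]
    noncomm_ring
  · rintro ⟨a, b, rfl⟩
    refine ⟨ModuleCat.ofHom ((LinearMap.toSpanSingleton R R b).coprod
      (LinearMap.toSpanSingleton R R (-a))), ?_⟩
    ext
    simp [rmul, d₂, add_comm]

/-- Functoriality of `toExt`: a chain map between Koszul complexes with components right
multiplication by `c₀` in degree `0`, by `(c₁, c₂)` in degree `1` and by `c₃` in degree `2`
computes the map induced on `Ext²`. -/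
lemma dualMap_toExt {M' : ModuleCat.{0} R} (K' : KoszulPresentation R M') (f : M ⟶ M')
    {c₀ c₁ c₂ c₃ : R} (h₀ : f.hom (K.π 1) = K'.π c₀) (h₁ : K.P * c₀ = c₁ * K'.P)
    (h₂ : K.Q * c₀ = c₂ * K'.Q) (h₃ : c₃ * K'.Q = K.Q * c₁) (h₄ : c₃ * K'.P = K.P * c₂) (r : R) :
    (dualMap R f).hom (K'.toExt r) = K.toExt (c₃ * r) := by
  have hf : ∀ x, f.hom (K.π x) = K'.π (x * c₀) := fun x => by
    have := congrArg (x • ·) h₀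
    simp only [← map_smul, smul_eq_mul, mul_one] at this
    exact this
  let τ : LinearMap.ker K.π →ₗ[R] LinearMap.ker K'.π :=
    LinearMap.restrict (LinearMap.toSpanSingleton R R c₀) (fun x hx => by
      have hx' : K.π x = 0 := hx
      change K'.π (x * c₀) = 0
      rw [← hf, hx', map_zero])
  let T₁ : K.S₁ ⟶ K'.S₁ :=
    { τ₁ := ModuleCat.ofHom τ
      τ₂ := rmul R c₀
      τ₃ := f
      comm₁₂ := rfl
      comm₂₃ := by
        refine ModuleCat.hom_ext (LinearMap.ext fun x => ?_)
        exact (hf x).symm }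
  let T₂ : K.S₂ ⟶ K'.S₂ :=
    { τ₁ := rmul R c₃
      τ₂ := ModuleCat.ofHom ((LinearMap.toSpanSingleton R R c₁).prodMap
        (LinearMap.toSpanSingleton R R c₂))
      τ₃ := ModuleCat.ofHom τ
      comm₁₂ := by
        refine ModuleCat.hom_ext (LinearMap.ext fun (x : R) => Prod.ext ?_ ?_)
        · change (x * c₃) * K'.Q = (x * K.Q) * c₁
          rw [mul_assoc, mul_assoc, h₃]
        · change -((x * c₃) * K'.P) = (-(x * K.P)) * c₂
          rw [mul_assoc, h₄]; noncomm_ring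
      comm₂₃ := by
        refine ModuleCat.hom_ext (LinearMap.ext fun (x : R × R) => Subtype.ext ?_)
        change (x.1 * c₁) * K'.P + (x.2 * c₂) * K'.Q = (x.1 * K.P + x.2 * K.Q) * c₀
        rw [mul_assoc, mul_assoc, ← h₁, ← h₂]; noncomm_ring }
  have n₁ := ShortComplex.ShortExact.extClass_naturality K.shortExact₁ K'.shortExact₁ T₁
  have n₂ := ShortComplex.ShortExact.extClass_naturality K.shortExact₂ K'.shortExact₂ T₂
  have hc : rmul R (c₃ * r) = T₂.τ₁ ≫ rmul R r := by
    refine ModuleCat.hom_ext (LinearMap.ext fun (x : R) => ?_)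
    exact (mul_assoc x c₃ r).symm
  change Ext.comp (Ext.mk₀ T₁.τ₃) (K'.classHom (rmul R r)) (zero_add 2) = K.classHom _
  rw [hc, classHom, classHom, ← Ext.mk₀_comp_mk₀,
    ← Ext.comp_assoc (a₁₂ := 1) _ _ _ (zero_add 1) rfl (by lia), ← n₁]
  rw [Ext.comp_assoc (a₂₃ := 1) _ _ _ (add_zero 1) (zero_add 1) (by lia)]
  congr 1
  rw [← Ext.comp_assoc (a₁₂ := 1) _ _ _ (zero_add 1) rfl (by lia)]
  erw [← n₂]
  exact Ext.comp_assoc_of_second_deg_zero _ _ _ _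

end KoszulPresentation

end Jantzen

namespace Jantzen

/-! ### Computations in the ring of differential operators -/

namespace Diff

variable {V : Chart}

lemma x_comm (i j : Fin 2) : (x i * x j : Diff V) = x j * x i := by
  simpa [x, gen] using mk_rel (Rel.x_comm (W := V) i j)

lemma d_comm (i j : Fin 2) : (d i * d j : Diff V) = d j * d i := by
  simpa [d, gen] using mk_rel (Rel.d_comm (W := V) i j)

lemma d_mul_x (i : Fin 2) : (d i * x i : Diff V) = x i * d i + 1 := by
  simpa [x, d, gen] using mk_rel (Rel.d_x (W := V) i i)

lemma d_mul_x_of_ne {i j : Fin 2} (h : i ≠ j) : (d i * x j : Diff V) = x j * d i := by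
  simpa [x, d, gen, h] using mk_rel (Rel.d_x (W := V) i j)

/-- An inverted coordinate, as a unit of `𝒟(V)`. -/
def xUnit (i : Fin 2) (h : V i = true) : (Diff V)ˣ where
  val := x i
  inv := gen (Gen.y i h)
  val_inv := by simpa [x, gen] using mk_rel (Rel.x_y (W := V) i h)
  inv_val := by simpa [x, gen] using mk_rel (Rel.y_x (W := V) i h)

/-- A subspace of `𝒟(V)` that contains `1` and is stable under left multiplication by the generators
is everything. -/
lemma mem_of_gen_mul_mem (S : Submodule ℂ (Diff V)) (h1 : (1 : Diff V) ∈ S)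
    (hx : ∀ i, ∀ a ∈ S, x i * a ∈ S) (hd : ∀ i, ∀ a ∈ S, d i * a ∈ S)
    (hy : ∀ i h, ∀ a ∈ S, ((xUnit i h)⁻¹ : (Diff V)ˣ) * a ∈ S) (a : Diff V) : a ∈ S := by
  obtain ⟨a, rfl⟩ := mk_surjective V a
  suffices h : ∀ b ∈ S, mk V a * b ∈ S by simpa using h 1 h1
  induction a using FreeAlgebra.induction with
  | grade0 r => intro b hb; simpa [Algebra.algebraMap_eq_smul_one] using S.smul_mem r hb
  | grade1 g =>
    intro b hb
    cases g with
    | x i => exact hx i b hb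
    | d i => exact hd i b hb
    | y i h => exact hy i h b hb
  | mul a b ha hb => intro c hc; rw [map_mul, mul_assoc]; exact ha _ (hb c hc)
  | add a b ha hb => intro c hc; rw [map_add, add_mul]; exact S.add_mem (ha c hc) (hb c hc)

/-- The powers `x i ^ b` for `b ≥ 0`, continued to `b < 0` by the powers of `x i` when this
coordinate is inverted, and by the powers of `d i` when it is not. -/
def zmon (i : Fin 2) (b : ℤ) : Diff V :=
  if h : V i = true then ((xUnit i h ^ b : (Diff V)ˣ) : Diff V)
  else if 0 ≤ b then x i ^ b.toNat else d i ^ (-b).toNat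

lemma zmon_of_inv (i : Fin 2) (h : V i = true) (b : ℤ) :
    zmon i b = ((xUnit i h ^ b : (Diff V)ˣ) : Diff V) := by rw [zmon, dif_pos h]

lemma zmon_natCast (i : Fin 2) (k : ℕ) : (zmon i (k : ℤ) : Diff V) = x i ^ k := by
  by_cases h : V i = true
  · rw [zmon_of_inv i h, zpow_natCast]; rfl
  · rw [zmon, dif_neg h, if_pos (by positivity), Int.toNat_natCast]

lemma zmon_zero (i : Fin 2) : (zmon i 0 : Diff V) = 1 := by
  simpa using zmon_natCast (V := V) i 0

lemma zmon_neg_natCast (i : Fin 2) (h : V i = false) (k : ℕ) :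
    (zmon i (-(k : ℤ)) : Diff V) = d i ^ k := by
  rcases k with _ | k
  · simp [zmon_zero]
  · rw [zmon, dif_neg (by simp [h]), if_neg (by push_cast; omega), neg_neg, Int.toNat_natCast]

lemma d_mul_x_pow (i : Fin 2) (k : ℕ) :
    (d i * x i ^ k : Diff V) = x i ^ k * d i + (k : ℂ) • x i ^ (k - 1) := by
  induction k with
  | zero => simp
  | succ k ih =>
    rw [pow_succ, ← mul_assoc, ih, add_mul, mul_assoc, d_mul_x, mul_add, mul_one, ← mul_assoc,
      add_assoc]
    congr 1
    rw [smul_mul_assoc]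
    rcases k with _ | k
    · simp
    · simp only [Nat.add_sub_cancel]
      rw [← pow_succ]
      push_cast
      module

lemma d_mul_xUnit_zpow (i : Fin 2) (h : V i = true) (b : ℤ) :
    (d i * ((xUnit i h ^ b : (Diff V)ˣ) : Diff V)) =
      ((xUnit i h ^ b : (Diff V)ˣ) : Diff V) * d i +
        (b : ℂ) • ((xUnit i h ^ (b - 1) : (Diff V)ˣ) : Diff V) := by
  have hx : ((xUnit i h : (Diff V)ˣ) : Diff V) = x i := rfl
  obtain ⟨k, rfl | rfl⟩ := b.eq_nat_or_neg
  · rw [zpow_natCast, Units.val_pow_eq_pow_val, hx, d_mul_x_pow]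
    rcases k with _ | k
    · simp
    · push_cast
      rw [add_sub_cancel_right, zpow_natCast, Units.val_pow_eq_pow_val, hx]
  · have h1 : ((xUnit i h ^ (-(k : ℤ)) : (Diff V)ˣ) : Diff V) * x i ^ k = 1 := by
      rw [← hx, ← Units.val_pow_eq_pow_val, ← Units.val_mul, ← zpow_natCast, ← zpow_add]
      simp
    have h2 : x i ^ k * ((xUnit i h ^ (-(k : ℤ)) : (Diff V)ˣ) : Diff V) = 1 := by
      rw [← hx, ← Units.val_pow_eq_pow_val, ← Units.val_mul, ← zpow_natCast, ← zpow_add]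
      simp
    have h3 : ((xUnit i h ^ (-(k : ℤ)) : (Diff V)ˣ) : Diff V) * ((k : ℂ) • x i ^ (k - 1)) *
        ((xUnit i h ^ (-(k : ℤ)) : (Diff V)ˣ) : Diff V) =
        (k : ℂ) • ((xUnit i h ^ (-(k : ℤ) - 1) : (Diff V)ˣ) : Diff V) := by
      rcases k with _ | k
      · simp
      · rw [mul_smul_comm, smul_mul_assoc, Nat.add_sub_cancel, ← hx, ← Units.val_pow_eq_pow_val,
          ← Units.val_mul, ← Units.val_mul, ← zpow_natCast, ← zpow_add, ← zpow_add]
        congr 4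
        push_cast; ring
    have h4 := d_mul_x_pow (V := V) i k
    set u := ((xUnit i h ^ (-(k : ℤ)) : (Diff V)ˣ) : Diff V)
    have h5 : u * (d i * x i ^ k) * u = u * d i := by rw [mul_assoc, mul_assoc, h2, mul_one]
    rw [h4, mul_add, add_mul, ← mul_assoc, h1, one_mul, h3] at h5
    rw [← h5]
    push_cast
    module

/-- The commutator of `d i` with the functions among the `zmon i b`. -/
lemma d_mul_zmon (i : Fin 2) (b : ℤ) (hb : V i = false → 0 ≤ b) :
    (d i * zmon i b : Diff V) = zmon i b * d i + (b : ℂ) • zmon i (b - 1) := by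
  by_cases h : V i = true
  · simp only [zmon_of_inv i h]; exact d_mul_xUnit_zpow i h b
  · obtain ⟨k, rfl⟩ := Int.eq_ofNat_of_zero_le (hb (by simpa using h))
    rw [zmon_natCast, d_mul_x_pow]
    rcases k with _ | k
    · simp
    · push_cast
      rw [add_sub_cancel_right, zmon_natCast]

lemma x_mul_zmon (i : Fin 2) (b : ℤ) (hb : V i = false → 0 ≤ b) :
    (x i * zmon i b : Diff V) = zmon i (b + 1) := by
  by_cases h : V i = true
  · simp only [zmon_of_inv i h]
    rw [add_comm, zpow_add, zpow_one, Units.val_mul]; rfl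
  · obtain ⟨k, rfl⟩ := Int.eq_ofNat_of_zero_le (hb (by simpa using h))
    rw [zmon_natCast, ← pow_succ']
    exact_mod_cast (zmon_natCast i (k + 1)).symm

lemma y_mul_zmon (i : Fin 2) (h : V i = true) (b : ℤ) :
    (((xUnit i h)⁻¹ : (Diff V)ˣ) : Diff V) * zmon i b = zmon i (b - 1) := by
  simp only [zmon_of_inv i h]
  rw [sub_eq_add_neg, add_comm, zpow_add, zpow_neg_one, Units.val_mul]

/-- The Euler operator of one coordinate. -/
def θ (i : Fin 2) : Diff V := x i * d i

lemma zmon_mul_x (i : Fin 2) (b : ℤ) (hb : V i = false → 0 ≤ b) :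
    (zmon i b * x i : Diff V) = zmon i (b + 1) := by
  by_cases h : V i = true
  · simp only [zmon_of_inv i h]
    rw [zpow_add, zpow_one, Units.val_mul]; rfl
  · obtain ⟨k, rfl⟩ := Int.eq_ofNat_of_zero_le (hb (by simpa using h))
    rw [zmon_natCast, ← pow_succ]
    exact_mod_cast (zmon_natCast i (k + 1)).symm

lemma d_pow_mul_x (i : Fin 2) (k : ℕ) :
    (d i ^ k * x i : Diff V) = x i * d i ^ k + (k : ℂ) • d i ^ (k - 1) := by
  induction k with
  | zero => simp
  | succ k ih =>
    rw [pow_succ', mul_assoc, ih, mul_add, ← mul_assoc, d_mul_x, add_mul, one_mul, add_assoc,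
      mul_assoc]
    congr 1
    rw [mul_smul_comm]
    rcases k with _ | k
    · simp
    · simp only [Nat.add_sub_cancel]
      rw [← pow_succ']
      push_cast
      module

/-- Left multiplication by a coordinate that is not inverted, on powers of its derivative. -/
lemma x_mul_zmon_neg (i : Fin 2) (h : V i = false) (b : ℤ) (hb : b < 0) :
    (x i * zmon i b : Diff V) = zmon i (b + 1) * (θ i + algebraMap ℂ _ (b + 1)) := by
  obtain ⟨k, rfl⟩ : ∃ k : ℕ, b = -((k : ℤ) + 1) := ⟨(-b - 1).toNat, by omega⟩
  have e1 : -((k : ℤ) + 1) + 1 = -(k : ℤ) := by ring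
  have e2 : -((k : ℤ) + 1) = -((k + 1 : ℕ) : ℤ) := by push_cast; ring
  rw [e1, e2, zmon_neg_natCast i h, zmon_neg_natCast i h, θ, mul_add, ← mul_assoc, d_pow_mul_x,
    Algebra.algebraMap_eq_smul_one, add_mul, mul_assoc, ← pow_succ, mul_smul_comm, mul_one,
    smul_mul_assoc]
  rcases k with _ | k
  · simp
  · simp only [Nat.add_sub_cancel]
    rw [← pow_succ]
    push_cast
    module

lemma d_mul_zmon_eq (i : Fin 2) (b : ℤ) (hb : V i = false → 0 < b) :
    (d i * zmon i b : Diff V) = zmon i (b - 1) * (θ i + algebraMap ℂ _ (b : ℂ)) := by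
  rw [d_mul_zmon i b (fun h => (hb h).le), θ, mul_add, ← mul_assoc,
    zmon_mul_x i (b - 1) (fun h => by have := hb h; omega), sub_add_cancel,
    Algebra.algebraMap_eq_smul_one, mul_smul_comm, mul_one]

lemma d_mul_zmon_neg (i : Fin 2) (h : V i = false) (b : ℤ) (hb : b ≤ 0) :
    (d i * zmon i b : Diff V) = zmon i (b - 1) := by
  obtain ⟨k, rfl⟩ : ∃ k : ℕ, b = -(k : ℤ) := ⟨(-b).toNat, by omega⟩
  have e2 : -(k : ℤ) - 1 = -((k + 1 : ℕ) : ℤ) := by push_cast; ring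
  rw [e2, zmon_neg_natCast i h, zmon_neg_natCast i h, pow_succ']

lemma commute_x_x (i j : Fin 2) : Commute (x i : Diff V) (x j) := x_comm i j

lemma commute_d_d (i j : Fin 2) : Commute (d i : Diff V) (d j) := d_comm i j

lemma commute_d_x {i j : Fin 2} (h : i ≠ j) : Commute (d i : Diff V) (x j) := d_mul_x_of_ne h

lemma commute_zmon {i : Fin 2} {a : Diff V} (hx : Commute a (x i)) (hd : Commute a (d i)) (b : ℤ) :
    Commute a (zmon i b) := by
  rw [zmon]
  split_ifs with h h'
  · exact Commute.units_zpow_right (u := xUnit i h) hx b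
  · exact hx.pow_right _
  · exact hd.pow_right _

lemma commute_y {i : Fin 2} {a : Diff V} (hx : Commute a (x i)) (h : V i = true) :
    Commute a (((xUnit i h)⁻¹ : (Diff V)ˣ) : Diff V) :=
  Commute.units_inv_right (u := xUnit i h) hx

lemma commute_θ {i : Fin 2} {a : Diff V} (hx : Commute a (x i)) (hd : Commute a (d i)) :
    Commute a (θ i) := hx.mul_right hd

end Diff

end Jantzen

namespace Jantzen

/-! ### Normal forms of differential operators and their action on functions -/

open Diff

/-- A restriction map from the differential operators of a chart `V` that agrees with `W` in the
first coordinate to those of `W ∩ U`; below `V` is `W` or `W ∩ U`. -/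
structure IsRestriction {V W : Chart} (ρ : Diff V →ₐ[ℂ] Diff W.meetU) : Prop where
  chart : V 0 = W 0
  map_x : ∀ i, ρ (x i) = x i
  map_d : ∀ i, ρ (d i) = d i

lemma isRestriction_res (W : Chart) : IsRestriction (Diff.res W) where
  chart := rfl
  map_x _ := Diff.lift_gen _ _ _
  map_d _ := Diff.lift_gen _ _ _

lemma isRestriction_id (W : Chart) : IsRestriction (W := W) (AlgHom.id ℂ (Diff W.meetU)) where
  chart := by simp [Chart.meetU]
  map_x _ := rfl
  map_d _ := rfl

lemma Chart.meetU_one (W : Chart) : W.meetU 1 = true := by simp [Chart.meetU]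

lemma Chart.meetU_zero (W : Chart) : W.meetU 0 = W 0 := by simp [Chart.meetU]

section NormalForm

variable {V W : Chart}

/-- The monomial of `𝒟(V)` with a given exponent; a negative power of a coordinate that is not
inverted on `V` is read as a power of the derivative. -/
def mono (V : Chart) {W : Chart} (e : Expo W.meetU) : Diff V := zmon 0 (e.1 0) * zmon 1 (e.1 1)

/-- The normal form `∑ₑ x^e fₑ(θ₂ + c)` of a differential operator modulo `𝒟(V) ∂₁`. -/
def normalForm (V : Chart) {W : Chart} (c : ℤ) : (Expo W.meetU →₀ ℂ[X]) →ₗ[ℂ] Diff V :=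
  Finsupp.lsum ℂ fun e => (LinearMap.mulLeft ℂ (mono V e)).comp
    (Polynomial.aeval (θ 1 + algebraMap ℂ (Diff V) c)).toLinearMap

lemma normalForm_single (c : ℤ) (e : Expo W.meetU) (p : ℂ[X]) :
    normalForm V c (Finsupp.single e p) =
      mono V e * Polynomial.aeval (θ 1 + algebraMap ℂ (Diff V) c) p := by
  simp [normalForm]

/-- The left ideal `𝒟(V) ∂₁`, as a vector space. -/
def leftIdealD (V : Chart) : Submodule ℂ (Diff V) :=
  LinearMap.range (LinearMap.mulRight ℂ (d 0 : Diff V))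

lemma mul_mem_leftIdealD (a b : Diff V) (h : b ∈ leftIdealD V) : a * b ∈ leftIdealD V := by
  obtain ⟨b', rfl⟩ := h
  exact ⟨a * b', by simp [mul_assoc]⟩

lemma up_zero_zero (e : Expo W.meetU) : (e.up 0).1 0 = e.1 0 + 1 := by simp [Expo.up]
lemma up_zero_one (e : Expo W.meetU) : (e.up 0).1 1 = e.1 1 := by simp [Expo.up]
lemma up_one_zero (e : Expo W.meetU) : (e.up 1).1 0 = e.1 0 := by simp [Expo.up]
lemma up_one_one (e : Expo W.meetU) : (e.up 1).1 1 = e.1 1 + 1 := by simp [Expo.up]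
lemma down_zero_one (e : Expo W.meetU) : (e.down 0).1 1 = e.1 1 :=
  Expo.down_apply_of_ne (by decide) e
lemma down_one_zero (e : Expo W.meetU) : (e.down 1).1 0 = e.1 0 :=
  Expo.down_apply_of_ne (by decide) e
lemma down_one_one (e : Expo W.meetU) : (e.down 1).1 1 = e.1 1 - 1 := by
  rw [Expo.down_pos (by simp [Chart.meetU_one])]; simp
lemma down_zero_zero (e : Expo W.meetU) (h : W 0 = false → 1 ≤ e.1 0) :
    (e.down 0).1 0 = e.1 0 - 1 := by
  rw [Expo.down_pos (by rwa [Chart.meetU_zero])]; simp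

lemma expo_nonneg (e : Expo W.meetU) (h : W 0 = false) : 0 ≤ e.1 0 :=
  e.2 0 (by rwa [Chart.meetU_zero])

lemma commute_d_aeval (c : ℤ) (p : ℂ[X]) :
    Commute (d 0 : Diff V) (Polynomial.aeval (θ 1 + algebraMap ℂ (Diff V) c) p) := by
  refine Polynomial.induction_on' p (fun p q hp hq => by simpa using hp.add_right hq) ?_
  intro n a
  rw [Polynomial.aeval_monomial]
  refine (Algebra.commute_algebraMap_right a _).mul_right (Commute.pow_right ?_ n)
  exact (commute_θ (commute_d_x (by decide)) (commute_d_d _ _)).add_right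
    (Algebra.commute_algebraMap_right _ _)

/-- Every differential operator on `V` has a normal form modulo `𝒟(V) ∂₁`. -/
theorem exists_normalForm (hV : V 0 = W 0) (c : ℤ) (a : Diff V) :
    ∃ (f : Expo W.meetU →₀ ℂ[X]) (b : Diff V), a = normalForm V c f + b * d 0 := by
  suffices h : a ∈ LinearMap.range (normalForm V (W := W) c) ⊔ leftIdealD V by
    obtain ⟨_, ⟨f, rfl⟩, _, ⟨b, rfl⟩, rfl⟩ := Submodule.mem_sup.1 h
    exact ⟨f, b, by simp⟩
  set S := LinearMap.range (normalForm V (W := W) c) ⊔ leftIdealD V with hS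
  have hL : leftIdealD V ≤ S := le_sup_right
  have hmem : ∀ (e : Expo W.meetU) (p : ℂ[X]),
      mono V e * Polynomial.aeval (θ 1 + algebraMap ℂ (Diff V) c) p ∈ S := fun e p =>
    Submodule.mem_sup_left ⟨Finsupp.single e p, normalForm_single c e p⟩
  have key : ∀ g : Diff V, (∀ (e : Expo W.meetU) (p : ℂ[X]),
      g * (mono V e * Polynomial.aeval (θ 1 + algebraMap ℂ (Diff V) c) p) ∈ S) →
      ∀ a ∈ S, g * a ∈ S := by
    intro g hg a ha
    obtain ⟨_, ⟨f, rfl⟩, b, hb, rfl⟩ := Submodule.mem_sup.1 ha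
    clear ha
    rw [mul_add]
    refine S.add_mem ?_ (hL (mul_mem_leftIdealD g b hb))
    clear hb
    induction f using Finsupp.induction_linear with
    | zero => simp
    | add f f' hf hf' =>
      rw [map_add, mul_add]
      exact S.add_mem hf hf'
    | single e p => rw [normalForm_single]; exact hg e p
  have hnn : ∀ e : Expo W.meetU, V 0 = false → 0 ≤ e.1 0 := fun e h =>
    expo_nonneg e (hV ▸ h)
  have hC : ∀ (e : Expo W.meetU) (z : ℂ) (p : ℂ[X]), mono V e * ((θ 1 + algebraMap ℂ _ z) *
      Polynomial.aeval (θ 1 + algebraMap ℂ (Diff V) c) p) ∈ S := by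
    intro e z p
    have : (θ 1 + algebraMap ℂ _ z) * Polynomial.aeval (θ 1 + algebraMap ℂ (Diff V) c) p =
        Polynomial.aeval (θ 1 + algebraMap ℂ (Diff V) c)
          ((Polynomial.X + Polynomial.C (z - c)) * p) := by
      rw [map_mul, map_add, Polynomial.aeval_X, Polynomial.aeval_C, map_sub]
      congr 1
      abel
    rw [this]
    exact hmem _ _
  have hx0 : ∀ b : ℤ, Commute (x 1 : Diff V) (zmon 0 b) :=
    commute_zmon (commute_x_x _ _) (commute_d_x (by decide)).symm
  have hd0 : ∀ b : ℤ, Commute (d 1 : Diff V) (zmon 0 b) :=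
    commute_zmon (commute_d_x (by decide)) (commute_d_d _ _)
  refine mem_of_gen_mul_mem S ?_ ?_ ?_ ?_ a
  · have := hmem ⟨0, fun _ _ => le_rfl⟩ 1
    simpa [mono, zmon_zero] using this
  · intro i
    refine key _ fun e p => ?_
    obtain rfl | rfl : i = 0 ∨ i = 1 := by omega
    · have : x 0 * mono V e = mono V (e.up 0) := by
        rw [mono, mono, ← mul_assoc, x_mul_zmon 0 _ (hnn e), up_zero_zero, up_zero_one]
      rw [← mul_assoc, this]
      exact hmem _ _
    · rw [mono, ← mul_assoc, ← mul_assoc, (hx0 _).eq, mul_assoc (zmon 0 _)]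
      by_cases h : V 1 = false → 0 ≤ e.1 1
      · have := hmem (e.up 1) p
        rwa [mono, up_one_zero, up_one_one, ← x_mul_zmon 1 _ h] at this
      · push Not at h
        rw [x_mul_zmon_neg 1 h.1 _ h.2, ← mul_assoc, mul_assoc]
        have := hC (e.up 1) (e.1 1 + 1) p
        rwa [mono, up_one_zero, up_one_one] at this
  · intro i
    refine key _ fun e p => ?_
    obtain rfl | rfl : i = 0 ∨ i = 1 := by omega
    · have hc : Commute (d 0 : Diff V)
          (zmon 1 (e.1 1) * Polynomial.aeval (θ 1 + algebraMap ℂ (Diff V) c) p) :=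
        (commute_zmon (commute_d_x (by decide)) (commute_d_d _ _) _).mul_right
          (commute_d_aeval c p)
      rw [mono, mul_assoc, ← mul_assoc, d_mul_zmon 0 _ (hnn e), add_mul, mul_assoc, hc.eq,
        ← mul_assoc, smul_mul_assoc]
      refine S.add_mem (hL ⟨_, rfl⟩) ?_
      by_cases h0 : W 0 = false → 1 ≤ e.1 0
      · refine S.smul_mem _ ?_
        have := hmem (e.down 0) p
        rwa [mono, down_zero_zero e h0, down_zero_one, mul_assoc] at this
      · push Not at h0
        have : e.1 0 = 0 := le_antisymm (by omega) (expo_nonneg e h0.1)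
        simp [this]
    · rw [mono, ← mul_assoc, ← mul_assoc, (hd0 _).eq, mul_assoc (zmon 0 _)]
      by_cases h : V 1 = false → 0 < e.1 1
      · rw [d_mul_zmon_eq 1 _ h, ← mul_assoc, mul_assoc]
        have := hC (e.down 1) (e.1 1) p
        rwa [mono, down_one_zero, down_one_one] at this
      · push Not at h
        have := hmem (e.down 1) p
        rwa [mono, down_one_zero, down_one_one, ← d_mul_zmon_neg 1 h.1 _ h.2] at this
  · intro i h
    refine key _ fun e p => ?_
    obtain rfl | rfl : i = 0 ∨ i = 1 := by omega
    · have := hmem (e.down 0) p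
      rw [mono, down_zero_zero e (by simp [← hV, h]), down_zero_one, ← y_mul_zmon 0 h] at this
      rwa [mono, ← mul_assoc, ← mul_assoc]
    · have := hmem (e.down 1) p
      rw [mono, down_one_zero, down_one_one, ← y_mul_zmon 1 h] at this
      rwa [mono, ← mul_assoc, ← mul_assoc, ← (commute_y (hx0 _).symm h).eq, mul_assoc (zmon 0 _)]

end NormalForm

section Exponents

variable {W : Chart}

/-- The exponent `(a, b)` moved to `(a, b - c)`. -/
def shift (c : ℤ) (e : Expo W.meetU) : Expo W.meetU :=
  ⟨fun i => if i = 1 then e.1 1 - c else e.1 i, fun i hi => by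
    obtain rfl | rfl : i = 0 ∨ i = 1 := by omega
    · simpa using e.2 0 hi
    · simp [Chart.meetU_one] at hi⟩

lemma expo_ext {e e' : Expo W.meetU} (h0 : e.1 0 = e'.1 0) (h1 : e.1 1 = e'.1 1) : e = e' := by
  apply Subtype.ext
  funext i
  obtain rfl | rfl : i = 0 ∨ i = 1 := by omega
  · exact h0
  · exact h1

end Exponents

section Action

variable {V W : Chart} {ρ : Diff V →ₐ[ℂ] Diff W.meetU} (hρ : IsRestriction ρ)
  (B : Type) [CommRing B] [Algebra ℂ B] (σ : B)

/-- The action of `𝒟(V)` on `(𝒪(W ∩ U) ⊗ B) t^σ` through a restriction map. -/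
def act (ρ : Diff V →ₐ[ℂ] Diff W.meetU) : Diff V →ₐ[ℂ] Module.End ℂ (Expo W.meetU →₀ B) :=
  (twistHom W B σ).comp ρ

include hρ

lemma act_x (i : Fin 2) (e : Expo W.meetU) (b : B) :
    act B σ ρ (x i) (Finsupp.single e b) = Finsupp.single (e.up i) b := by
  rw [act, AlgHom.comp_apply, hρ.map_x, x, twistHom_gen, twistGen_x]

lemma act_d (i : Fin 2) (e : Expo W.meetU) (b : B) :
    act B σ ρ (d i) (Finsupp.single e b) =
      Finsupp.single (e.down i) (((e.1 i : B) + if i = 1 then σ else 0) * b) := by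
  rw [act, AlgHom.comp_apply, hρ.map_d, d, twistHom_gen, twistGen_d]

lemma act_θ (e : Expo W.meetU) (b : B) :
    act B σ ρ (θ 1) (Finsupp.single e b) = Finsupp.single e (((e.1 1 : B) + σ) * b) := by
  rw [θ, map_mul, Module.End.mul_apply, act_d hρ, act_x hρ,
    Expo.up_down _ _ (by simp [Chart.meetU_one])]
  simp

end Action

end Jantzen

namespace Jantzen

open Diff

/-! ### The action of monomials on `x₂^(-c) t^s` -/

section ActMonomials

variable {V W : Chart} {ρ : Diff V →ₐ[ℂ] Diff W.meetU}
  (B : Type) [CommRing B] [Algebra ℂ B] (σ : B)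

/-- The action of `𝒟(V)` is linear over the coefficients. -/
lemma act_smul (a : Diff V) (z : B) (v : Expo W.meetU →₀ B) :
    act B σ ρ a (z • v) = z • act B σ ρ a v := by
  have h : ∀ w : Expo W.meetU →₀ B,
      Finsupp.mapRange.linearMap (LinearMap.mulLeft ℂ z) w = z • w := fun w => by
    ext; simp
  have := twist_coeff_comm (σ := σ) (σ' := σ) W (LinearMap.mulLeft ℂ z)
    (fun b => by simp [mul_left_comm]) (ρ a) v
  rw [h, h] at this
  exact this.symm

variable (hρ : IsRestriction ρ)
include hρ

lemma act_x_pow (i : Fin 2) (k : ℕ) (e e' : Expo W.meetU) (h : e'.1 = e.1 + Pi.single i (k : ℤ))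
    (b : B) : act B σ ρ (x i ^ k) (Finsupp.single e b) = Finsupp.single e' b := by
  induction k generalizing e with
  | zero =>
    have : e' = e := Subtype.ext (by simpa using h)
    simp [this]
  | succ k ih =>
    rw [pow_succ, map_mul, Module.End.mul_apply, act_x hρ, ih]
    rw [h]
    simp only [Expo.up, Nat.cast_add, Nat.cast_one, Pi.single_add]
    abel

lemma act_zmon (i : Fin 2) (b : ℤ) (e e' : Expo W.meetU) (hb : V i = false → 0 ≤ b)
    (h : e'.1 = e.1 + Pi.single i b) (z : B) :
    act B σ ρ (zmon i b) (Finsupp.single e z) = Finsupp.single e' z := by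
  obtain ⟨k, rfl | rfl⟩ := b.eq_nat_or_neg
  · rw [zmon_natCast]; exact act_x_pow B σ hρ i k e e' h z
  · by_cases hV : V i = true
    · have h' : e.1 = e'.1 + Pi.single i (k : ℤ) := by
        rw [h, Pi.single_neg]; abel
      rw [← act_x_pow B σ hρ i k e' e h', ← Module.End.mul_apply, ← map_mul]
      have : (zmon i (-(k : ℤ)) * x i ^ k : Diff V) = 1 := by
        have hx : ((xUnit i hV : (Diff V)ˣ) : Diff V) = x i := rfl
        rw [zmon_of_inv i hV, ← hx, ← Units.val_pow_eq_pow_val, ← Units.val_mul, ← zpow_natCast,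
          ← zpow_add]
        simp
      rw [this, map_one, Module.End.one_apply]
    · have : k = 0 := by have := hb (by simpa using hV); omega
      subst this
      have : e' = e := Subtype.ext (by simpa using h)
      simp [this, zmon_zero]

lemma act_d_one_pow (k : ℕ) (c : ℤ) (e e' : Expo W.meetU) (hc : e.1 1 = -c)
    (h : e'.1 = e.1 - Pi.single 1 (k : ℤ)) (z : B) :
    act B σ ρ (d 1 ^ k) (Finsupp.single e z) =
      Finsupp.single e' ((∏ j ∈ Finset.range k, (σ - ((c + j : ℤ) : B))) * z) := by
  induction k generalizing e' with
  | zero =>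
    have : e' = e := Subtype.ext (by simpa using h)
    simp [this]
  | succ k ih =>
    have hup : (e'.up 1).1 = e.1 - Pi.single 1 (k : ℤ) := by
      simp only [Expo.up, h, Nat.cast_add, Nat.cast_one, Pi.single_add]
      abel
    rw [pow_succ', map_mul, Module.End.mul_apply, ih _ hup, act_d hρ, Expo.down_up,
      Finset.prod_range_succ, if_pos rfl, hup]
    congr 1
    simp [hc]
    ring

/-- The factor by which the monomial with second exponent `b` acts on `x₂^(-c) t^s`, apart from
moving the exponent. -/
def gam (V : Chart) (c b : ℤ) : ℂ[X] :=
  if V 1 = false ∧ b < 0 then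
    ∏ j ∈ Finset.range (-b).toNat, (Polynomial.X - Polynomial.C ((c + j : ℤ) : ℂ)) else 1

lemma act_zmon_one (b c : ℤ) (e e' : Expo W.meetU) (hc : e.1 1 = -c)
    (h : e'.1 = e.1 + Pi.single 1 b) (z : B) :
    act B σ ρ (zmon 1 b) (Finsupp.single e z) =
      Finsupp.single e' (Polynomial.aeval σ (gam V c b) * z) := by
  by_cases hb : V 1 = false ∧ b < 0
  · rw [gam, if_pos hb]
    obtain ⟨k, rfl⟩ : ∃ k : ℕ, b = -(k : ℤ) := ⟨(-b).toNat, by omega⟩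
    rw [zmon_neg_natCast 1 hb.1, act_d_one_pow B σ hρ k c e e' hc (by
      rw [h, Pi.single_neg, sub_eq_add_neg])]
    simp [map_prod]
  · rw [gam, if_neg hb, map_one, one_mul]
    exact act_zmon B σ hρ 1 b e e' (by simpa using hb) h z

/-- The exponent of `x₂^(-c)`. -/
def base (W : Chart) (c : ℤ) : Expo W.meetU := shift c ⟨0, fun _ _ => le_rfl⟩

omit hρ in
lemma base_zero (c : ℤ) : (base W c).1 0 = 0 := by simp [base, shift]

omit hρ in
lemma base_one (c : ℤ) : (base W c).1 1 = -c := by simp [base, shift]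

omit hρ in
lemma shift_injective (c : ℤ) : Function.Injective (shift (W := W) c) := fun e e' h => by
  have h0 := congrArg (fun e => e.1 0) h
  have h1 := congrArg (fun e => e.1 1) h
  simp only [shift] at h0 h1
  exact expo_ext (by simpa using h0) (by simpa using h1)

lemma act_mono (c : ℤ) (e : Expo W.meetU) (z : B) :
    act B σ ρ (mono V e) (Finsupp.single (base W c) z) =
      Finsupp.single (shift c e) (Polynomial.aeval σ (gam V c (e.1 1)) * z) := by
  let e₁ : Expo W.meetU := ⟨fun i => if i = 1 then e.1 1 - c else 0, fun i hi => by
    obtain rfl | rfl : i = 0 ∨ i = 1 := by omega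
    · simp
    · simp [Chart.meetU_one] at hi⟩
  rw [mono, map_mul, Module.End.mul_apply,
    act_zmon_one B σ hρ (e.1 1) c (base W c) e₁ (base_one c) (by
      funext i
      obtain rfl | rfl : i = 0 ∨ i = 1 := by omega
      · simp [e₁, base_zero]
      · simp [e₁, base_one]; ring),
    act_zmon B σ hρ 0 (e.1 0) e₁ (shift c e) (fun h => expo_nonneg e (hρ.chart ▸ h)) (by
      funext i
      obtain rfl | rfl : i = 0 ∨ i = 1 := by omega
      · simp [e₁, shift]
      · simp [e₁, shift])]

lemma act_aeval (c : ℤ) (p : ℂ[X]) (e : Expo W.meetU) (hc : e.1 1 = -c) (z : B) :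
    act B σ ρ (Polynomial.aeval (θ 1 + algebraMap ℂ (Diff V) c) p) (Finsupp.single e z) =
      Finsupp.single e (Polynomial.aeval σ p * z) := by
  have h1 : ∀ z : B, act B σ ρ (θ 1 + algebraMap ℂ (Diff V) c) (Finsupp.single e z) =
      Finsupp.single e (σ * z) := fun z => by
    rw [map_add, LinearMap.add_apply, act_θ hρ, AlgHom.commutes, Module.algebraMap_end_apply,
      hc, Finsupp.smul_single, ← Finsupp.single_add]
    congr 1
    rw [Algebra.smul_def]
    simp
    ring
  rw [← Polynomial.aeval_algHom_apply]
  induction p using Polynomial.induction_on' with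
  | add p q hp hq =>
    rw [map_add (Polynomial.aeval _), LinearMap.add_apply, hp, hq, map_add, add_mul,
      Finsupp.single_add]
  | monomial n a =>
    rw [Polynomial.aeval_monomial, Polynomial.aeval_monomial, Module.End.mul_apply]
    have h2 : ∀ z : B, ((act B σ ρ (θ 1 + algebraMap ℂ (Diff V) c)) ^ n) (Finsupp.single e z) =
        Finsupp.single e (σ ^ n * z) := fun z => by
      induction n generalizing z with
      | zero => simp
      | succ n ih => rw [pow_succ, Module.End.mul_apply, h1, ih, pow_succ, mul_assoc]
    rw [h2, Module.algebraMap_end_apply, Finsupp.smul_single, Algebra.smul_def, mul_assoc]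

/-- The generator `x₂^(-c) t^σ`. -/
def genVec (W : Chart) (B : Type) [CommRing B] (c : ℤ) : Expo W.meetU →₀ B :=
  Finsupp.single (base W c) 1

/-- The coefficients of a normal form can be read off from its value on `x₂^(-c) t^σ`. -/
lemma act_normalForm (c : ℤ) (f : Expo W.meetU →₀ ℂ[X]) (e : Expo W.meetU) :
    (act B σ ρ (normalForm V c f) (genVec W B c)) (shift c e) =
      Polynomial.aeval σ (gam V c (e.1 1) * f e) := by
  induction f using Finsupp.induction_linear with
  | zero => simp
  | add f g hf hg => simp only [map_add, LinearMap.add_apply, Finsupp.add_apply, hf, hg, mul_add]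
  | single e' p =>
    rw [normalForm_single, map_mul, Module.End.mul_apply, genVec,
      act_aeval B σ hρ c p _ (base_one c), act_mono B σ hρ, Finsupp.single_apply,
      Finsupp.single_apply]
    by_cases h : e' = e
    · rw [if_pos h, if_pos (congrArg _ h), h, mul_one, map_mul]
    · rw [if_neg h, if_neg ((shift_injective c).ne h), mul_zero, map_zero]

lemma act_mul_d (c : ℤ) (b : Diff V) : act B σ ρ (b * d 0) (genVec W B c) = 0 := by
  rw [map_mul, Module.End.mul_apply, genVec, act_d hρ, base_zero]
  simp

lemma act_mul_θ (c : ℤ) (b : Diff V) : act B σ ρ (b * (θ 1 + algebraMap ℂ (Diff V) c))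
    (genVec W B c) = σ • act B σ ρ b (genVec W B c) := by
  have := act_aeval B σ hρ c Polynomial.X _ (base_one c) 1
  rw [Polynomial.aeval_X, Polynomial.aeval_X, mul_one] at this
  rw [map_mul, Module.End.mul_apply, genVec, this, ← act_smul, Finsupp.smul_single, smul_eq_mul,
    mul_one]

lemma act_mul_θ_pow (c : ℤ) (n : ℕ) (b : Diff V) :
    act B σ ρ (b * (θ 1 + algebraMap ℂ (Diff V) c) ^ n) (genVec W B c) =
      σ ^ n • act B σ ρ b (genVec W B c) := by
  induction n with
  | zero => simp
  | succ n ih => rw [pow_succ, ← mul_assoc, act_mul_θ B σ hρ, ih, pow_succ', mul_smul]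

omit hρ in
lemma gam_ne_zero (c b : ℤ) : gam V c b ≠ 0 := by
  unfold gam
  split_ifs
  · exact Finset.prod_ne_zero_iff.2 fun j _ => Polynomial.X_sub_C_ne_zero _
  · exact one_ne_zero

/-- An operator that kills `x₂^(-c) t^s`, for `s` an indeterminate, lies in `𝒟(V) ∂₁`. -/
theorem exists_mul_d_of_act_eq_zero (c : ℤ) (a : Diff V)
    (h : act ℂ[X] Polynomial.X ρ a (genVec W ℂ[X] c) = 0) : ∃ b, a = b * d 0 := by
  obtain ⟨f, b, rfl⟩ := exists_normalForm hρ.chart c a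
  have hf : f = 0 := by
    ext1 e
    have h1 := act_normalForm ℂ[X] Polynomial.X hρ c f e
    rw [map_add, LinearMap.add_apply, act_mul_d _ _ hρ, add_zero] at h
    rw [h, Polynomial.aeval_X_left, AlgHom.id_apply] at h1
    simpa [gam_ne_zero] using h1.symm
  exact ⟨b, by rw [hf, map_zero, zero_add]⟩

/-- Right multiplication by a power of `θ₂ + c` is injective on `𝒟(V) / 𝒟(V) ∂₁`. -/
theorem exists_mul_d_of_mul_θ_pow (c : ℤ) (n : ℕ) (a b : Diff V)
    (h : a * (θ 1 + algebraMap ℂ (Diff V) c) ^ n = b * d 0) : ∃ b', a = b' * d 0 := by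
  refine exists_mul_d_of_act_eq_zero hρ c a ?_
  have h1 := act_mul_θ_pow ℂ[X] Polynomial.X hρ c n a
  rw [h, act_mul_d _ _ hρ] at h1
  exact (smul_eq_zero.1 h1.symm).resolve_left (pow_ne_zero _ Polynomial.X_ne_zero)

omit hρ in
lemma normalForm_mul_pow (c : ℤ) (n : ℕ) (f : Expo W.meetU →₀ ℂ[X]) :
    normalForm V c f * (θ 1 + algebraMap ℂ (Diff V) c) ^ n =
      normalForm V c ((Polynomial.X : ℂ[X]) ^ n • f) := by
  induction f using Finsupp.induction_linear with
  | zero => simp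
  | add f g hf hg => rw [map_add, add_mul, hf, hg, smul_add, map_add]
  | single e p =>
    rw [Finsupp.smul_single, normalForm_single, normalForm_single, smul_eq_mul, mul_comm _ p,
      map_mul, map_pow, Polynomial.aeval_X, mul_assoc]

omit hρ in
/-- A normal form all of whose coefficients are divisible by `s^n`. -/
lemma exists_normalForm_mul_pow (c : ℤ) (n : ℕ) (f : Expo W.meetU →₀ ℂ[X])
    (h : ∀ e, (Polynomial.X : ℂ[X]) ^ n ∣ f e) :
    ∃ b, normalForm V c f = b * (θ 1 + algebraMap ℂ (Diff V) c) ^ n := by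
  choose g hg using h
  let g' : Expo W.meetU →₀ ℂ[X] := Finsupp.onFinset f.support g fun e he => by
    rw [Finsupp.mem_support_iff, hg e]
    exact mul_ne_zero (pow_ne_zero _ Polynomial.X_ne_zero) he
  refine ⟨normalForm V c g', ?_⟩
  rw [normalForm_mul_pow]
  congr 1
  ext1 e
  rw [Finsupp.smul_apply, smul_eq_mul]
  exact hg e

end ActMonomials

/-! ### Right multiplication by `∂₁` is injective -/

section Regular

variable {V : Chart}

/-- The derivation `a ↦ a x₁ - x₁ a` of `𝒟(V)`; it is locally nilpotent. -/
def adX (V : Chart) : Diff V →ₗ[ℂ] Diff V :=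
  LinearMap.mulRight ℂ (x 0) - LinearMap.mulLeft ℂ (x 0)

lemma adX_apply (a : Diff V) : adX V a = a * x 0 - x 0 * a := rfl

lemma adX_mul_of_commute (g a : Diff V) (h : Commute g (x 0)) (k : ℕ) :
    (adX V ^ k) (g * a) = g * (adX V ^ k) a := by
  induction k with
  | zero => simp
  | succ k ih =>
    rw [pow_succ', Module.End.mul_apply, ih, Module.End.mul_apply, adX_apply, adX_apply, mul_sub,
      ← mul_assoc (x 0), ← h.eq]
    noncomm_ring

lemma adX_pow_d_mul (a : Diff V) (k : ℕ) : (adX V ^ (k + 1)) (d 0 * a) =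
    d 0 * (adX V ^ (k + 1)) a + ((k + 1 : ℕ) : ℂ) • (adX V ^ k) a := by
  have h1 : ∀ b : Diff V, adX V (d 0 * b) = d 0 * adX V b + b := fun b => by
    rw [adX_apply, adX_apply, mul_sub, ← mul_assoc (x 0), ← mul_assoc (d 0) (x 0), d_mul_x]
    noncomm_ring
  induction k with
  | zero => simp [h1]
  | succ k ih =>
    rw [pow_succ', Module.End.mul_apply, ih, map_add, h1, map_smul, ← Module.End.mul_apply,
      ← pow_succ', ← Module.End.mul_apply, ← pow_succ']
    push_cast
    module

lemma adX_locally_nilpotent (a : Diff V) : ∃ k : ℕ, (adX V ^ k) a = 0 := by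
  have mono : ∀ (b : Diff V) (k l : ℕ), k ≤ l → (adX V ^ k) b = 0 → (adX V ^ l) b = 0 := by
    intro b k l hkl h
    obtain ⟨m, rfl⟩ := Nat.exists_eq_add_of_le hkl
    rw [add_comm, pow_add, Module.End.mul_apply, h, map_zero]
  let S : Submodule ℂ (Diff V) :=
    { carrier := {a | ∃ k : ℕ, (adX V ^ k) a = 0}
      add_mem' := by
        rintro a b ⟨k, hk⟩ ⟨l, hl⟩
        exact ⟨k + l, by rw [map_add, mono a k _ (by omega) hk, mono b l _ (by omega) hl, add_zero]⟩
      zero_mem' := ⟨0, by simp⟩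
      smul_mem' := by
        rintro c a ⟨k, hk⟩
        exact ⟨k, by rw [map_smul, hk, smul_zero]⟩ }
  refine mem_of_gen_mul_mem S ⟨1, ?_⟩ ?_ ?_ ?_ a
  · simp [adX_apply]
  · rintro i a ⟨k, hk⟩
    exact ⟨k, by rw [adX_mul_of_commute _ _ (commute_x_x i 0), hk, mul_zero]⟩
  · rintro i a ⟨k, hk⟩
    obtain rfl | rfl : i = 0 ∨ i = 1 := by omega
    · exact ⟨k + 1, by rw [adX_pow_d_mul, hk, mono a k _ (by omega) hk, mul_zero, smul_zero,
        add_zero]⟩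
    · exact ⟨k, by rw [adX_mul_of_commute _ _ (commute_d_x (by decide)), hk, mul_zero]⟩
  · rintro i h a ⟨k, hk⟩
    exact ⟨k, by
      rw [adX_mul_of_commute _ _ (commute_y (commute_x_x 0 i) h).symm, hk, mul_zero]⟩

/-- Right multiplication by `∂₁` is injective: if `a ∂₁ = 0` then the iterated commutators
`aₖ` of `a` with `x₁` satisfy `aₖ₊₁ ∂₁ = -(k + 1) aₖ`, and they vanish for large `k`. -/
theorem eq_zero_of_mul_d_eq_zero (a : Diff V) (h : a * d 0 = 0) : a = 0 := by
  have key : ∀ k : ℕ, (adX V ^ (k + 1)) a * d 0 + ((k + 1 : ℕ) : ℂ) • (adX V ^ k) a = 0 := by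
    have h1 : ∀ b : Diff V, adX V (b * d 0) = adX V b * d 0 + b := fun b => by
      rw [adX_apply, adX_apply, mul_assoc, d_mul_x]
      noncomm_ring
    intro k
    induction k with
    | zero => simpa [h] using (h1 a).symm
    | succ k ih =>
      have := congrArg (adX V) ih
      rw [map_add, h1, map_smul, ← Module.End.mul_apply, ← pow_succ', ← Module.End.mul_apply,
        ← pow_succ', map_zero] at this
      rw [← this]
      push_cast
      module
  obtain ⟨k, hk⟩ := adX_locally_nilpotent a
  induction k with
  | zero => simpa using hk
  | succ k ih =>
    refine ih ?_
    have := key k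
    rw [hk, zero_mul, zero_add] at this
    exact (smul_eq_zero.1 this).resolve_left (by exact_mod_cast k.succ_ne_zero)

end Regular

/-! ### Transposition of differential operators -/

section Transpose

variable (V : Chart)

/-- The images of the generators under transposition of differential operators. -/
def transposeGen : Gen V → (Diff V)ᵐᵒᵖ
  | .x i => MulOpposite.op (x i)
  | .d i => MulOpposite.op (-d i)
  | .y i h => MulOpposite.op (((xUnit i h)⁻¹ : (Diff V)ˣ) : Diff V)

/-- Transposition of differential operators: the anti-automorphism of `𝒟(V)` with `x i ↦ x i` and
`∂ i ↦ -∂ i`. -/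
def transpose : Diff V →ₐ[ℂ] (Diff V)ᵐᵒᵖ :=
  Diff.lift (transposeGen V) (by
    intro a b hab
    cases hab with
    | x_comm i j =>
      simp only [map_mul, FreeAlgebra.lift_ι_apply, transposeGen, ← MulOpposite.op_mul, x_comm i j]
    | d_comm i j =>
      simp only [map_mul, FreeAlgebra.lift_ι_apply, transposeGen, ← MulOpposite.op_mul, neg_mul_neg,
        d_comm i j]
    | d_x i j =>
      by_cases h : i = j
      · subst h
        simp only [map_mul, map_add, map_one, if_true, FreeAlgebra.lift_ι_apply, transposeGen,
          ← MulOpposite.op_mul, ← MulOpposite.op_one, ← MulOpposite.op_add]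
        congr 1
        rw [neg_mul, d_mul_x]
        noncomm_ring
      · simp only [map_mul, if_neg h, FreeAlgebra.lift_ι_apply, transposeGen,
          ← MulOpposite.op_mul, add_zero]
        rw [neg_mul, d_mul_x_of_ne h, mul_neg]
    | x_y i h =>
      simp only [map_mul, map_one, FreeAlgebra.lift_ι_apply, transposeGen, ← MulOpposite.op_mul]
      rw [← MulOpposite.op_one]
      congr 1
      exact (xUnit i h).inv_mul
    | y_x i h =>
      simp only [map_mul, map_one, FreeAlgebra.lift_ι_apply, transposeGen, ← MulOpposite.op_mul]
      rw [← MulOpposite.op_one]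
      congr 1
      exact (xUnit i h).mul_inv)

/-- The transpose of a differential operator. -/
def tr (a : Diff V) : Diff V := (transpose V a).unop

variable {V}

lemma tr_x (i : Fin 2) : tr V (x i) = x i := by
  rw [tr, transpose, x, Diff.lift_gen]; rfl

lemma tr_d (i : Fin 2) : tr V (d i) = -d i := by
  rw [tr, transpose, d, Diff.lift_gen]; rfl

lemma tr_mul (a b : Diff V) : tr V (a * b) = tr V b * tr V a := by simp [tr]

lemma tr_add (a b : Diff V) : tr V (a + b) = tr V a + tr V b := by simp [tr]

lemma tr_one : tr V 1 = 1 := by simp [tr]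

lemma tr_neg (a : Diff V) : tr V (-a) = -tr V a := by simp [tr]

lemma tr_zero : tr V 0 = 0 := by simp [tr]

lemma tr_smul (z : ℂ) (a : Diff V) : tr V (z • a) = z • tr V a := by simp [tr]

lemma tr_pow (a : Diff V) (n : ℕ) : tr V (a ^ n) = tr V a ^ n := by simp [tr]

lemma tr_θ : tr V (θ 1) = -(θ 1 + algebraMap ℂ _ (1 : ℤ)) := by
  rw [θ, tr_mul, tr_x, tr_d, neg_mul, d_mul_x]
  simp

lemma tr_y (i : Fin 2) (h : V i = true) : tr V (((xUnit i h)⁻¹ : (Diff V)ˣ) : Diff V) =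
    (((xUnit i h)⁻¹ : (Diff V)ˣ) : Diff V) := by
  change tr V (gen (Gen.y i h)) = _
  rw [tr, transpose, Diff.lift_gen]; rfl

/-- Transposition is an involution. -/
lemma tr_tr (a : Diff V) : tr V (tr V a) = a := by
  let S : Submodule ℂ (Diff V) :=
    { carrier := {a | tr V (tr V a) = a}
      add_mem' := fun {a b} (ha : _ = _) (hb : _ = _) => by
        change _ = _
        rw [tr_add, tr_add, ha, hb]
      zero_mem' := by change _ = _; rw [tr_zero, tr_zero]
      smul_mem' := fun c a (ha : _ = _) => by
        change _ = _
        rw [tr_smul, tr_smul, ha] }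
  refine mem_of_gen_mul_mem S ?_ ?_ ?_ ?_ a
  · change _ = _; rw [tr_one, tr_one]
  · intro i a (ha : _ = _); change _ = _; rw [tr_mul, tr_mul, ha, tr_x, tr_x]
  · intro i a (ha : _ = _); change _ = _; rw [tr_mul, tr_mul, ha, tr_d, tr_neg, tr_d, neg_neg]
  · intro i h a (ha : _ = _); change _ = _; rw [tr_mul, tr_mul, ha, tr_y, tr_y]

/-- Transposition commutes with restriction. -/
lemma tr_res (W : Chart) (a : Diff W) :
    tr W.meetU (Diff.res W a) = Diff.res W (tr W a) := by
  have hρ := isRestriction_res W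
  let S : Submodule ℂ (Diff W) :=
    { carrier := {a | tr W.meetU (Diff.res W a) = Diff.res W (tr W a)}
      add_mem' := fun {a b} (ha : _ = _) (hb : _ = _) => by
        change _ = _
        rw [tr_add, map_add, map_add, tr_add, ha, hb]
      zero_mem' := by change _ = _; rw [map_zero, tr_zero, tr_zero, map_zero]
      smul_mem' := fun c a (ha : _ = _) => by
        change _ = _
        rw [tr_smul, map_smul, map_smul, tr_smul, ha] }
  refine mem_of_gen_mul_mem S ?_ ?_ ?_ ?_ a
  · change _ = _; rw [map_one, tr_one, tr_one, map_one]
  · intro i a (ha : _ = _); change _ = _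
    rw [tr_mul, map_mul, map_mul, tr_mul, ha, tr_x, hρ.map_x, tr_x]
  · intro i a (ha : _ = _); change _ = _
    rw [tr_mul, map_mul, map_mul, tr_mul, ha, tr_d, hρ.map_d, tr_d, map_neg, hρ.map_d]
  · intro i h a (ha : _ = _); change _ = _
    have hy : Diff.res W (((xUnit i h)⁻¹ : (Diff W)ˣ) : Diff W) =
        (((xUnit i (W.le_meetU i h))⁻¹ : (Diff W.meetU)ˣ) : Diff W.meetU) :=
      Diff.lift_gen _ _ _
    rw [tr_mul, map_mul, map_mul, tr_mul, ha, tr_y, hy, tr_y]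

end Transpose

end Jantzen

namespace Jantzen

/-! ### Truncated coefficients, duality and the push-forward `j_!` -/

open Diff

/-- `B` is `ℂ[s] / s^n`, with `σ` the image of `s`. -/
structure IsTruncation (B : Type) [CommRing B] [Algebra ℂ B] (σ : B) (n : ℕ) : Prop where
  dvd : ∀ p : ℂ[X], Polynomial.aeval σ p = 0 ↔ Polynomial.X ^ n ∣ p
  surj : Function.Surjective (Polynomial.aeval σ : ℂ[X] →ₐ[ℂ] B)

lemma Trunc.aeval_s (n : ℕ) (p : ℂ[X]) : Polynomial.aeval (Trunc.s n) p =
    Ideal.Quotient.mk (Ideal.span {(Polynomial.X : ℂ[X]) ^ n}) p := by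
  have : (Polynomial.aeval (Trunc.s n) : ℂ[X] →ₐ[ℂ] Trunc n) = Ideal.Quotient.mkₐ ℂ _ :=
    Polynomial.algHom_ext (by rw [Polynomial.aeval_X]; rfl)
  rw [this]; rfl

lemma isTruncation_trunc (n : ℕ) : IsTruncation (Trunc n) (Trunc.s n) n where
  dvd p := by rw [Trunc.aeval_s, Ideal.Quotient.eq_zero_iff_mem, Ideal.mem_span_singleton]
  surj b := by
    obtain ⟨p, rfl⟩ := Ideal.Quotient.mk_surjective b
    exact ⟨p, Trunc.aeval_s n p⟩

lemma isTruncation_complex : IsTruncation ℂ 0 1 where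
  dvd p := by
    rw [pow_one, Polynomial.X_dvd_iff, Polynomial.coeff_zero_eq_aeval_zero]
  surj z := ⟨Polynomial.C z, by simp⟩

lemma IsTruncation.pow_eq_zero {B : Type} [CommRing B] [Algebra ℂ B] {σ : B} {n : ℕ}
    (h : IsTruncation B σ n) : σ ^ n = 0 := by
  simpa using (h.dvd (Polynomial.X ^ n)).2 dvd_rfl

section Cyclic

variable {V W : Chart} {ρ : Diff V →ₐ[ℂ] Diff W.meetU} (hρ : IsRestriction ρ)
  {B : Type} [CommRing B] [Algebra ℂ B] {σ : B} {n : ℕ} (hB : IsTruncation B σ n) {c : ℤ}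
  (hc : ∀ b, (gam V c b).eval 0 ≠ 0)

lemma isCoprime_X_pow {p : ℂ[X]} (h : p.eval 0 ≠ 0) (n : ℕ) :
    IsCoprime (Polynomial.X ^ n) p := by
  refine IsCoprime.pow_left ((Polynomial.irreducible_X.coprime_iff_not_dvd).2 fun hd => h ?_)
  rwa [Polynomial.X_dvd_iff, Polynomial.coeff_zero_eq_eval_zero] at hd

/-- On the chart with the second coordinate inverted, all monomials act invertibly. -/
lemma gam_eval_of_inv (h : V 1 = true) (c b : ℤ) : (gam V c b).eval 0 ≠ 0 := by
  simp [gam, h]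

/-- The monomials act invertibly on `x₂⁻¹ t^s`. -/
lemma gam_one_eval (b : ℤ) : (gam V 1 b).eval 0 ≠ 0 := by
  unfold gam
  split_ifs
  · rw [Polynomial.eval_prod]
    refine Finset.prod_ne_zero_iff.2 fun j _ => ?_
    have : (1 : ℂ) + j ≠ 0 := by exact_mod_cast (by omega : 1 + j ≠ 0)
    rw [Polynomial.eval_sub, Polynomial.eval_X, Polynomial.eval_C, zero_sub, neg_ne_zero]
    exact_mod_cast this
  · simp

include hρ hB hc

/-- The annihilator of `x₂^(-c) t^s` in truncated coefficients. -/
theorem act_genVec_eq_zero_iff (a : Diff V) : act B σ ρ a (genVec W B c) = 0 ↔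
    ∃ b b', a = b * d 0 + b' * (θ 1 + algebraMap ℂ (Diff V) c) ^ n := by
  constructor
  · intro h
    obtain ⟨f, b, rfl⟩ := exists_normalForm hρ.chart c a
    rw [map_add, LinearMap.add_apply, act_mul_d _ _ hρ, add_zero] at h
    obtain ⟨b', hb'⟩ := exists_normalForm_mul_pow (V := V) c n f fun e => by
      have h1 := act_normalForm B σ hρ c f e
      rw [h, Finsupp.zero_apply, eq_comm, hB.dvd] at h1
      exact (isCoprime_X_pow (hc _) n).dvd_of_dvd_mul_left h1
    exact ⟨b, b', by rw [hb', add_comm]⟩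
  · rintro ⟨b, b', rfl⟩
    rw [map_add, LinearMap.add_apply, act_mul_d _ _ hρ, act_mul_θ_pow _ _ hρ, hB.pow_eq_zero]
    simp

/-- The vector `x₂^(-c) t^s` is a generator in truncated coefficients. -/
theorem exists_act_genVec (v : Expo W.meetU →₀ B) : ∃ a, act B σ ρ a (genVec W B c) = v := by
  have h : ∀ (b : ℤ) (z : B), ∃ p : ℂ[X], Polynomial.aeval σ (gam V c b * p) = z := fun b z => by
    obtain ⟨p, rfl⟩ := hB.surj z
    obtain ⟨u, w, huw⟩ := isCoprime_X_pow (hc b) n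
    refine ⟨w * p, ?_⟩
    rw [← sub_eq_zero, ← map_sub, hB.dvd]
    exact ⟨-u * p, by linear_combination p * huw⟩
  choose p hp using h
  classical
  let f : Expo W.meetU →₀ ℂ[X] := Finsupp.onFinset
    (v.support.preimage (shift c) (shift_injective c).injOn)
    (fun e => if v (shift c e) = 0 then 0 else p (e.1 1) (v (shift c e))) fun e he => by
      rw [Finset.mem_preimage, Finsupp.mem_support_iff]
      exact fun h0 => he (if_pos h0)
  refine ⟨normalForm V c f, ?_⟩
  ext e
  obtain ⟨e, rfl⟩ : ∃ e', shift c e' = e := ⟨shift (-c) e, expo_ext (by simp [shift])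
    (by simp [shift])⟩
  rw [act_normalForm _ _ hρ]
  change Polynomial.aeval σ (gam V c (e.1 1) *
    (if v (shift c e) = 0 then 0 else p (e.1 1) (v (shift c e)))) = _
  split_ifs with h0
  · simp [h0]
  · exact hp _ _

end Cyclic

section Dual

variable (W : Chart) {B : Type} [CommRing B] [Algebra ℂ B] {σ : B} {n : ℕ}
  (hB : IsTruncation B σ n)

lemma commute_d_θc {V : Chart} (c : ℤ) : Commute (d 0 : Diff V) (θ 1 + algebraMap ℂ _ (c : ℂ)) := by
  simpa using commute_d_aeval (V := V) c Polynomial.X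

/-- The `𝒟(W ∩ U)`-module `(𝒪(W ∩ U) ⊗ B) t^σ`. -/
abbrev twistMod (B : Type) [CommRing B] [Algebra ℂ B] (σ : B) : ModuleCat.{0} (Diff W.meetU) :=
  ModuleCat.of _ (Twist W B σ)

/-- The generator `t^σ`. -/
abbrev twistGenVec (B : Type) [CommRing B] [Algebra ℂ B] (σ : B) : Twist W B σ := genVec W B 0

include hB in
lemma twist_surj : Function.Surjective
    (LinearMap.toSpanSingleton (Diff W.meetU) (twistMod W B σ) (twistGenVec W B σ)) := fun v =>
  exists_act_genVec (isRestriction_id W) hB (gam_eval_of_inv W.meetU_one 0) v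

/-- The module `(𝒪(W ∩ U) ⊗ ℂ[s]/s^n) t^s` is `𝒟(W ∩ U) / (𝒟(W ∩ U) ∂₁ + 𝒟(W ∩ U) θ₂^n)`. -/
def twistKoszul : KoszulPresentation (Diff W.meetU) (twistMod W B σ) where
  P := d 0
  Q := (θ 1 + algebraMap ℂ _ ((0 : ℤ) : ℂ)) ^ n
  π := LinearMap.toSpanSingleton (Diff W.meetU) (twistMod W B σ) (twistGenVec W B σ)
  comm := ((commute_d_θc 0).pow_right n).eq
  regular_left := eq_zero_of_mul_d_eq_zero
  regular_right r b h := exists_mul_d_of_mul_θ_pow (isRestriction_id W) 0 n r b h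
  surj := twist_surj W hB
  ker := act_genVec_eq_zero_iff (isRestriction_id W) hB (gam_eval_of_inv W.meetU_one 0)

lemma tr_θc {V : Chart} : tr V (θ 1 + algebraMap ℂ _ ((0 : ℤ) : ℂ)) =
    -(θ 1 + algebraMap ℂ _ ((1 : ℤ) : ℂ)) := by
  rw [tr_add, tr_θ, Int.cast_zero, map_zero, tr_zero, add_zero]

/-- Transposition exchanges the right ideal of `∂₁` and `θ₂^n` with the left ideal of `∂₁` and
`(θ₂ + 1)^n`. -/
lemma exists_right_iff {V : Chart} (n : ℕ) (r : Diff V) :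
    (∃ a b, r = d 0 * a + (θ 1 + algebraMap ℂ _ ((0 : ℤ) : ℂ)) ^ n * b) ↔
      ∃ a b, tr V r = a * d 0 + b * (θ 1 + algebraMap ℂ _ ((1 : ℤ) : ℂ)) ^ n := by
  constructor
  · rintro ⟨a, b, rfl⟩
    refine ⟨-tr V a, tr V b * (-1) ^ n, ?_⟩
    rw [tr_add, tr_mul, tr_mul, tr_pow, tr_θc, tr_d, neg_pow (θ 1 + _)]
    noncomm_ring
  · rintro ⟨a, b, h⟩
    refine ⟨-tr V a, (-1) ^ n * tr V b, ?_⟩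
    have h2 : tr V (θ 1 + algebraMap ℂ _ ((1 : ℤ) : ℂ)) =
        -(θ 1 + algebraMap ℂ _ ((0 : ℤ) : ℂ)) := by
      rw [← neg_neg (θ 1 + algebraMap ℂ _ ((1 : ℤ) : ℂ)), ← tr_θc, tr_neg, tr_tr]
    rw [← tr_tr r, h, tr_add, tr_mul, tr_mul, tr_pow, h2, tr_d, neg_pow (θ 1 + _),
      ((Commute.neg_one_left (θ 1 + algebraMap ℂ (Diff V) ((0 : ℤ) : ℂ))).pow_pow n n).eq]
    noncomm_ring

/-- The dual of a `𝒟(W ∩ U)`-module, as a right module over `𝒟(W)`. -/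
abbrev dualRes (M : ModuleCat.{0} (Diff W.meetU)) : ModuleCat.{0} (Diff W)ᵐᵒᵖ :=
  (ModuleCat.restrictScalars (RingHom.op (Diff.res W).toRingHom)).obj (dual (Diff W.meetU) M)

/-- The map `𝒟(W) → 𝔻((𝒪 ⊗ ℂ[s]/s^n) t^s)` of right modules given by the Koszul complex. -/
def dualResπ : (Diff W)ᵐᵒᵖ →ₗ[(Diff W)ᵐᵒᵖ] dualRes W (twistMod W B σ) where
  toFun r := (twistKoszul W hB).toExt (Diff.res W r.unop)
  map_add' r t := by rw [MulOpposite.unop_add, map_add, map_add]; rfl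
  map_smul' r t := by
    rw [smul_eq_mul, MulOpposite.unop_mul, map_mul, KoszulPresentation.toExt_mul]
    rfl

/-- The dual of `(𝒪(W ∩ U) ⊗ ℂ[s]/s^n) t^s`, as a right `𝒟(W)`-module, is
`𝒟(W) / (∂₁ 𝒟(W) + θ₂^n 𝒟(W))`: this module is generated by the class of `1` although the chart
`W` need not invert `x₂`, because `θ₂ + 1` has no eigenvalue `0` on the negative powers. -/
def dualKoszul : KoszulPresentation (Diff W)ᵐᵒᵖ (dualRes W (twistMod W B σ)) where
  P := MulOpposite.op (d 0)
  Q := MulOpposite.op ((θ 1 + algebraMap ℂ _ ((0 : ℤ) : ℂ)) ^ n)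
  π := dualResπ W hB
  comm := by rw [← MulOpposite.op_mul, ← MulOpposite.op_mul, ((commute_d_θc 0).pow_right n).eq]
  regular_left r h := by
    have h1 : d 0 * r.unop = 0 := congrArg MulOpposite.unop h
    have h2 := congrArg (tr W) h1
    rw [tr_mul, tr_d, tr_zero, mul_neg, neg_eq_zero] at h2
    have h3 := congrArg (tr W) (eq_zero_of_mul_d_eq_zero _ h2)
    rw [tr_tr, tr_zero] at h3
    exact MulOpposite.unop_injective h3
  regular_right r b h := by
    have h1 : (θ 1 + algebraMap ℂ _ ((0 : ℤ) : ℂ)) ^ n * r.unop = d 0 * b.unop :=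
      congrArg MulOpposite.unop h
    have h2 := congrArg (tr W) h1
    rw [tr_mul, tr_mul, tr_pow, tr_θc, tr_d, neg_pow (θ 1 + _), ← mul_assoc, mul_neg,
      ← neg_mul] at h2
    obtain ⟨b', hb'⟩ := exists_mul_d_of_mul_θ_pow (isRestriction_res W) 1 n _ _ h2
    have h3 : tr W r.unop = (b' * (-1) ^ n) * d 0 := by
      rw [mul_assoc, ((Commute.neg_one_left (d 0 : Diff W)).pow_left n).eq, ← mul_assoc, ← hb',
        mul_assoc, ← pow_add, ← two_mul, pow_mul]
      simp
    refine ⟨MulOpposite.op (-tr W (b' * (-1) ^ n)), MulOpposite.unop_injective ?_⟩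
    change r.unop = d 0 * -tr W (b' * (-1) ^ n)
    rw [← tr_tr r.unop, h3, tr_mul, tr_d]
    noncomm_ring
  surj x := by
    obtain ⟨u, hu⟩ := (twistKoszul W hB).toExt_surjective x
    obtain ⟨r, hr⟩ := exists_act_genVec (isRestriction_res W) hB (c := 1) gam_one_eval
      (act B σ (AlgHom.id ℂ _) (tr W.meetU u) (genVec W B 1))
    refine ⟨MulOpposite.op (tr W r), ?_⟩
    rw [← hu]
    change (twistKoszul W hB).toExt (Diff.res W (tr W r)) = (twistKoszul W hB).toExt u
    rw [← sub_eq_zero, ← map_sub, KoszulPresentation.toExt_eq_zero_iff]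
    refine (exists_right_iff n _).2 ?_
    refine (act_genVec_eq_zero_iff (isRestriction_id W) hB gam_one_eval _).1 ?_
    rw [sub_eq_add_neg, tr_add, tr_neg, tr_res, tr_tr, map_add, map_neg, LinearMap.add_apply,
      LinearMap.neg_apply, ← hr]
    exact add_neg_cancel _
  ker r := by
    change (twistKoszul W hB).toExt (Diff.res W r.unop) = 0 ↔ _
    rw [KoszulPresentation.toExt_eq_zero_iff]
    have h1 := exists_right_iff n (Diff.res W r.unop)
    rw [tr_res] at h1
    refine h1.trans (Iff.trans ?_ ((exists_right_iff n r.unop).symm.trans ?_))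
    · rw [← act_genVec_eq_zero_iff (isRestriction_id W) hB gam_one_eval,
        ← act_genVec_eq_zero_iff (isRestriction_res W) hB gam_one_eval]
      rfl
    · constructor
      · rintro ⟨a, b, h⟩
        exact ⟨MulOpposite.op a, MulOpposite.op b, MulOpposite.unop_injective h⟩
      · rintro ⟨a, b, rfl⟩
        exact ⟨a.unop, b.unop, rfl⟩

/-- The map `𝒟(W) → j_! ((𝒪(W ∩ U) ⊗ ℂ[s]/s^n) t^s)` that identifies the target with
`𝒟(W) / (𝒟(W) ∂₁ + 𝒟(W) θ₂^n)`. -/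
def toShriek : Diff W →ₗ[Diff W] jShriek W (twistMod W B σ) where
  toFun a := (dualKoszul W hB).toExt (MulOpposite.op a)
  map_add' a b := by rw [MulOpposite.op_add, map_add]; rfl
  map_smul' a b := by
    rw [smul_eq_mul, MulOpposite.op_mul, KoszulPresentation.toExt_mul]
    rfl

lemma toShriek_surjective : Function.Surjective (toShriek W hB) := fun x => by
  obtain ⟨r, hr⟩ := (dualKoszul W hB).toExt_surjective x
  exact ⟨r.unop, hr⟩

lemma toShriek_eq_zero_iff (a : Diff W) : toShriek W hB a = 0 ↔
    ∃ b b', a = b * d 0 + b' * (θ 1 + algebraMap ℂ _ ((0 : ℤ) : ℂ)) ^ n := by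
  refine ((dualKoszul W hB).toExt_eq_zero_iff _).trans ⟨?_, ?_⟩
  · rintro ⟨b, b', h⟩
    exact ⟨b.unop, b'.unop, congrArg MulOpposite.unop h⟩
  · rintro ⟨b, b', rfl⟩
    exact ⟨MulOpposite.op b, MulOpposite.op b', rfl⟩

variable {B' : Type} [CommRing B'] [Algebra ℂ B'] {σ' : B'} {n' : ℕ}
  (hB' : IsTruncation B' σ' n')

/-- The effect of `j_!` on the map induced by a map of coefficients with `1 ↦ σ'^k`, where
multiplication by `s^k` maps `s^n ℂ[s]` to `s^(n') ℂ[s]` with quotient `s^l`. -/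
lemma jShriekMap_toShriek (f : twistMod W B σ ⟶ twistMod W B' σ') (k l : ℕ)
    (hf : f.hom (twistGenVec W B σ) = (σ' ^ k • genVec W B' 0 : Expo W.meetU →₀ B'))
    (hl : n + k = l + n') (a : Diff W) :
    (jShriekMap W f).hom (toShriek W hB a) =
      toShriek W hB' (a * (θ 1 + algebraMap ℂ _ ((0 : ℤ) : ℂ)) ^ k) := by
  have h1 : ∀ r, (dualMap (Diff W.meetU) f).hom ((twistKoszul W hB').toExt r) =
      (twistKoszul W hB).toExt ((θ 1 + algebraMap ℂ _ ((0 : ℤ) : ℂ)) ^ l * r) := by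
    refine (twistKoszul W hB).dualMap_toExt (twistKoszul W hB') f
      (c₀ := (θ 1 + algebraMap ℂ _ ((0 : ℤ) : ℂ)) ^ k)
      (c₁ := (θ 1 + algebraMap ℂ _ ((0 : ℤ) : ℂ)) ^ k)
      (c₂ := (θ 1 + algebraMap ℂ _ ((0 : ℤ) : ℂ)) ^ l) ?_ ?_ ?_ ?_ ?_
    · change f.hom ((1 : Diff W.meetU) • twistGenVec W B σ) =
        act B' σ' (AlgHom.id ℂ _) _ (genVec W B' 0)
      rw [one_smul, hf]
      have := act_mul_θ_pow B' σ' (isRestriction_id W) 0 k 1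
      rw [one_mul, map_one] at this
      exact this.symm
    · exact ((commute_d_θc 0).pow_right k).eq
    · change _ ^ n * _ ^ k = _ ^ l * _ ^ n'
      rw [← pow_add, ← pow_add, hl]
    · change _ ^ l * _ ^ n' = _ ^ n * _ ^ k
      rw [← pow_add, ← pow_add, hl]
    · exact ((commute_d_θc 0).pow_right l).eq.symm
  refine ((dualKoszul W hB').dualMap_toExt (dualKoszul W hB) _
    (c₀ := MulOpposite.op ((θ 1 + algebraMap ℂ _ ((0 : ℤ) : ℂ)) ^ l))
    (c₁ := MulOpposite.op ((θ 1 + algebraMap ℂ _ ((0 : ℤ) : ℂ)) ^ l))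
    (c₂ := MulOpposite.op ((θ 1 + algebraMap ℂ _ ((0 : ℤ) : ℂ)) ^ k))
    (c₃ := MulOpposite.op ((θ 1 + algebraMap ℂ _ ((0 : ℤ) : ℂ)) ^ k)) ?_ ?_ ?_ ?_ ?_ _)
  · refine (h1 _).trans ?_
    change (twistKoszul W hB).toExt (_ * Diff.res W 1) =
      (twistKoszul W hB).toExt (Diff.res W (_ ^ l))
    have hθ : Diff.res W (θ 1 + algebraMap ℂ _ ((0 : ℤ) : ℂ)) =
        θ 1 + algebraMap ℂ _ ((0 : ℤ) : ℂ) := by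
      rw [map_add, θ, map_mul, (isRestriction_res W).map_x, (isRestriction_res W).map_d,
        AlgHom.commutes]
      rfl
    rw [map_one, mul_one, map_pow (Diff.res W), hθ]
  · refine MulOpposite.unop_injective ?_
    exact ((commute_d_θc 0).pow_right l).eq.symm
  · refine MulOpposite.unop_injective ?_
    change _ ^ l * _ ^ n' = _ ^ n * _ ^ k
    rw [← pow_add, ← pow_add, hl]
  · refine MulOpposite.unop_injective ?_
    change _ ^ n * _ ^ k = _ ^ l * _ ^ n'
    rw [← pow_add, ← pow_add, hl]
  · refine MulOpposite.unop_injective ?_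
    exact ((commute_d_θc 0).pow_right k).eq

end Dual

section Interface

variable (W : Chart) (n : ℕ)

/-- The map `𝒟(W) → j_! f^s 𝒪_U^{(n)}` that corresponds to the section `t^s`. -/
def shriekGen : Diff W →ₗ[Diff W] jShriek W (fsO W n) := toShriek W (isTruncation_trunc n)

lemma shriekGen_surjective : Function.Surjective (shriekGen W n) := toShriek_surjective W _

lemma shriekGen_eq_zero_iff (a : Diff W) : shriekGen W n a = 0 ↔
    ∃ b b', a = b * d 0 + b' * (θ 1 + algebraMap ℂ _ ((0 : ℤ) : ℂ)) ^ n :=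
  toShriek_eq_zero_iff W _ a

lemma sShriek_shriekGen (a : Diff W) : sShriek W n (shriekGen W n a) =
    shriekGen W n (a * (θ 1 + algebraMap ℂ _ ((0 : ℤ) : ℂ))) := by
  have := jShriekMap_toShriek W (isTruncation_trunc n) (isTruncation_trunc n)
    (fsMul W n (Trunc.s n)) 1 1 (by
      rw [pow_one]
      change Finsupp.mapRange.linearMap (LinearMap.mulLeft ℂ (Trunc.s n)) (Finsupp.single _ 1) = _
      rw [Finsupp.mapRange.linearMap_apply, Finsupp.mapRange_single, genVec, Finsupp.smul_single]
      rfl) (add_comm _ _) a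
  rw [pow_one] at this
  exact this

lemma redShriek_shriekGen (hn : n ≠ 0) (a : Diff W) : redShriek W n hn (shriekGen W n a) =
    toShriek W isTruncation_complex a := by
  have := jShriekMap_toShriek W (isTruncation_trunc n) isTruncation_complex
    (fsRed W n hn) 0 (n - 1) (by
      rw [pow_zero, one_smul]
      change Finsupp.mapRange.linearMap (Trunc.eval n hn).toLinearMap (Finsupp.single _ 1) = _
      rw [Finsupp.mapRange.linearMap_apply, Finsupp.mapRange_single, genVec]
      congr 1
      exact map_one (Trunc.eval n hn)) (by omega) a
  rw [pow_zero, mul_one] at this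
  exact this

end Interface

end Jantzen

namespace Jantzen

/-! ### The coefficient ring `ℂ[s]_{(s)}` -/

open Diff

section CoefficientRing

lemma A.aeval_s (p : ℂ[X]) : Polynomial.aeval A.s p = algebraMap ℂ[X] A p := by
  have : (Polynomial.aeval A.s : ℂ[X] →ₐ[ℂ] A) = IsScalarTower.toAlgHom ℂ ℂ[X] A :=
    Polynomial.algHom_ext (by rw [Polynomial.aeval_X]; rfl)
  rw [this]; rfl

lemma A.algebraMap_injective : Function.Injective (algebraMap ℂ[X] A) :=
  IsLocalization.injective A
    (Ideal.primeCompl_le_nonZeroDivisors (Ideal.span {(Polynomial.X : ℂ[X])}))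

lemma A.s_ne_zero : A.s ≠ 0 := fun h =>
  Polynomial.X_ne_zero (A.algebraMap_injective (h.trans (map_zero _).symm))

lemma mem_primeCompl_iff (p : ℂ[X]) :
    p ∈ (Ideal.span {(Polynomial.X : ℂ[X])}).primeCompl ↔ p.eval 0 ≠ 0 := by
  rw [Ideal.mem_primeCompl_iff, Ideal.mem_span_singleton, Polynomial.X_dvd_iff,
    Polynomial.coeff_zero_eq_eval_zero]

lemma A.isUnit_aeval {p : ℂ[X]} (h : p.eval 0 ≠ 0) : IsUnit (Polynomial.aeval A.s p) := by
  rw [A.aeval_s]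
  exact IsLocalization.map_units A (⟨p, (mem_primeCompl_iff p).2 h⟩ :
    (Ideal.span {(Polynomial.X : ℂ[X])}).primeCompl)

/-- Every element of `A` is a polynomial up to `s^n A`. -/
lemma A.exists_approx (a : A) (n : ℕ) : ∃ (p : ℂ[X]) (b : A),
    a = Polynomial.aeval A.s p + A.s ^ n * b := by
  obtain ⟨p, ⟨r, hr⟩, rfl⟩ := IsLocalization.exists_mk'_eq
    (Ideal.span {(Polynomial.X : ℂ[X])}).primeCompl a
  obtain ⟨u, w, h⟩ := isCoprime_X_pow ((mem_primeCompl_iff r).1 hr) n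
  set a := IsLocalization.mk' A p (⟨r, hr⟩ : (Ideal.span {(Polynomial.X : ℂ[X])}).primeCompl)
  have h1 : a * Polynomial.aeval A.s r = Polynomial.aeval A.s p := by
    rw [A.aeval_s, A.aeval_s]
    exact IsLocalization.mk'_spec A p (⟨r, hr⟩ : (Ideal.span {(Polynomial.X : ℂ[X])}).primeCompl)
  have h2 := congrArg (Polynomial.aeval A.s) h
  simp only [map_add, map_mul, map_pow, Polynomial.aeval_X, map_one] at h2
  refine ⟨p * w, a * Polynomial.aeval A.s u, ?_⟩
  rw [map_mul]
  linear_combination (-a) * h2 + Polynomial.aeval A.s w * h1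

lemma A.pow_dvd_aeval_iff (n : ℕ) (p : ℂ[X]) :
    A.s ^ n ∣ Polynomial.aeval A.s p ↔ Polynomial.X ^ n ∣ p := by
  constructor
  · rintro ⟨b, hb⟩
    obtain ⟨q, ⟨r, hr⟩, rfl⟩ := IsLocalization.exists_mk'_eq
      (Ideal.span {(Polynomial.X : ℂ[X])}).primeCompl b
    have h1 := IsLocalization.mk'_spec A q (⟨r, hr⟩ :
      (Ideal.span {(Polynomial.X : ℂ[X])}).primeCompl)
    have h2 : algebraMap ℂ[X] A (p * r) = algebraMap ℂ[X] A (Polynomial.X ^ n * q) := by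
      rw [map_mul, ← A.aeval_s p, hb, map_mul, ← h1, map_pow, mul_assoc]
      rfl
    exact (isCoprime_X_pow ((mem_primeCompl_iff r).1 hr) n).dvd_of_dvd_mul_right
      ⟨q, A.algebraMap_injective h2⟩
  · rintro ⟨q, rfl⟩
    exact ⟨Polynomial.aeval A.s q, by simp⟩

/-- The reduction `A → ℂ[s] / s^n`. -/
def A.toTrunc (n : ℕ) : A →ₐ[ℂ] Trunc n :=
  IsLocalization.liftAlgHom (M := (Ideal.span {(Polynomial.X : ℂ[X])}).primeCompl)
    (f := (Polynomial.aeval (Trunc.s n) : ℂ[X] →ₐ[ℂ] Trunc n)) (by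
      rintro ⟨r, hr⟩
      obtain ⟨u, w, h⟩ := isCoprime_X_pow ((mem_primeCompl_iff r).1 hr) n
      refine IsUnit.of_mul_eq_one (Polynomial.aeval (Trunc.s n) w) ?_
      change Polynomial.aeval (Trunc.s n) r * _ = 1
      rw [← map_mul, ← sub_eq_zero, ← map_one (Polynomial.aeval (Trunc.s n) : ℂ[X] →ₐ[ℂ] Trunc n),
        ← map_sub, (isTruncation_trunc n).dvd]
      exact ⟨-u, by linear_combination h⟩)

lemma A.toTrunc_aeval (n : ℕ) (p : ℂ[X]) :
    A.toTrunc n (Polynomial.aeval A.s p) = Polynomial.aeval (Trunc.s n) p := by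
  rw [A.aeval_s]; simp [A.toTrunc]

lemma A.toTrunc_s (n : ℕ) : A.toTrunc n A.s = Trunc.s n := by
  simpa using A.toTrunc_aeval n Polynomial.X

lemma A.toTrunc_eq_zero_iff (n : ℕ) (a : A) : A.toTrunc n a = 0 ↔ A.s ^ n ∣ a := by
  obtain ⟨p, b, rfl⟩ := A.exists_approx a n
  rw [map_add, map_mul, map_pow, A.toTrunc_s, (isTruncation_trunc n).pow_eq_zero, zero_mul,
    add_zero, A.toTrunc_aeval, (isTruncation_trunc n).dvd, ← A.pow_dvd_aeval_iff,
    dvd_add_left (dvd_mul_right _ _)]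

lemma A.eval_eq_zero_iff (a : A) : A.eval a = 0 ↔ A.s ∣ a := by
  obtain ⟨p, b, rfl⟩ := A.exists_approx a 1
  have h : A.eval (Polynomial.aeval A.s p) = Polynomial.aeval (0 : ℂ) p := by
    rw [A.aeval_s]; simp [A.eval]
  have h2 := A.pow_dvd_aeval_iff 1 p
  rw [pow_one, pow_one] at h2
  rw [map_add, map_mul, map_pow, A.eval_s, pow_one, zero_mul, add_zero, h, pow_one,
    dvd_add_left (dvd_mul_right _ _), h2, Polynomial.X_dvd_iff, Polynomial.coeff_zero_eq_aeval_zero]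

/-- The properties of `A = ℂ[s]_{(s)}` with its parameter `s` that are used below, and its
reductions `ℂ[s] / s^n` and `ℂ`. -/
structure Parameter (R : Type) [CommRing R] [Algebra ℂ R] (s : R) where
  ne_zero : s ≠ 0
  isUnit_aeval : ∀ {p : ℂ[X]}, p.eval 0 ≠ 0 → IsUnit (Polynomial.aeval s p)
  exists_approx : ∀ (a : R) (n : ℕ), ∃ (p : ℂ[X]) (b : R), a = Polynomial.aeval s p + s ^ n * b
  pow_dvd_aeval_iff : ∀ (n : ℕ) (p : ℂ[X]), s ^ n ∣ Polynomial.aeval s p ↔ Polynomial.X ^ n ∣ p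
  toTrunc : ∀ n : ℕ, R →ₐ[ℂ] Trunc n
  toTrunc_s : ∀ n, toTrunc n s = Trunc.s n
  toTrunc_eq_zero_iff : ∀ n a, toTrunc n a = 0 ↔ s ^ n ∣ a
  eval : R →ₐ[ℂ] ℂ
  eval_s : eval s = 0
  eval_eq_zero_iff : ∀ a, eval a = 0 ↔ s ∣ a

/-- The parameter of `A`. -/
def A.parameter : Parameter A A.s where
  ne_zero := A.s_ne_zero
  isUnit_aeval := A.isUnit_aeval
  exists_approx := A.exists_approx
  pow_dvd_aeval_iff := A.pow_dvd_aeval_iff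
  toTrunc := A.toTrunc
  toTrunc_s := A.toTrunc_s
  toTrunc_eq_zero_iff := A.toTrunc_eq_zero_iff
  eval := A.eval
  eval_s := A.eval_s
  eval_eq_zero_iff := A.eval_eq_zero_iff

end CoefficientRing

namespace Parameter

variable {R : Type} [CommRing R] [Algebra ℂ R] {s : R} (P : Parameter R s)

include P

lemma toTrunc_surjective (n : ℕ) : Function.Surjective (P.toTrunc n) := fun b => by
  obtain ⟨p, rfl⟩ := (isTruncation_trunc n).surj b
  exact ⟨Polynomial.aeval s p, by rw [← Polynomial.aeval_algHom_apply, P.toTrunc_s]⟩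

lemma isUnit_add_s {z : ℂ} (h : z ≠ 0) : IsUnit (algebraMap ℂ R z + s) := by
  have := P.isUnit_aeval (p := Polynomial.C z + Polynomial.X) (by simpa using h)
  simpa using this

lemma aeval_ne_zero {p : ℂ[X]} (hp : p ≠ 0) : Polynomial.aeval s p ≠ 0 := fun h => by
  have h1 : Polynomial.X ^ (p.natDegree + 1) ∣ p :=
    (P.pow_dvd_aeval_iff _ _).1 (by rw [h]; exact dvd_zero _)
  have h2 := Polynomial.natDegree_le_of_dvd h1 hp
  rw [Polynomial.natDegree_X_pow] at h2
  omega

end Parameter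

end Jantzen

namespace Jantzen

open Diff

/-! ### The lattice generated by `t^s` -/

section Lattice

variable (W : Chart) {R : Type} [CommRing R]

/-- The module `(𝒪(W ∩ U) ⊗ R) t^s`. For `R = ℂ[s]_{(s)}` it is a lift of `j₊ f^s 𝒪_U^{(n)}` for all
`n` at once. -/
abbrev Lift (R : Type) [CommRing R] : Type := Expo W.meetU →₀ R

/-- The elements of `(𝒪(W ∩ U) ⊗ R) t^s` whose coefficients at negative powers of `x₂` are divisible
by `s`, if `x₂` is not inverted on `W`, and all elements otherwise. For `R = ℂ[s]_{(s)}` this is the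
`𝒟(W) ⊗ R`-submodule generated by `t^s`, and a lift of `j_! f^s 𝒪_U^{(n)}` for all `n` at once. -/
def lattice (s : R) : Submodule R (Lift W R) where
  carrier := {f | ∀ e, W 1 = false → e.1 1 < 0 → s ∣ f e}
  add_mem' hf hg e h1 h2 := dvd_add (hf e h1 h2) (hg e h1 h2)
  zero_mem' _ _ _ := dvd_zero _
  smul_mem' c _ hf e h1 h2 := (hf e h1 h2).mul_left c

variable {s : R}

lemma single_mem_lattice {W : Chart} {e : Expo W.meetU} {a : R}
    (h : W 1 = false → e.1 1 < 0 → s ∣ a) :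
    Finsupp.single e a ∈ lattice W s := fun e' h1 h2 => by
  classical
  rw [Finsupp.single_apply]
  split_ifs with he
  · subst he; exact h h1 h2
  · exact dvd_zero _

lemma s_smul_mem_lattice (f : Lift W R) : s • f ∈ lattice W s := fun e _ _ => by
  rw [Finsupp.smul_apply, smul_eq_mul]; exact dvd_mul_right _ _

lemma shift_zero {W : Chart} (e : Expo W.meetU) : shift 0 e = e :=
  expo_ext (by simp [shift]) (by simp [shift])

variable [Algebra ℂ R]

/-- The action of `𝒟(W)` on `(𝒪(W ∩ U) ⊗ R) t^s`. -/
abbrev actL (W : Chart) (s : R) : Diff W →ₐ[ℂ] Module.End ℂ (Lift W R) := act R s (Diff.res W)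

variable (P : Parameter R s)
include P

/-- A negative power of `x₂` carries exactly one factor `s`. -/
lemma gam_dvd_iff (b : ℤ) (a : R) :
    Polynomial.aeval s (gam W 0 b) ∣ a ↔ (W 1 = false → b < 0 → s ∣ a) := by
  by_cases h : W 1 = false ∧ b < 0
  · obtain ⟨k, hk⟩ : ∃ k : ℕ, (-b).toNat = k + 1 := ⟨(-b).toNat - 1, by omega⟩
    have h1 : gam W 0 b = (∏ j ∈ Finset.range k,
        (Polynomial.X - Polynomial.C ((0 + (j + 1 : ℕ) : ℤ) : ℂ))) * Polynomial.X := by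
      rw [gam, if_pos h, hk, Finset.prod_range_succ']
      simp
    have h2 : IsUnit (Polynomial.aeval s (∏ j ∈ Finset.range k,
        (Polynomial.X - Polynomial.C ((0 + (j + 1 : ℕ) : ℤ) : ℂ)))) := by
      refine P.isUnit_aeval ?_
      rw [Polynomial.eval_prod]
      refine Finset.prod_ne_zero_iff.2 fun j _ => ?_
      rw [Polynomial.eval_sub, Polynomial.eval_X, Polynomial.eval_C, zero_sub, neg_ne_zero]
      exact_mod_cast j.succ_ne_zero
    rw [h1, map_mul, Polynomial.aeval_X, h2.mul_left_dvd]
    simp [h]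
  · rw [gam, if_neg h, map_one]
    simp only [one_dvd, true_iff]
    exact fun h1 h2 => absurd ⟨h1, h2⟩ h

variable {W}

lemma mem_lattice_iff (f : Lift W R) :
    f ∈ lattice W s ↔ ∀ e, Polynomial.aeval s (gam W 0 (e.1 1)) ∣ f e :=
  forall_congr' fun _ => (gam_dvd_iff W P _ _).symm

/-- An additive property of the elements of the lattice holds if it holds for its terms. -/
lemma lattice_induction {p : Lift W R → Prop} (h0 : p 0) (hadd : ∀ f g, p f → p g → p (f + g))
    (hs : ∀ e z, p (Finsupp.single e (Polynomial.aeval s (gam W 0 (e.1 1)) * z)))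
    {f : Lift W R} (hf : f ∈ lattice W s) : p f := by
  rw [← Finsupp.sum_single f]
  refine Finset.sum_induction _ p hadd h0 fun e _ => ?_
  obtain ⟨z, hz⟩ := (mem_lattice_iff P f).1 hf e
  rw [hz]
  exact hs e z

omit P in
lemma single_gam_eq (e : Expo W.meetU) (z : R) :
    Finsupp.single e (Polynomial.aeval s (gam W 0 (e.1 1)) * z) =
      z • actL W s (mono W e) (genVec W R 0) := by
  rw [genVec, act_mono R s (isRestriction_res W), shift_zero, Finsupp.smul_single, mul_one,
    smul_eq_mul, mul_comm]

lemma act_genVec_mem_lattice (a : Diff W) : actL W s a (genVec W R 0) ∈ lattice W s := by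
  obtain ⟨f, b, rfl⟩ := exists_normalForm (W := W) rfl 0 a
  rw [map_add, LinearMap.add_apply, act_mul_d _ _ (isRestriction_res W), add_zero,
    mem_lattice_iff P]
  intro e
  rw [← shift_zero e, act_normalForm _ _ (isRestriction_res W), shift_zero, map_mul]
  exact dvd_mul_right _ _

lemma act_mem_lattice (a : Diff W) {f : Lift W R} (hf : f ∈ lattice W s) :
    actL W s a f ∈ lattice W s := by
  refine lattice_induction P (p := fun f => actL W s a f ∈ lattice W s) (by simp) ?_ ?_ hf
  · intro f g hf hg; rw [map_add]; exact add_mem hf hg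
  · intro e z
    rw [single_gam_eq, act_smul, ← Module.End.mul_apply, ← map_mul]
    exact Submodule.smul_mem _ _ (act_genVec_mem_lattice P _)

/-- Modulo `s^n`, the lattice is generated by `t^s` over `𝒟(W)`. -/
lemma exists_lattice_approx (n : ℕ) {f : Lift W R} (hf : f ∈ lattice W s) :
    ∃ (a : Diff W) (g : Lift W R), g ∈ lattice W s ∧ f = actL W s a (genVec W R 0) + s ^ n • g := by
  refine lattice_induction P (p := fun f => ∃ (a : Diff W) (g : Lift W R), g ∈ lattice W s ∧
    f = actL W s a (genVec W R 0) + s ^ n • g) ⟨0, 0, zero_mem _, by simp⟩ ?_ ?_ hf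
  · rintro _ _ ⟨a, g, hg, rfl⟩ ⟨b, g', hg', rfl⟩
    exact ⟨a + b, g + g', add_mem hg hg', by
      rw [map_add, LinearMap.add_apply, smul_add]; abel⟩
  · intro e z
    obtain ⟨p, z', rfl⟩ := P.exists_approx z n
    refine ⟨normalForm W 0 (Finsupp.single e p), Finsupp.single e
      (Polynomial.aeval s (gam W 0 (e.1 1)) * z'), single_mem_lattice ((gam_dvd_iff W P _ _).1
        (dvd_mul_right _ _)), ?_⟩
    rw [normalForm_single, map_mul, Module.End.mul_apply, genVec,
      act_aeval R s (isRestriction_res W) 0 p _ (base_one 0), act_mono R s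
      (isRestriction_res W), shift_zero, Finsupp.smul_single, ← Finsupp.single_add]
    congr 1
    rw [smul_eq_mul]
    ring

/-- Every element is moved into the lattice by a power of `x₂`. -/
lemma exists_x_pow_mem_lattice (f : Lift W R) : ∃ k : ℕ, actL W s (x 1 ^ k) f ∈ lattice W s := by
  induction f using Finsupp.induction_linear with
  | zero => exact ⟨0, by simp⟩
  | add f g hf hg =>
    obtain ⟨k, hk⟩ := hf
    obtain ⟨l, hl⟩ := hg
    refine ⟨k + l, ?_⟩
    rw [map_add]
    refine add_mem ?_ ?_
    · rw [add_comm, pow_add, map_mul, Module.End.mul_apply]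
      exact act_mem_lattice P _ hk
    · rw [pow_add, map_mul, Module.End.mul_apply]
      exact act_mem_lattice P _ hl
  | single e z =>
    let e' : Expo W.meetU := shift (-((-e.1 1).toNat : ℤ)) e
    refine ⟨(-e.1 1).toNat, ?_⟩
    rw [act_x_pow R s (isRestriction_res W) 1 _ e e' ?_]
    · refine single_mem_lattice fun _ h => ?_
      simp only [e', shift, if_true] at h
      omega
    · funext i
      obtain rfl | rfl : i = 0 ∨ i = 1 := by omega
      · simp [e', shift]
      · simp [e', shift]

variable [IsDomain R]

/-- The operators that map `t^s` into `s^n` times the lattice. -/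
lemma act_genVec_mem_pow_iff (n : ℕ) (a : Diff W) :
    (∃ g ∈ lattice W s, actL W s a (genVec W R 0) = s ^ n • g) ↔
      ∃ b b', a = b * d 0 + b' * (θ 1 + algebraMap ℂ (Diff W) ((0 : ℤ) : ℂ)) ^ n := by
  constructor
  · rintro ⟨g, hg, h⟩
    obtain ⟨f, b, rfl⟩ := exists_normalForm (W := W) rfl 0 a
    rw [map_add, LinearMap.add_apply, act_mul_d _ _ (isRestriction_res W), add_zero] at h
    obtain ⟨b', hb'⟩ := exists_normalForm_mul_pow (V := W) 0 n f fun e => by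
      have h1 := act_normalForm R s (isRestriction_res W) 0 f e
      rw [h, shift_zero, Finsupp.smul_apply, map_mul] at h1
      obtain ⟨z, hz⟩ := (mem_lattice_iff P g).1 hg e
      rw [hz, smul_eq_mul, mul_left_comm] at h1
      have h2 := mul_left_cancel₀ (P.aeval_ne_zero (gam_ne_zero (V := W) 0 (e.1 1))) h1
      exact (P.pow_dvd_aeval_iff n _).1 ⟨z, h2.symm⟩
    exact ⟨b, b', by rw [hb', add_comm]⟩
  · rintro ⟨b, b', rfl⟩
    refine ⟨actL W s b' (genVec W R 0), act_genVec_mem_lattice P b', ?_⟩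
    rw [map_add, LinearMap.add_apply, act_mul_d _ _ (isRestriction_res W),
      act_mul_θ_pow _ _ (isRestriction_res W), zero_add]

end Lattice

/-! ### Reduction of the lattice and of its ambient module modulo `s^n` -/

section Projections

variable {W : Chart} {R : Type} [CommRing R]

lemma exists_smul_of_dvd {a : R} (f : Lift W R) (h : ∀ e, a ∣ f e) : ∃ g, f = a • g := by
  induction f using Finsupp.induction with
  | zero => exact ⟨0, by simp⟩
  | single_add e b f he hb ih =>
    classical
    obtain ⟨g, rfl⟩ := ih fun e' => by
      by_cases hee : e' = e
      · subst hee; rw [Finsupp.notMem_support_iff.1 he]; exact dvd_zero _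
      · have := h e'
        rwa [Finsupp.add_apply, Finsupp.single_apply, if_neg (Ne.symm hee), zero_add] at this
    have := h e
    rw [Finsupp.add_apply, Finsupp.single_eq_same, Finsupp.notMem_support_iff.1 he,
      add_zero] at this
    obtain ⟨z, rfl⟩ := this
    exact ⟨Finsupp.single e z + g, by simp [smul_add]⟩

variable [Algebra ℂ R] {s : R} (P : Parameter R s) (n : ℕ)

section

variable [IsDomain R]

/-- The operator chosen to represent an element of the lattice modulo `s^n` matters only up to the
relations of `j_! f^s 𝒪_U^{(n)}`. -/
lemma shriekGen_choose_eq (f : lattice W s) (a : Diff W) (g : Lift W R) (hg : g ∈ lattice W s)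
    (h : f.1 = actL W s a (genVec W R 0) + s ^ n • g) :
    shriekGen W n (exists_lattice_approx P n f.2).choose = shriekGen W n a := by
  obtain ⟨g', hg', h'⟩ := (exists_lattice_approx P n f.2).choose_spec
  rw [← sub_eq_zero, ← map_sub, shriekGen_eq_zero_iff, ← act_genVec_mem_pow_iff P]
  refine ⟨g - g', sub_mem hg hg', ?_⟩
  rw [map_sub, LinearMap.sub_apply, smul_sub, sub_eq_sub_iff_add_eq_add, ← h', h, add_comm]

/-- The projection from the lattice to `j_! f^s 𝒪_U^{(n)}`, with kernel `s^n` times the lattice. -/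
def latticeProj : lattice W s →+ jShriek W (fsO W n) :=
  AddMonoidHom.mk' (fun f => shriekGen W n (exists_lattice_approx P n f.2).choose) (by
    intro f f'
    rw [← map_add]
    obtain ⟨g, hg, h⟩ := (exists_lattice_approx P n f.2).choose_spec
    obtain ⟨g', hg', h'⟩ := (exists_lattice_approx P n f'.2).choose_spec
    refine shriekGen_choose_eq P n _ _ (g + g') (add_mem hg hg') ?_
    rw [map_add, LinearMap.add_apply, smul_add, add_add_add_comm, ← h, ← h']
    rfl)

lemma latticeProj_eq (f : lattice W s) (a : Diff W) (g : Lift W R) (hg : g ∈ lattice W s)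
    (h : f.1 = actL W s a (genVec W R 0) + s ^ n • g) :
    latticeProj P n f = shriekGen W n a := shriekGen_choose_eq P n f a g hg h

lemma latticeProj_act_genVec (a : Diff W) :
    latticeProj P n ⟨actL W s a (genVec W R 0), act_genVec_mem_lattice P a⟩ = shriekGen W n a :=
  latticeProj_eq P n _ a 0 (zero_mem _) (by simp)

lemma latticeProj_surjective : Function.Surjective (latticeProj P (W := W) n) := fun v => by
  obtain ⟨a, rfl⟩ := shriekGen_surjective W n v
  exact ⟨_, latticeProj_act_genVec P n a⟩

lemma latticeProj_act (a : Diff W) (f : lattice W s) :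
    latticeProj P n ⟨actL W s a f.1, act_mem_lattice P a f.2⟩ = a • latticeProj P n f := by
  obtain ⟨b, g, hg, h⟩ := exists_lattice_approx P n f.2
  rw [latticeProj_eq P n f b g hg h, latticeProj_eq P n _ (a * b) (actL W s a g)
    (act_mem_lattice P a hg), ← smul_eq_mul, map_smul]
  change actL W s a f.1 = _
  rw [h, map_add, act_smul, map_mul, Module.End.mul_apply]

lemma latticeProj_s (f : lattice W s) :
    latticeProj P n (s • f) = sShriek W n (latticeProj P n f) := by
  obtain ⟨b, g, hg, h⟩ := exists_lattice_approx P n f.2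
  rw [latticeProj_eq P n f b g hg h, sShriek_shriekGen,
    latticeProj_eq P n _ (b * (θ 1 + algebraMap ℂ _ ((0 : ℤ) : ℂ))) (s • g)
      (Submodule.smul_mem _ _ hg)]
  rw [act_mul_θ _ _ (isRestriction_res W), Submodule.coe_smul, h, smul_add, smul_comm]

lemma latticeProj_eq_zero_iff (f : lattice W s) :
    latticeProj P n f = 0 ↔ ∃ g ∈ lattice W s, f.1 = s ^ n • g := by
  constructor
  · intro h
    obtain ⟨b, g, hg, hb⟩ := exists_lattice_approx P n f.2
    rw [latticeProj_eq P n f b g hg hb, shriekGen_eq_zero_iff, ← act_genVec_mem_pow_iff P] at h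
    obtain ⟨g', hg', h'⟩ := h
    exact ⟨g' + g, add_mem hg' hg, by rw [hb, h', smul_add]⟩
  · rintro ⟨g, hg, h⟩
    rw [latticeProj_eq P n f 0 g hg (by simpa using h), map_zero]

end

/-- A family of coefficients, as an element of `j₊ f^s 𝒪_U^{(n)}`. -/
def toPlus (W : Chart) (n : ℕ) : (Expo W.meetU →₀ Trunc n) ≃+ jPlus W (fsO W n) :=
  AddEquiv.refl (Expo W.meetU →₀ Trunc n)

lemma smul_toPlus (a : Diff W) (v : Expo W.meetU →₀ Trunc n) : a • toPlus W n v =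
    toPlus W n (act (Trunc n) (Trunc.s n) (Diff.res W) a v) := rfl

lemma mulPlus_toPlus (b : Trunc n) (v : Expo W.meetU →₀ Trunc n) :
    mulPlus W n b (toPlus W n v) = toPlus W n (b • v) := by
  have : Finsupp.mapRange.linearMap (LinearMap.mulLeft ℂ b) v = b • v := by ext; simp
  rw [← this]
  rfl

lemma mulPlus_mul (b c : Trunc n) (v : jPlus W (fsO W n)) :
    mulPlus W n (b * c) v = mulPlus W n b (mulPlus W n c v) := by
  obtain ⟨v, rfl⟩ := (toPlus W n).surjective v
  rw [mulPlus_toPlus, mulPlus_toPlus, mulPlus_toPlus]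
  congr 1
  ext e
  exact mul_assoc b c (v e)

lemma mulPlus_one (v : jPlus W (fsO W n)) : mulPlus W n 1 v = v := by
  obtain ⟨v, rfl⟩ := (toPlus W n).surjective v
  rw [mulPlus_toPlus, one_smul]

lemma sPlus_mulPlus (b : Trunc n) (v : jPlus W (fsO W n)) :
    sPlus W n (mulPlus W n b v) = mulPlus W n b (sPlus W n v) := by
  rw [sPlus, ← mulPlus_mul, ← mulPlus_mul, mul_comm]

/-- The projection `(𝒪(W ∩ U) ⊗ R) t^s → j₊ f^s 𝒪_U^{(n)}`. -/
def plusProj : Lift W R →+ jPlus W (fsO W n) :=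
  (toPlus W n).toAddMonoidHom.comp (Finsupp.mapRange.addMonoidHom (P.toTrunc n))

lemma plusProj_eq (f : Lift W R) : plusProj P n f =
    toPlus W n (Finsupp.mapRange.linearMap (P.toTrunc n).toLinearMap f) := rfl

lemma plusProj_act (a : Diff W) (f : Lift W R) :
    plusProj P n (actL W s a f) = a • plusProj P n f := by
  rw [plusProj_eq, plusProj_eq, smul_toPlus]
  congr 1
  refine twist_coeff_comm W _ (fun b => ?_) _ _
  change P.toTrunc n (s * b) = Trunc.s n * P.toTrunc n b
  rw [map_mul, P.toTrunc_s]

lemma plusProj_smul (a : R) (f : Lift W R) :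
    plusProj P n (a • f) = mulPlus W n (P.toTrunc n a) (plusProj P n f) := by
  rw [plusProj_eq, plusProj_eq, mulPlus_toPlus]
  congr 1
  ext e
  simp

lemma plusProj_s (f : Lift W R) : plusProj P n (s • f) = sPlus W n (plusProj P n f) := by
  rw [plusProj_smul, P.toTrunc_s]; rfl

lemma plusProj_surjective : Function.Surjective (plusProj (W := W) P n) := fun v => by
  obtain ⟨v, rfl⟩ := (toPlus W n).surjective v
  obtain ⟨f, rfl⟩ := Finsupp.mapRange_surjective _ (map_zero (P.toTrunc n))
    (P.toTrunc_surjective n) v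
  exact ⟨f, rfl⟩

lemma plusProj_eq_zero_iff (f : Lift W R) : plusProj P n f = 0 ↔ ∃ g, f = s ^ n • g := by
  constructor
  · intro h
    refine exists_smul_of_dvd f fun e => (P.toTrunc_eq_zero_iff n _).1 ?_
    exact DFunLike.congr_fun (show (Finsupp.mapRange.linearMap (P.toTrunc n).toLinearMap f :
      Expo W.meetU →₀ Trunc n) = 0 from h) e
  · rintro ⟨g, rfl⟩
    have h0 : mulPlus W n 0 (plusProj P n g) = 0 := by
      rw [plusProj_eq, mulPlus_toPlus, ← map_zero (toPlus W n)]
      congr 1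
      ext e
      exact zero_mul _
    rw [plusProj_smul, map_pow, P.toTrunc_s, (isTruncation_trunc n).pow_eq_zero, h0]

lemma plusProj_genVec : plusProj P n (genVec W R 0) = toPlus W n (genVec W (Trunc n) 0) := by
  rw [plusProj_eq]
  simp [genVec]

end Projections

/-! ### Canonical maps -/

section CanonicalMaps

variable {W : Chart} {n : ℕ}

/-- The Euler operators act diagonally. -/
lemma act_x_mul_d_apply {V W : Chart} {ρ : Diff V →ₐ[ℂ] Diff W.meetU} (B : Type) [CommRing B]
    [Algebra ℂ B] (σ : B) (hρ : IsRestriction ρ) (i : Fin 2) (v : Expo W.meetU →₀ B)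
    (e : Expo W.meetU) : act B σ ρ (x i * d i) v e =
      ((e.1 i : B) + if i = 1 then σ else 0) * v e := by
  classical
  induction v using Finsupp.induction_linear with
  | zero => simp
  | add f g hf hg => rw [map_add, Finsupp.add_apply, hf, hg, Finsupp.add_apply, mul_add]
  | single e' z =>
    rw [map_mul, Module.End.mul_apply, act_d hρ, act_x hρ]
    by_cases h : W.meetU i = false → 1 ≤ e'.1 i
    · rw [Expo.up_down _ _ h]
      by_cases he : e' = e
      · rw [he, Finsupp.single_eq_same, Finsupp.single_eq_same]
      · rw [Finsupp.single_eq_of_ne (Ne.symm he), Finsupp.single_eq_of_ne (Ne.symm he), mul_zero]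
    · push Not at h
      have hi : i ≠ 1 := by
        rintro rfl
        simp [Chart.meetU] at h
      have h0 : e'.1 i = 0 := by
        have := e'.2 i h.1
        omega
      by_cases he : e' = e
      · simp [hi, h0, ← he]
      · rw [Finsupp.single_eq_of_ne (Ne.symm he)]
        simp [hi, h0]

/-- The vectors that satisfy the equations of `t^s` are the multiples of `t^s`. -/
lemma eq_smul_genVec (v : Expo W.meetU →₀ Trunc n)
    (h0 : act (Trunc n) (Trunc.s n) (Diff.res W) (d 0) v = 0)
    (h1 : act (Trunc n) (Trunc.s n) (Diff.res W) (θ 1) v = Trunc.s n • v) :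
    v = v (base W 0) • genVec W (Trunc n) 0 := by
  have hz : ∀ (z : ℤ) (b : Trunc n), z ≠ 0 → (z : Trunc n) * b = 0 → b = 0 := by
    intro z b hz h
    have h2 : (z : ℂ) • b = 0 := by
      rw [← h, ← zsmul_eq_mul]
      exact Int.cast_smul_eq_zsmul ℂ z b
    exact (smul_eq_zero.1 h2).resolve_left (by exact_mod_cast hz)
  have hx := fun e => act_x_mul_d_apply (Trunc n) (Trunc.s n) (isRestriction_res W) 0 v e
  have hy := fun e => act_x_mul_d_apply (Trunc n) (Trunc.s n) (isRestriction_res W) 1 v e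
  simp only [Fin.isValue, if_true, zero_ne_one, if_false, add_zero] at hx hy
  rw [← θ, h1] at hy
  classical
  ext e
  rw [Finsupp.smul_apply, genVec, Finsupp.single_apply]
  split_ifs with he
  · rw [← he]; simp
  · by_cases he0 : e.1 0 = 0
    · have he1 : e.1 1 ≠ 0 := fun he1 => he (expo_ext (by rw [base_zero, he0])
        (by rw [base_one, he1]; rfl))
      have := hy e
      rw [Finsupp.smul_apply, add_mul, smul_eq_mul, right_eq_add] at this
      rw [hz _ _ he1 this, smul_zero]
    · have := hx e
      rw [map_mul, Module.End.mul_apply, h0, map_zero, Finsupp.zero_apply] at this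
      rw [hz _ _ he0 this.symm, smul_zero]

variable {R : Type} [CommRing R] [Algebra ℂ R] {s : R} (P : Parameter R s)

lemma shriekGen_smul (a : Diff W) : shriekGen W n a = a • shriekGen W n 1 := by
  rw [← map_smul, smul_eq_mul, mul_one]

lemma res_x_pow_genVec (k : ℕ) : ∃ e : Expo W.meetU,
    act (Trunc n) (Trunc.s n) (Diff.res W) (x 1 ^ k) (genVec W (Trunc n) 0) =
      Finsupp.single e 1 := by
  refine ⟨shift (-(k : ℤ)) (base W 0), ?_⟩
  refine act_x_pow _ _ (isRestriction_res W) 1 k _ _ ?_ 1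
  funext i
  obtain rfl | rfl : i = 0 ∨ i = 1 := by omega
  · simp [shift]
  · simp [shift]

/-- A canonical map is determined by a unit: it maps the section `t^s` to a multiple of `t^s`, and
the multiple is a unit because the cokernel is `x₂`-power torsion. -/
lemma CanonicalMap.exists_unit (can : CanonicalMap W n) : ∃ u : (Trunc n)ˣ, ∀ a,
    can.toLin (shriekGen W n a) = mulPlus W n u (a • toPlus W n (genVec W (Trunc n) 0)) := by
  obtain ⟨v, hv1⟩ := (toPlus W n).surjective (can.toLin (shriekGen W n 1))
  have hv : ∀ a, can.toLin (shriekGen W n a) =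
      toPlus W n (act (Trunc n) (Trunc.s n) (Diff.res W) a v) := fun a => by
    rw [shriekGen_smul, map_smul, ← hv1, smul_toPlus]
  have h0 : act (Trunc n) (Trunc.s n) (Diff.res W) (d 0) v = 0 := by
    refine (toPlus W n).injective ((hv (d 0)).symm.trans ?_)
    rw [(shriekGen_eq_zero_iff W n (d 0)).2 ⟨1, 0, by simp⟩, map_zero, map_zero]
  have h1 : act (Trunc n) (Trunc.s n) (Diff.res W) (θ 1) v = Trunc.s n • v := by
    refine (toPlus W n).injective ((hv (θ 1)).symm.trans ?_)
    have := sShriek_shriekGen W n 1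
    rw [one_mul, Int.cast_zero, map_zero, add_zero] at this
    rw [← this, can.comm, ← hv1, sPlus, mulPlus_toPlus]
  have hb := eq_smul_genVec v h0 h1
  have hu : IsUnit (v (base W 0)) := by
    obtain ⟨k, w, hw⟩ := can.torsion_coker (toPlus W n (genVec W (Trunc n) 0))
    obtain ⟨a, rfl⟩ := shriekGen_surjective W n w
    obtain ⟨e, he⟩ := res_x_pow_genVec (W := W) (n := n) k
    rw [hv, smul_toPlus, he] at hw
    have h2 := (toPlus W n).injective hw
    rw [hb, act_smul] at h2
    have h3 := DFunLike.congr_fun h2 e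
    rw [Finsupp.smul_apply, Finsupp.single_eq_same, smul_eq_mul] at h3
    exact IsUnit.of_mul_eq_one _ h3
  obtain ⟨u, hu⟩ := hu
  refine ⟨u, fun a => (hv a).trans ?_⟩
  rw [hb, act_smul, hu, smul_toPlus, mulPlus_toPlus]

/-- The canonical map that restricts to the identity on `W ∩ U`: it sends `t^s` to `t^s`. -/
lemma exists_shriek_to_plus (W : Chart) (n : ℕ) :
    ∃ F : jShriek W (fsO W n) →ₗ[Diff W] jPlus W (fsO W n),
      ∀ a, F (shriekGen W n a) = a • toPlus W n (genVec W (Trunc n) 0) := by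
  let G : Diff W →ₗ[Diff W] jPlus W (fsO W n) :=
    LinearMap.toSpanSingleton (Diff W) (jPlus W (fsO W n)) (toPlus W n (genVec W (Trunc n) 0))
  have hG : LinearMap.ker (shriekGen W n) ≤ LinearMap.ker G := by
    intro a ha
    obtain ⟨b, b', rfl⟩ := (shriekGen_eq_zero_iff W n a).1 ha
    rw [LinearMap.mem_ker, LinearMap.toSpanSingleton_apply, smul_toPlus, map_add (act _ _ _),
      LinearMap.add_apply, act_mul_d _ _ (isRestriction_res W),
      act_mul_θ_pow _ _ (isRestriction_res W), (isTruncation_trunc n).pow_eq_zero, zero_smul,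
      add_zero, map_zero]
  refine ⟨(Submodule.liftQ _ G hG).comp
    ((shriekGen W n).quotKerEquivOfSurjective (shriekGen_surjective W n)).symm.toLinearMap,
    fun a => ?_⟩
  have : ((shriekGen W n).quotKerEquivOfSurjective (shriekGen_surjective W n)).symm
      (shriekGen W n a) = Submodule.Quotient.mk a := by
    rw [LinearEquiv.symm_apply_eq]; rfl
  rw [LinearMap.comp_apply, LinearEquiv.coe_coe, this]
  rfl

section

variable [IsDomain R]

lemma latticeProj_plusProj_compat {F : jShriek W (fsO W n) →ₗ[Diff W] jPlus W (fsO W n)}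
    {u : Trunc n}
    (hF : ∀ a, F (shriekGen W n a) = mulPlus W n u (a • toPlus W n (genVec W (Trunc n) 0)))
    (f : lattice W s) : F (latticeProj P n f) = mulPlus W n u (plusProj P n f.1) := by
  obtain ⟨a, g, hg, h⟩ := exists_lattice_approx P n f.2
  rw [latticeProj_eq P n f a g hg h, hF, h, map_add, plusProj_act, plusProj_genVec,
    (plusProj_eq_zero_iff P n _).2 ⟨g, rfl⟩, add_zero]

/-- A canonical map is induced by the inclusion of the lattice, up to a unit. -/
lemma CanonicalMap.exists_unit_latticeProj (can : CanonicalMap W n) :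
    ∃ u : (Trunc n)ˣ, ∀ f : lattice W s,
      can.toLin (latticeProj P n f) = mulPlus W n u (plusProj P n f.1) := by
  obtain ⟨u, hu⟩ := can.exists_unit
  exact ⟨u, latticeProj_plusProj_compat P hu⟩

include P in
/-- The inclusion of the lattice induces a canonical map. -/
lemma nonempty_canonicalMap (W : Chart) (n : ℕ) : Nonempty (CanonicalMap W n) := by
  obtain ⟨F, hF⟩ := exists_shriek_to_plus W n
  have hc : ∀ f : lattice W s, F (latticeProj P n f) = plusProj P n f.1 := fun f => by
    have := latticeProj_plusProj_compat P (u := 1) (F := F)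
      (fun a => by rw [hF, mulPlus_one]) f
    rwa [mulPlus_one] at this
  refine ⟨⟨F, fun v => ?_, fun v hv => ?_, fun w => ?_⟩⟩
  · obtain ⟨f, rfl⟩ := latticeProj_surjective P n v
    rw [← latticeProj_s, hc, hc, Submodule.coe_smul, plusProj_s]
  · obtain ⟨f, rfl⟩ := latticeProj_surjective P n v
    rw [hc] at hv
    obtain ⟨g, hg⟩ := (plusProj_eq_zero_iff P n f.1).1 hv
    obtain ⟨k, hk⟩ := exists_x_pow_mem_lattice P g
    refine ⟨k, ?_⟩
    rw [← latticeProj_act, latticeProj_eq_zero_iff]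
    exact ⟨_, hk, by rw [← act_smul, ← hg]⟩
  · obtain ⟨g, hg⟩ := plusProj_surjective P n w
    obtain ⟨k, hk⟩ := exists_x_pow_mem_lattice P g
    refine ⟨k, latticeProj P n ⟨_, hk⟩, ?_⟩
    rw [hc, plusProj_act, hg]

include P in
/-- Canonical maps are unique up to units. -/
lemma exists_unit_mulPlus (can can' : CanonicalMap W n) : ∃ u : (Trunc n)ˣ,
    can'.toLin = mulPlus W n u ∘ₗ can.toLin := by
  obtain ⟨u, hu⟩ := can.exists_unit_latticeProj P
  obtain ⟨u', hu'⟩ := can'.exists_unit_latticeProj P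
  refine ⟨u' * u⁻¹, LinearMap.ext fun v => ?_⟩
  obtain ⟨f, rfl⟩ := latticeProj_surjective P n v
  rw [hu', LinearMap.comp_apply, hu, ← mulPlus_mul]
  simp

variable (can : CanonicalMap W n)
include P

/-- The image of `can` contains that of `s`, since the lattice contains all multiples of `s`. -/
lemma range_sPlus_le : LinearMap.range (sPlus W n) ≤ LinearMap.range can.toLin := by
  rintro _ ⟨v, rfl⟩
  obtain ⟨u, hu⟩ := can.exists_unit_latticeProj P
  obtain ⟨g, hg⟩ := plusProj_surjective P n (mulPlus W n ↑u⁻¹ v)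
  refine ⟨latticeProj P n ⟨s • g, s_smul_mem_lattice W g⟩, ?_⟩
  rw [hu, plusProj_s, hg, ← sPlus_mulPlus, ← mulPlus_mul, Units.mul_inv, mulPlus_one]

lemma exists_pow_of_sPlus_eq_zero (v : jPlus W (fsO W n)) (hv : sPlus W n v = 0) (hn : n ≠ 0) :
    ∃ g : Lift W R, v = plusProj P n (s ^ (n - 1) • g) := by
  obtain ⟨f, rfl⟩ := plusProj_surjective P n v
  rw [← plusProj_s, plusProj_eq_zero_iff] at hv
  obtain ⟨g, hg⟩ := hv
  refine ⟨g, ?_⟩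
  congr 1
  obtain ⟨m, rfl⟩ := Nat.exists_eq_succ_of_ne_zero hn
  rw [pow_succ', mul_smul] at hg
  exact smul_right_injective _ P.ne_zero hg

/-- For `n ≥ 2` an element killed by `s` is a multiple of `s^(n-1)`, hence of `s`. -/
lemma ker_sPlus_le (hn : 2 ≤ n) : LinearMap.ker (sPlus W n) ≤ LinearMap.range can.toLin := by
  intro v hv
  obtain ⟨g, rfl⟩ := exists_pow_of_sPlus_eq_zero P v hv (by omega)
  refine range_sPlus_le P can ⟨plusProj P n (s ^ (n - 2) • g), ?_⟩
  rw [← plusProj_s, ← mul_smul, ← pow_succ']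
  congr 4
  omega

lemma ker_can_le (hn : 2 ≤ n) : LinearMap.ker can.toLin ≤ LinearMap.range (sShriek W n) := by
  intro v hv
  obtain ⟨u, hu⟩ := can.exists_unit_latticeProj P
  obtain ⟨f, rfl⟩ := latticeProj_surjective P n v
  rw [LinearMap.mem_ker, hu] at hv
  have h1 : plusProj P n f.1 = 0 := by
    rw [← mulPlus_one n (plusProj P n f.1), ← u.inv_mul, mulPlus_mul, hv, map_zero]
  obtain ⟨g, hg⟩ := (plusProj_eq_zero_iff P n _).1 h1
  refine ⟨latticeProj P n (s ^ (n - 2) • ⟨s • g, s_smul_mem_lattice W g⟩), ?_⟩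
  rw [← latticeProj_s]
  congr 1
  refine Subtype.ext ?_
  rw [hg, Submodule.coe_smul, Submodule.coe_smul, ← mul_smul, ← mul_smul, ← pow_succ',
    ← pow_succ]
  congr 2
  omega

end

end CanonicalMaps

end Jantzen

namespace Jantzen

/-! ### Monodromy filtrations of endomorphisms of square zero -/

section Monodromy

variable {R M : Type} [Ring R] [AddCommGroup M] [Module R M] {s : M →ₗ[R] M}

/-- The monodromy filtration of an endomorphism of square zero. -/
def squareZeroFiltration (s : M →ₗ[R] M) (m : ℤ) : Submodule R M :=
  if m ≤ -2 then ⊥ else if m = -1 then LinearMap.range s else if m = 0 then LinearMap.ker s else ⊤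

variable (hs : ∀ v, s (s v) = 0)
include hs

lemma pow_eq_zero_of_sq (k : ℕ) (hk : 2 ≤ k) (v : M) : (s ^ k) v = 0 := by
  obtain ⟨m, rfl⟩ := Nat.exists_eq_add_of_le hk
  rw [add_comm, pow_add, Module.End.mul_apply, pow_two, Module.End.mul_apply, hs, map_zero]

lemma range_le_ker_of_sq : LinearMap.range s ≤ LinearMap.ker s := by
  rintro _ ⟨v, rfl⟩; exact hs v

lemma isMonodromyFiltration_squareZero : IsMonodromyFiltration s (squareZeroFiltration s) where
  mono := by
    refine monotone_int_of_le_succ fun m => ?_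
    unfold squareZeroFiltration
    split_ifs <;> first | exact bot_le | exact le_top | exact range_le_ker_of_sq hs | omega
  exists_eq_bot := ⟨-2, by simp [squareZeroFiltration]⟩
  exists_eq_top := ⟨1, by simp [squareZeroFiltration]⟩
  map_le m := by
    rintro _ ⟨v, hv, rfl⟩
    rcases lt_trichotomy m 1 with h | rfl | h
    · have hv' : s v = 0 := by
        unfold squareZeroFiltration at hv
        split_ifs at hv with h1 h2 h3
        · rw [show v = 0 from hv, map_zero]
        · exact range_le_ker_of_sq hs hv
        · exact hv
        · omega
      rw [hv']; exact zero_mem _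
    · simp [squareZeroFiltration]
    · have : s v ∈ LinearMap.ker s := hs v
      unfold squareZeroFiltration
      split_ifs <;> first | omega | exact this | exact Submodule.mem_top
  gr_injective k v _ hv := by
    rcases k with _ | _ | k
    · simpa [squareZeroFiltration] using hv
    · simpa [squareZeroFiltration] using hv
    · have : ((k + 1 + 1 : ℕ) : ℤ) - 1 = k + 1 := by push_cast; ring
      rw [this, squareZeroFiltration, if_neg (by omega), if_neg (by omega), if_neg (by omega)]
      exact Submodule.mem_top
  gr_surjective k w hw := by
    rcases k with _ | _ | k
    · exact ⟨w, by simpa using hw, by simp⟩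
    · obtain ⟨v, rfl⟩ : w ∈ LinearMap.range s := by simpa [squareZeroFiltration] using hw
      exact ⟨v, by simp [squareZeroFiltration], by simp⟩
    · have : w = 0 := by
        unfold squareZeroFiltration at hw
        rw [if_pos (by push_cast; omega)] at hw
        exact hw
      exact ⟨0, zero_mem _, by simp [this]⟩

/-- The monodromy filtration of an endomorphism of square zero is unique. -/
lemma IsMonodromyFiltration.eq_squareZero {μ : ℤ → Submodule R M}
    (hμ : IsMonodromyFiltration s μ) : μ = squareZeroFiltration s := by
  have htop : μ 1 = ⊤ := by
    obtain ⟨m, hm⟩ := hμ.exists_eq_top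
    have key : ∀ k : ℕ, μ (1 + k) = ⊤ → μ 1 = ⊤ := by
      intro k
      induction k with
      | zero => intro h; simpa using h
      | succ k ih =>
        intro h
        refine ih (top_le_iff.1 (h ▸ fun v hv => ?_))
        have := hμ.gr_injective (k + 2) v (by convert hv using 2; push_cast; ring)
          (by rw [pow_eq_zero_of_sq hs _ (by omega)]; exact zero_mem _)
        convert this using 2
        push_cast; ring
    rcases le_total m 1 with h | h
    · exact top_le_iff.1 (hm ▸ hμ.mono h)
    · obtain ⟨k, hk⟩ := Int.eq_ofNat_of_zero_le (sub_nonneg.2 h)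
      refine key k ?_
      rw [← hm]; congr 1; omega
  have hbot : μ (-2) = ⊥ := by
    obtain ⟨m, hm⟩ := hμ.exists_eq_bot
    have key : ∀ k : ℕ, μ (-2 - k) = ⊥ → μ (-2) = ⊥ := by
      intro k
      induction k with
      | zero => intro h; simpa using h
      | succ k ih =>
        intro h
        refine ih (le_bot_iff.1 (h ▸ fun w hw => ?_))
        obtain ⟨v, _, h2⟩ := hμ.gr_surjective (k + 2) w (by convert hw using 2; push_cast; ring)
        rw [pow_eq_zero_of_sq hs _ (by omega), sub_zero] at h2
        convert h2 using 2
        push_cast; ring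
    rcases le_total (-2) m with h | h
    · exact le_bot_iff.1 (hm ▸ hμ.mono h)
    · obtain ⟨k, hk⟩ := Int.eq_ofNat_of_zero_le (sub_nonneg.2 h)
      refine key k ?_
      rw [← hm]; congr 1; omega
  have hzero : μ 0 = LinearMap.ker s := by
    refine le_antisymm (fun v hv => ?_) fun v hv => ?_
    · have := hμ.map_le 0 ⟨v, hv, rfl⟩
      rwa [zero_sub, hbot] at this
    · have := hμ.gr_injective 1 v (by rw [Nat.cast_one, htop]; trivial) (by
        rw [pow_one, show s v = 0 from hv]; exact zero_mem _)
      simpa using this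
  have hone : μ (-1) = LinearMap.range s := by
    refine le_antisymm (fun w hw => ?_) ?_
    · obtain ⟨v, _, h⟩ := hμ.gr_surjective 1 w (by simpa using hw)
      have h2 : w - (s ^ 1) v = 0 := by
        have e : (-((1 : ℕ) : ℤ) - 1) = -2 := by norm_num
        rwa [e, hbot] at h
      exact ⟨v, by rw [pow_one] at h2; exact (sub_eq_zero.1 h2).symm⟩
    · rintro _ ⟨v, rfl⟩
      have := hμ.map_le 1 ⟨v, by rw [htop]; trivial, rfl⟩
      simpa using this
  funext m
  unfold squareZeroFiltration
  split_ifs with h1 h2 h3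
  · exact le_bot_iff.1 (hbot ▸ hμ.mono h1)
  · rw [h2, hone]
  · rw [h3, hzero]
  · exact top_le_iff.1 (htop ▸ hμ.mono (by omega))

end Monodromy

/-! ### The module `Ξ` and its Jantzen filtrations -/

namespace CanonicalMap

variable {W : Chart} {n : ℕ} (can : CanonicalMap W n)

/-- The three properties of a canonical map that determine the geometry of `Ξ`. -/
structure Tame : Prop where
  range_s_le : LinearMap.range (sPlus W n) ≤ LinearMap.range can.toLin
  ker_s_le : LinearMap.ker (sPlus W n) ≤ LinearMap.range can.toLin
  ker_le : LinearMap.ker can.toLin ≤ LinearMap.range (sShriek W n)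

variable {can} (h : can.Tame)
include h

lemma Tame.canBar_injective : Function.Injective can.canBar := by
  refine (injective_iff_map_eq_zero can.canBar).2 fun v hv => ?_
  obtain ⟨v, rfl⟩ := Submodule.Quotient.mk_surjective _ v
  obtain ⟨w, hw⟩ := (Submodule.Quotient.mk_eq_zero _).1 hv
  have h1 : v - sShriek W n w ∈ LinearMap.ker can.toLin := by
    rw [LinearMap.mem_ker, map_sub, can.comm, sub_eq_zero]; exact hw.symm
  obtain ⟨w', hw'⟩ := h.ker_le h1
  refine (Submodule.Quotient.mk_eq_zero _).2 ⟨w' + w, ?_⟩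
  rw [map_add, hw', sub_add_cancel]

lemma Tame.range_canBar : LinearMap.range can.canBar = LinearMap.ker can.sXi := by
  refine le_antisymm ?_ fun v hv => ?_
  · rintro _ ⟨v, rfl⟩
    obtain ⟨v, rfl⟩ := Submodule.Quotient.mk_surjective _ v
    exact (Submodule.Quotient.mk_eq_zero _).2 ⟨v, rfl⟩
  · obtain ⟨v, rfl⟩ := Submodule.Quotient.mk_surjective _ v
    obtain ⟨w, hw⟩ := (Submodule.Quotient.mk_eq_zero _).1 hv
    have h1 : v - can.toLin w ∈ LinearMap.ker (sPlus W n) := by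
      rw [LinearMap.mem_ker, map_sub, sub_eq_zero]; exact hw.symm
    obtain ⟨w', hw'⟩ := h.ker_s_le h1
    refine ⟨Submodule.Quotient.mk (w' + w), ?_⟩
    change Submodule.Quotient.mk (can.toLin (w' + w)) = _
    rw [map_add, hw', sub_add_cancel]

lemma Tame.sXi_sq (v : can.Xi) : can.sXi (can.sXi v) = 0 := by
  obtain ⟨v, rfl⟩ := Submodule.Quotient.mk_surjective _ v
  obtain ⟨w, hw⟩ := h.range_s_le ⟨v, rfl⟩
  refine (Submodule.Quotient.mk_eq_zero _).2 ⟨w, ?_⟩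
  change sPlus W n (can.toLin w) = _
  rw [hw]

omit h in
lemma mem_algFiltration (i : ℕ) (v : jShriek W (fsO W n)) (w : jPlus W (fsO W n))
    (hw : (sPlus W n ^ i) w = can.toLin v) :
    (Submodule.Quotient.mk v : ShriekModS W n) ∈ can.algFiltration i :=
  ⟨v, ⟨w, hw⟩, rfl⟩

/-- Both Jantzen filtrations are `ker s` in degree `0`, the image of `s` in degree `1`, and zero
from degree `2` on. -/
lemma Tame.map_algFiltration (i : ℕ) : (can.algFiltration i).map can.canBar =
    LinearMap.ker can.sXi ⊓ LinearMap.range (can.sXi ^ i) := by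
  have hmk : ∀ (k : ℕ) w, (can.sXi ^ k) (Submodule.Quotient.mk w) =
      Submodule.Quotient.mk ((sPlus W n ^ k) w) := by
    intro k
    induction k with
    | zero => intro w; rfl
    | succ k ih =>
      intro w
      rw [pow_succ, Module.End.mul_apply, pow_succ, Module.End.mul_apply, ← ih]
      rfl
  refine le_antisymm ?_ fun v hv => ?_
  · rintro _ ⟨_, ⟨v, ⟨w, hw⟩, rfl⟩, rfl⟩
    refine ⟨?_, ?_⟩
    · rw [SetLike.mem_coe, ← h.range_canBar]; exact ⟨_, rfl⟩
    · refine ⟨Submodule.Quotient.mk w, ?_⟩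
      rw [hmk, hw]; rfl
  · obtain ⟨hv1, v, rfl⟩ := hv
    obtain ⟨w, rfl⟩ := Submodule.Quotient.mk_surjective _ v
    rcases i with _ | _ | i
    · rw [SetLike.mem_coe, ← h.range_canBar] at hv1
      obtain ⟨v, hv⟩ := hv1
      obtain ⟨v, rfl⟩ := Submodule.Quotient.mk_surjective _ v
      rw [← hv]
      exact ⟨_, mem_algFiltration 0 v (can.toLin v) rfl, rfl⟩
    · obtain ⟨v, hv⟩ := h.range_s_le ⟨w, rfl⟩
      refine ⟨_, mem_algFiltration 1 v w ?_, ?_⟩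
      · rw [hv, pow_one]
      · change Submodule.Quotient.mk (can.toLin v) = _
        rw [hmk, hv, pow_one]
    · rw [pow_eq_zero_of_sq h.sXi_sq _ (by omega)]
      exact zero_mem _

lemma Tame.isNilpotent_sXi : IsNilpotent can.sXi :=
  ⟨2, LinearMap.ext fun v => by rw [pow_two, Module.End.mul_apply, h.sXi_sq]; rfl⟩

lemma Tame.existsUnique_monodromyFiltration :
    ∃! μ : ℤ → Submodule (Diff W) can.Xi, IsMonodromyFiltration can.sXi μ :=
  ⟨_, isMonodromyFiltration_squareZero h.sXi_sq, fun _ hμ => hμ.eq_squareZero h.sXi_sq⟩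

lemma Tame.ker_inf_monodromyFiltration {μ : ℤ → Submodule (Diff W) can.Xi}
    (hμ : IsMonodromyFiltration can.sXi μ) (i : ℕ) : LinearMap.ker can.sXi ⊓ μ (-(i : ℤ)) =
      LinearMap.ker can.sXi ⊓ LinearMap.range (can.sXi ^ i) := by
  rw [hμ.eq_squareZero h.sXi_sq]
  rcases i with _ | _ | i
  · simp [squareZeroFiltration, Module.End.one_eq_id]
  · simp [squareZeroFiltration]
  · have : can.sXi ^ (i + 1 + 1) = 0 :=
      LinearMap.ext fun v => pow_eq_zero_of_sq h.sXi_sq _ (by omega) v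
    rw [squareZeroFiltration, if_pos (by push_cast; omega), this, LinearMap.range_zero]

end CanonicalMap

lemma CanonicalMap.tame {W : Chart} {n : ℕ} (can : CanonicalMap W n) (hn : 2 ≤ n) : can.Tame where
  range_s_le := range_sPlus_le A.parameter can
  ker_s_le := ker_sPlus_le A.parameter can hn
  ker_le := ker_can_le A.parameter can hn

lemma redShriek_surjective (W : Chart) (n : ℕ) (hn : n ≠ 0) :
    Function.Surjective (redShriek W n hn) := fun v => by
  obtain ⟨a, rfl⟩ := toShriek_surjective W isTruncation_complex v
  exact ⟨_, redShriek_shriekGen W n hn a⟩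

/-- Together with `redShriek_surjective`, this says that `j_! 𝒪_U` is the quotient of
`j_! f^s 𝒪_U^{(n)}` by `s`. -/
lemma ker_redShriek (W : Chart) (n : ℕ) (hn : n ≠ 0) :
    LinearMap.ker (redShriek W n hn) = LinearMap.range (sShriek W n) := by
  ext v
  obtain ⟨a, rfl⟩ := shriekGen_surjective W n v
  rw [LinearMap.mem_ker, redShriek_shriekGen]
  refine (toShriek_eq_zero_iff W isTruncation_complex a).trans ?_
  constructor
  · rintro ⟨b, b', rfl⟩
    refine ⟨shriekGen W n b', ?_⟩
    rw [sShriek_shriekGen, ← sub_eq_zero, ← map_sub, shriekGen_eq_zero_iff]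
    exact ⟨-b, 0, by noncomm_ring⟩
  · rintro ⟨w, hw⟩
    obtain ⟨b, rfl⟩ := shriekGen_surjective W n w
    rw [sShriek_shriekGen, ← sub_eq_zero, ← map_sub, shriekGen_eq_zero_iff] at hw
    obtain ⟨c, c', hc⟩ := hw
    obtain ⟨m, rfl⟩ := Nat.exists_eq_succ_of_ne_zero hn
    refine ⟨-c, b - c' * (Diff.θ 1 + algebraMap ℂ _ ((0 : ℤ) : ℂ)) ^ m, ?_⟩
    rw [pow_one, sub_mul, mul_assoc, ← pow_succ, neg_mul]
    refine (sub_sub_cancel (b * (Diff.θ 1 + algebraMap ℂ _ ((0 : ℤ) : ℂ))) a).symm.trans ?_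
    rw [hc]
    abel

end Jantzen

namespace Jantzen
open Diff

/-! ### The action of `𝔰𝔩₂` by vector fields -/

section VectorFields

attribute [local instance] LieRing.ofAssociativeRing

lemma lie_x_mul_d {V : Chart} (i j k l : Fin 2) :
    ⁅(x j * d i : Diff V), (x l * d k : Diff V)⁆ =
      (if i = l then x j * d k else 0) - if k = j then x l * d i else 0 := by
  have h : ∀ a b : Fin 2, (d a * x b : Diff V) = x b * d a + if a = b then 1 else 0 := by
    intro a b
    split_ifs with hab
    · subst hab; exact d_mul_x a
    · rw [add_zero]; exact (d_mul_x_of_ne hab)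
  have hx : (x j * x l : Diff V) = x l * x j := x_comm j l
  have hd : (d i * d k : Diff V) = d k * d i := d_comm i k
  have h1 : (x j * d i * (x l * d k) : Diff V) = x j * x l * (d i * d k) +
      if i = l then x j * d k else 0 := by
    rw [mul_assoc, ← mul_assoc (d i), h]
    split_ifs <;> noncomm_ring
  have h2 : (x l * d k * (x j * d i) : Diff V) = x l * x j * (d k * d i) +
      if k = j then x l * d i else 0 := by
    rw [mul_assoc, ← mul_assoc (d k), h]
    split_ifs <;> noncomm_ring
  rw [Ring.lie_def, h1, h2, hx, hd]
  abel

lemma vf_apply (X : G) : vf X = -(X.1 0 0 • (x 0 * d 0) + X.1 0 1 • (x 1 * d 0) +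
    (X.1 1 0 • (x 0 * d 1) + X.1 1 1 • (x 1 * d 1))) := by
  simp [vf, Fin.sum_univ_two]

lemma bracket_val (X Y : G) (i j : Fin 2) : ⁅X, Y⁆.1 i j =
    (X.1 i 0 * Y.1 0 j + X.1 i 1 * Y.1 1 j) - (Y.1 i 0 * X.1 0 j + Y.1 i 1 * X.1 1 j) := by
  have : ⁅X, Y⁆.1 = X.1 * Y.1 - Y.1 * X.1 := rfl
  rw [this, Matrix.sub_apply, Matrix.mul_apply, Matrix.mul_apply, Fin.sum_univ_two,
    Fin.sum_univ_two]

lemma vf_lie (X Y : G) : vf ⁅X, Y⁆ = ⁅vf X, vf Y⁆ := by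
  rw [vf_apply X, vf_apply Y, vf_apply]
  simp only [bracket_val]
  generalize X.1 0 0 = a
  generalize X.1 0 1 = b
  generalize X.1 1 0 = c
  generalize X.1 1 1 = e
  generalize Y.1 0 0 = a'
  generalize Y.1 0 1 = b'
  generalize Y.1 1 0 = c'
  generalize Y.1 1 1 = e'
  simp only [neg_lie, lie_neg, add_lie, lie_add, smul_lie, lie_smul, lie_x_mul_d]
  simp
  module

lemma add_val (X Y : G) (i j : Fin 2) : (X + Y).1 i j = X.1 i j + Y.1 i j := rfl

lemma smul_val (c : ℂ) (X : G) (i j : Fin 2) : (c • X).1 i j = c * X.1 i j := rfl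

/-- The homomorphism `U(𝔤) → 𝒟(𝔸²)` given by the vector fields `L_X`. -/
def vfHom : UG →ₐ[ℂ] Diff Chart.plane := UniversalEnvelopingAlgebra.lift ℂ
  { toFun := vf
    map_add' := fun X Y => by
      rw [vf_apply, vf_apply, vf_apply]
      simp only [add_val]
      module
    map_smul' := fun c X => by
      rw [vf_apply, vf_apply]
      simp only [smul_val, RingHom.id_apply]
      module
    map_lie' := vf_lie _ _ }

lemma vfHom_toUG (X : G) : vfHom (toUG X) = vf X := UniversalEnvelopingAlgebra.lift_ι_apply ℂ _ _

lemma toUG_lie (X Y : G) : toUG ⁅X, Y⁆ = toUG X * toUG Y - toUG Y * toUG X :=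
  LieHom.map_lie (UniversalEnvelopingAlgebra.ι ℂ) X Y

end VectorFields

/-! ### Commutation relations in the enveloping algebra -/

section EnvelopingAlgebra

lemma toUG_add (X Y : G) : toUG (X + Y) = toUG X + toUG Y := map_add _ _ _

lemma toUG_smul (c : ℂ) (X : G) : toUG (c • X) = c • toUG X := map_smul _ _ _

/-- The enveloping algebra is generated by `𝔤`. -/
lemma UG.induction {p : UG → Prop} (hι : ∀ X, p (toUG X)) (hc : ∀ c : ℂ, p (algebraMap ℂ UG c))
    (hadd : ∀ u v, p u → p v → p (u + v)) (hmul : ∀ u v, p u → p v → p (u * v)) (u : UG) :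
    p u := by
  obtain ⟨t, rfl⟩ : ∃ t, UniversalEnvelopingAlgebra.mkAlgHom ℂ G t = u :=
    RingCon.mkₐ_surjective _ u
  induction t using TensorAlgebra.induction with
  | algebraMap r => rw [AlgHom.commutes]; exact hc r
  | ι X => exact hι X
  | mul a b ha hb => rw [map_mul]; exact hmul _ _ ha hb
  | add a b ha hb => rw [map_add]; exact hadd _ _ ha hb

/-- The element `e` of `𝔰𝔩₂`. -/
def G.e : G := ⟨!![0, 1; 0, 0], by simp [LieAlgebra.SpecialLinear.sl]⟩

/-- The element `f` of `𝔰𝔩₂`. -/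
def G.f : G := ⟨!![0, 0; 1, 0], by simp [LieAlgebra.SpecialLinear.sl]⟩

/-- The element `h` of `𝔰𝔩₂`. -/
def G.h : G := ⟨!![1, 0; 0, -1], by simp [LieAlgebra.SpecialLinear.sl]⟩

lemma G.ext {X Y : G} (h : ∀ i j, X.1 i j = Y.1 i j) : X = Y :=
  Subtype.ext (Matrix.ext h)

lemma G.one_one (X : G) : X.1 1 1 = -X.1 0 0 := by
  have h : X.1.trace = 0 := X.2
  rw [Matrix.trace_fin_two] at h
  linear_combination h

lemma G.eq_comb (X : G) : X = X.1 0 1 • G.e + (X.1 0 0 • G.h + X.1 1 0 • G.f) := by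
  refine G.ext fun i j => ?_
  rw [add_val, add_val, smul_val, smul_val, smul_val]
  have := G.one_one X
  fin_cases i <;> fin_cases j <;> simp [G.e, G.f, G.h, this]

lemma toUG_eq_comb (X : G) :
    toUG X = X.1 0 1 • toUG G.e + (X.1 0 0 • toUG G.h + X.1 1 0 • toUG G.f) := by
  conv_lhs => rw [G.eq_comb X]
  rw [toUG_add, toUG_add, toUG_smul, toUG_smul, toUG_smul]

lemma toUG_e_mul_f : toUG G.e * toUG G.f = toUG G.f * toUG G.e + toUG G.h := by
  have h : ⁅G.e, G.f⁆ = G.h := by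
    refine G.ext fun i j => ?_
    rw [bracket_val]
    fin_cases i <;> fin_cases j <;> simp [G.e, G.f, G.h]
  rw [← h, toUG_lie]; abel

lemma toUG_h_mul_e : toUG G.h * toUG G.e = toUG G.e * toUG G.h + (2 : ℂ) • toUG G.e := by
  have h : ⁅G.h, G.e⁆ = (2 : ℂ) • G.e := by
    refine G.ext fun i j => ?_
    rw [bracket_val, smul_val]
    fin_cases i <;> fin_cases j <;> simp [G.e, G.h]; norm_num
  rw [← toUG_smul, ← h, toUG_lie]; abel

lemma toUG_h_mul_f : toUG G.h * toUG G.f = toUG G.f * toUG G.h - (2 : ℂ) • toUG G.f := by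
  have h : ⁅G.h, G.f⁆ = (-2 : ℂ) • G.f := by
    refine G.ext fun i j => ?_
    rw [bracket_val, smul_val]
    fin_cases i <;> fin_cases j <;> simp [G.f, G.h]; norm_num
  rw [sub_eq_add_neg, ← neg_smul, ← toUG_smul, ← h, toUG_lie]; abel

lemma e_pow_mul_h (k : ℕ) : toUG G.e ^ k * toUG G.h =
    toUG G.h * toUG G.e ^ k - (2 * k : ℂ) • toUG G.e ^ k := by
  induction k with
  | zero => simp
  | succ k ih =>
    rw [pow_succ', mul_assoc, ih, mul_sub, ← mul_assoc, ← mul_assoc, toUG_h_mul_e, add_mul,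
      mul_smul_comm, smul_mul_assoc]
    push_cast
    module

lemma e_pow_mul_f (k : ℕ) : toUG G.e ^ (k + 1) * toUG G.f = toUG G.f * toUG G.e ^ (k + 1) +
    ((k + 1 : ℂ) • (toUG G.h * toUG G.e ^ k) - ((k + 1) * k : ℂ) • toUG G.e ^ k) := by
  induction k with
  | zero => simp [toUG_e_mul_f]
  | succ k ih =>
    have h : toUG G.e * toUG G.h = toUG G.h * toUG G.e - (2 : ℂ) • toUG G.e := by
      rw [toUG_h_mul_e]; abel
    rw [pow_succ', mul_assoc, ih, mul_add, mul_sub, mul_smul_comm, mul_smul_comm, ← mul_assoc,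
      ← mul_assoc, toUG_e_mul_f, h, add_mul, sub_mul, smul_mul_assoc, mul_assoc, mul_assoc,
      ← pow_succ', ← pow_succ']
    push_cast
    module

lemma h_mul_f_pow (k : ℕ) : toUG G.h * toUG G.f ^ k =
    toUG G.f ^ k * toUG G.h - (2 * k : ℂ) • toUG G.f ^ k := by
  induction k with
  | zero => simp
  | succ k ih =>
    rw [pow_succ, ← mul_assoc, ih, sub_mul, mul_assoc, mul_assoc, toUG_h_mul_f, mul_sub,
      mul_smul_comm, smul_mul_assoc]
    push_cast
    module

lemma e_mul_f_pow (k : ℕ) : toUG G.e * toUG G.f ^ (k + 1) = toUG G.f ^ (k + 1) * toUG G.e +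
    ((k + 1 : ℂ) • (toUG G.f ^ k * toUG G.h) - ((k + 1) * k : ℂ) • toUG G.f ^ k) := by
  induction k with
  | zero => simp [toUG_e_mul_f]
  | succ k ih =>
    rw [pow_succ, ← mul_assoc, ih, add_mul, sub_mul, smul_mul_assoc, smul_mul_assoc, mul_assoc,
      mul_assoc (toUG G.f ^ k), toUG_e_mul_f, toUG_h_mul_f, mul_add, mul_sub, mul_smul_comm,
      ← mul_assoc, ← mul_assoc, ← pow_succ, ← pow_succ]
    push_cast
    module

end EnvelopingAlgebra

/-! ### Coinduced modules -/

section Coinduced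

variable {B : Type} [CommRing B] [Algebra ℂ B] {σ : B} {lam : ℂ}

lemma wt_f : wt B σ lam G.f = 0 := by simp [wt, G.f]

lemma wt_h : wt B σ lam G.h = algebraMap ℂ B lam + σ := by simp [wt, G.h]

/-- An element of the coinduced module is determined by its values on the powers of `e`. -/
lemma eq_zero_of_forall_e_pow {φ : UG →ₗ[ℂ] B} (hφ : φ ∈ coinduced B σ lam)
    (h : ∀ k : ℕ, φ (toUG G.e ^ k) = 0) : φ = 0 := by
  -- the space of all such elements is stable under the action of `U(𝔤)`
  let C : Set (UG →ₗ[ℂ] B) := {φ | φ ∈ coinduced B σ lam ∧ ∀ k : ℕ, φ (toUG G.e ^ k) = 0}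
  have hC : ∀ u, ∀ φ ∈ C, φ.comp (LinearMap.mulRight ℂ u) ∈ C := by
    refine UG.induction ?_ ?_ ?_ ?_
    · rintro X φ ⟨hφ, h⟩
      refine ⟨fun Y hY u => ?_, fun k => ?_⟩
      · simp only [LinearMap.comp_apply, LinearMap.mulRight_apply]
        rw [mul_assoc, hφ Y hY]
      · have hh : ∀ u, φ (toUG G.h * u) = wt B σ lam G.h * φ u := hφ G.h (by simp [G.h])
        have hf : ∀ u, φ (toUG G.f * u) = 0 := fun u => by
          rw [hφ G.f (by simp [G.f]), wt_f, zero_mul]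
        have h1 : φ (toUG G.e ^ k * toUG G.h) = 0 := by
          rw [e_pow_mul_h, map_sub, map_smul, hh, h, mul_zero, smul_zero, sub_zero]
        have h2 : φ (toUG G.e ^ k * toUG G.f) = 0 := by
          cases k with
          | zero => simpa using hf 1
          | succ k =>
            rw [e_pow_mul_f, map_add, map_sub, map_smul, map_smul, hh, h, hf, mul_zero, smul_zero,
              smul_zero, sub_zero, add_zero]
        rw [LinearMap.comp_apply, LinearMap.mulRight_apply, toUG_eq_comb X, mul_add, mul_add,
          mul_smul_comm, mul_smul_comm, mul_smul_comm, map_add, map_add, map_smul, map_smul,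
          map_smul, h1, h2, ← pow_succ, h, smul_zero, smul_zero, smul_zero, add_zero, add_zero]
    · rintro c φ ⟨hφ, h⟩
      have : φ.comp (LinearMap.mulRight ℂ (algebraMap ℂ UG c)) = algebraMap ℂ B c • φ := by
        ext u
        rw [LinearMap.comp_apply, LinearMap.mulRight_apply, ← Algebra.commutes,
          ← Algebra.smul_def, map_smul, LinearMap.smul_apply, algebraMap_smul]
      rw [this]
      exact ⟨Submodule.smul_mem _ _ hφ, fun k => by rw [LinearMap.smul_apply, h, smul_zero]⟩
    · intro u v hu hv φ hφ
      obtain ⟨h1, h2⟩ := hu φ hφ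
      obtain ⟨h3, h4⟩ := hv φ hφ
      have : φ.comp (LinearMap.mulRight ℂ (u + v)) = φ.comp (LinearMap.mulRight ℂ u) +
          φ.comp (LinearMap.mulRight ℂ v) := by
        ext w; simp [mul_add]
      rw [this]
      exact ⟨add_mem h1 h3, fun k => by rw [LinearMap.add_apply, h2, h4, add_zero]⟩
    · intro u v hu hv φ hφ
      have : φ.comp (LinearMap.mulRight ℂ (u * v)) =
          (φ.comp (LinearMap.mulRight ℂ v)).comp (LinearMap.mulRight ℂ u) := by
        ext w; simp [mul_assoc]
      rw [this]
      exact hu _ (hv _ hφ)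
  ext u
  simpa using (hC u φ ⟨hφ, h⟩).2 0

end Coinduced

/-! ### Deformed Verma modules -/

section Verma

variable {B : Type} [CommRing B] [Algebra ℂ B] {σ : B} {lam : ℂ}

lemma coeffVerma_coeffVerma (b c : B) (m : Verma B σ lam) :
    coeffVerma b (coeffVerma c m) = coeffVerma (b * c) m := by
  rw [coeffVerma, coeffVerma, coeffVerma, ← mul_smul, Algebra.TensorProduct.tmul_mul_tmul, one_mul]

lemma mk_eq_smul_gen (z : B ⊗[ℂ] UG) :
    (Submodule.Quotient.mk z : Verma B σ lam) = z • Verma.gen B σ lam := by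
  rw [Verma.gen, ← Submodule.Quotient.mk_smul, smul_eq_mul, mul_one]

/-- The generator satisfies its defining relations. -/
lemma lieVerma_gen (X : G) (hX : X.1 1 0 = 0) :
    lieVerma X (Verma.gen B σ lam) = coeffVerma (wt B σ lam X) (Verma.gen B σ lam) := by
  rw [lieVerma, coeffVerma, ← sub_eq_zero, ← sub_smul, ← mk_eq_smul_gen,
    Submodule.Quotient.mk_eq_zero]
  exact Ideal.subset_span ⟨X, hX, rfl⟩

/-- A deformed Verma module is generated by its highest weight vector. -/
lemma Verma.induction {p : Verma B σ lam → Prop} (hgen : p (Verma.gen B σ lam))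
    (hadd : ∀ m m', p m → p m' → p (m + m')) (hc : ∀ b m, p m → p (coeffVerma b m))
    (hl : ∀ X m, p m → p (lieVerma X m)) (m : Verma B σ lam) : p m := by
  have hu : ∀ u : UG, ∀ m, p m → p (((1 : B) ⊗ₜ[ℂ] u) • m) := by
    refine UG.induction hl ?_ ?_ ?_
    · intro c m hm
      rw [Algebra.algebraMap_eq_smul_one, ← TensorProduct.smul_tmul]
      exact hc _ _ hm
    · intro u v hu hv m hm
      rw [TensorProduct.tmul_add, add_smul]
      exact hadd _ _ (hu m hm) (hv m hm)
    · intro u v hu hv m hm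
      rw [← one_mul (1 : B), ← Algebra.TensorProduct.tmul_mul_tmul, mul_smul]
      exact hu _ (hv _ hm)
  obtain ⟨z, rfl⟩ := Submodule.Quotient.mk_surjective _ m
  rw [mk_eq_smul_gen]
  have h0 : p 0 := by
    have := hc 0 _ hgen
    rwa [coeffVerma, TensorProduct.zero_tmul, zero_smul] at this
  induction z using TensorProduct.induction_on with
  | zero => rwa [zero_smul]
  | add a b ha hb => rw [add_smul]; exact hadd _ _ ha hb
  | tmul b u =>
    rw [← mul_one b, ← one_mul u, ← Algebra.TensorProduct.tmul_mul_tmul, mul_smul]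
    exact hc b _ (hu u _ hgen)

/-- The universal property of a deformed Verma module. -/
lemma Verma.exists_hom {S N : Type} [Ring S] [AddCommGroup N] [Module S N]
    (ρ : B ⊗[ℂ] UG →+* S) (v : N)
    (hv : ∀ X : G, X.1 1 0 = 0 → ρ (1 ⊗ₜ toUG X) • v = ρ (wt B σ lam X ⊗ₜ 1) • v) :
    ∃ F : Verma B σ lam →+ N, F (Verma.gen B σ lam) = v ∧ ∀ z m, F (z • m) = ρ z • F m := by
  let F0 : B ⊗[ℂ] UG →+ N := AddMonoidHom.mk' (fun z => ρ z • v) fun a b => by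
    rw [map_add, add_smul]
  have hF : (vermaIdeal B σ lam).toAddSubgroup ≤ F0.ker := by
    intro z hz
    change ρ z • v = 0
    refine Submodule.span_induction (p := fun z _ => ρ z • v = 0) ?_ ?_ ?_ ?_ hz
    · rintro _ ⟨X, hX, rfl⟩
      rw [map_sub, sub_smul, hv X hX, sub_self]
    · rw [map_zero, zero_smul]
    · intro a b _ _ ha hb
      rw [map_add, add_smul, ha, hb, add_zero]
    · intro a b _ hb
      rw [smul_eq_mul, map_mul, mul_smul, hb, smul_zero]
  let F : Verma B σ lam →+ N := QuotientAddGroup.lift _ F0 hF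
  have hmk : ∀ z, F (Submodule.Quotient.mk z) = ρ z • v := fun z => rfl
  refine ⟨F, ?_, fun z m => ?_⟩
  · rw [Verma.gen, hmk, map_one, one_smul]
  · obtain ⟨a, rfl⟩ := Submodule.Quotient.mk_surjective _ m
    rw [← Submodule.Quotient.mk_smul, hmk, hmk, smul_eq_mul, map_mul, mul_smul]

/-- The element `∑ₖ bₖ f^k` of a deformed Verma module. -/
def Verma.sum (B : Type) [CommRing B] [Algebra ℂ B] (σ : B) (lam : ℂ) :
    (ℕ →₀ B) →+ Verma B σ lam :=
  Finsupp.liftAddHom fun k => AddMonoidHom.mk'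
    (fun b => (b ⊗ₜ[ℂ] (toUG G.f ^ k)) • Verma.gen B σ lam) fun b c => by
      rw [TensorProduct.add_tmul, add_smul]

lemma Verma.sum_single (k : ℕ) (b : B) : Verma.sum B σ lam (Finsupp.single k b) =
    (b ⊗ₜ[ℂ] (toUG G.f ^ k)) • Verma.gen B σ lam := by
  simp [Verma.sum]

lemma smul_h_gen (b : B) (u : UG) : (b ⊗ₜ[ℂ] (u * toUG G.h)) • Verma.gen B σ lam =
    ((b * (algebraMap ℂ B lam + σ)) ⊗ₜ[ℂ] u) • Verma.gen B σ lam := by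
  have := lieVerma_gen (B := B) (σ := σ) (lam := lam) G.h (by simp [G.h])
  rw [wt_h, lieVerma, coeffVerma] at this
  rw [← mul_one b, ← Algebra.TensorProduct.tmul_mul_tmul, mul_smul, this, ← mul_smul,
    Algebra.TensorProduct.tmul_mul_tmul, mul_one, mul_one]

lemma smul_e_gen (b : B) (u : UG) : (b ⊗ₜ[ℂ] (u * toUG G.e)) • Verma.gen B σ lam = 0 := by
  have := lieVerma_gen (B := B) (σ := σ) (lam := lam) G.e (by simp [G.e])
  have h0 : wt B σ lam G.e = 0 := by simp [wt, G.e]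
  rw [h0, lieVerma, coeffVerma, TensorProduct.zero_tmul, zero_smul] at this
  rw [← mul_one b, ← Algebra.TensorProduct.tmul_mul_tmul, mul_smul, this, smul_zero]

/-- A deformed Verma module is spanned by the vectors `f^k ⊗ 1` over the coefficients. -/
lemma Verma.sum_surjective : Function.Surjective (Verma.sum B σ lam) := by
  have hs : ∀ (b : B) (k : ℕ), (b ⊗ₜ[ℂ] (toUG G.f ^ k)) • Verma.gen B σ lam ∈
      (Verma.sum B σ lam).range := fun b k => ⟨_, Verma.sum_single k b⟩
  refine fun m => ?_
  change m ∈ (Verma.sum B σ lam).range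
  -- it suffices to test stability under an element of `B ⊗ U(𝔤)` on the spanning vectors
  have key : ∀ z : B ⊗[ℂ] UG, (∀ (b : B) (k : ℕ),
      (z * (b ⊗ₜ[ℂ] (toUG G.f ^ k))) • Verma.gen B σ lam ∈ (Verma.sum B σ lam).range) →
      ∀ m ∈ (Verma.sum B σ lam).range, z • m ∈ (Verma.sum B σ lam).range := by
    rintro z hz _ ⟨b, rfl⟩
    induction b using Finsupp.induction_linear with
    | zero => rw [map_zero, smul_zero]; exact zero_mem _
    | add b c hb hc => rw [map_add, smul_add]; exact add_mem hb hc
    | single k b => rw [Verma.sum_single, ← mul_smul]; exact hz b k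
  refine Verma.induction ?_ (fun m m' => add_mem) (fun c => key _ fun b k => ?_)
    (fun X => key _ fun b k => ?_) m
  · have := hs 1 0
    rwa [pow_zero, ← Algebra.TensorProduct.one_def, one_smul] at this
  · rw [Algebra.TensorProduct.tmul_mul_tmul, one_mul]
    exact hs _ _
  · have hsc : ∀ (c : ℂ) (u : UG), (b ⊗ₜ[ℂ] u) • Verma.gen B σ lam ∈ (Verma.sum B σ lam).range →
        (b ⊗ₜ[ℂ] (c • u)) • Verma.gen B σ lam ∈ (Verma.sum B σ lam).range := by
      intro c u hu
      have := key ((algebraMap ℂ B c) ⊗ₜ 1) (fun b k => by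
        rw [Algebra.TensorProduct.tmul_mul_tmul, one_mul]; exact hs _ _) _ hu
      rwa [← mul_smul, Algebra.TensorProduct.tmul_mul_tmul, one_mul, ← Algebra.smul_def,
        TensorProduct.smul_tmul] at this
    have hh : (b ⊗ₜ[ℂ] (toUG G.h * toUG G.f ^ k)) • Verma.gen B σ lam ∈
        (Verma.sum B σ lam).range := by
      rw [h_mul_f_pow, TensorProduct.tmul_sub, sub_smul, smul_h_gen]
      exact sub_mem (hs _ _) (hsc _ _ (hs _ _))
    have he : (b ⊗ₜ[ℂ] (toUG G.e * toUG G.f ^ k)) • Verma.gen B σ lam ∈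
        (Verma.sum B σ lam).range := by
      cases k with
      | zero =>
        rw [pow_zero, mul_one, ← one_mul (toUG G.e), smul_e_gen]
        exact zero_mem _
      | succ k =>
        rw [e_mul_f_pow, TensorProduct.tmul_add, add_smul, TensorProduct.tmul_sub, sub_smul,
          smul_e_gen]
        refine add_mem (zero_mem _) (sub_mem (hsc _ _ ?_) (hsc _ _ (hs _ _)))
        rw [smul_h_gen]
        exact hs _ _
    rw [Algebra.TensorProduct.tmul_mul_tmul, one_mul, toUG_eq_comb X, add_mul, add_mul,
      smul_mul_assoc, smul_mul_assoc, smul_mul_assoc, ← pow_succ', TensorProduct.tmul_add,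
      TensorProduct.tmul_add, add_smul, add_smul]
    exact add_mem (hsc _ _ he) (add_mem (hsc _ _ hh) (hsc _ _ (hs _ _)))

/-- The canonical homomorphism is unique: the image of the highest weight vector is killed by `e`,
so its values on the powers `e^k` with `k > 0` vanish, and its value on `1` is prescribed. -/
lemma IsCanonicalHom.unique {ψ ψ' : Verma B σ lam →+ dualVerma B σ lam}
    (h : IsCanonicalHom B σ lam ψ) (h' : IsCanonicalHom B σ lam ψ') : ψ = ψ' := by
  have hle : dualVerma B σ lam ≤ coinduced B σ lam := iSup_le fun μ φ hφ => hφ.1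
  have hk : ∀ ψ : Verma B σ lam →+ dualVerma B σ lam, IsCanonicalHom B σ lam ψ → ∀ k : ℕ,
      (ψ (Verma.gen B σ lam)).1 (toUG G.e ^ (k + 1)) = 0 := by
    intro ψ h k
    have h0 : lieVerma G.e (Verma.gen B σ lam) = 0 := by
      have := smul_e_gen (B := B) (σ := σ) (lam := lam) 1 1
      rwa [one_mul] at this
    rw [pow_succ, ← h.map_lie, h0, map_zero]
    rfl
  have hgen : ψ (Verma.gen B σ lam) = ψ' (Verma.gen B σ lam) := by
    refine Subtype.ext (sub_eq_zero.1 (eq_zero_of_forall_e_pow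
      (sub_mem (hle (ψ _).2) (hle (ψ' _).2)) fun k => ?_))
    rw [LinearMap.sub_apply, sub_eq_zero]
    cases k with
    | zero => rw [pow_zero, h.map_gen, h'.map_gen]
    | succ k => rw [hk ψ h, hk ψ' h']
  ext1 m
  refine Verma.induction (p := fun m => ψ m = ψ' m) hgen (fun m m' hm hm' => ?_)
    (fun b m hm => ?_) (fun X m hm => ?_) m
  · rw [map_add, map_add, hm, hm']
  · rw [h.map_coeff, h'.map_coeff, hm]
  · refine Subtype.ext (LinearMap.ext fun u => ?_)
    rw [h.map_lie, h'.map_lie, hm]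

end Verma

end Jantzen

namespace Jantzen

open Diff

/-! ### Homogeneous functions -/

section Line

variable (R : Type) [CommRing R] (l : ℤ)

/-- The exponent of `x₁^k x₂^(l-k)`. -/
def lineExpo (l : ℤ) (k : ℕ) : Expo Chart.plane.meetU :=
  ⟨fun i => if i = 1 then l - k else k, fun i hi => by
    obtain rfl | rfl : i = 0 ∨ i = 1 := by omega
    · simp
    · simp [Chart.meetU_one] at hi⟩

lemma lineExpo_zero (k : ℕ) : (lineExpo l k).1 0 = k := by simp [lineExpo]

lemma lineExpo_one (k : ℕ) : (lineExpo l k).1 1 = l - k := by simp [lineExpo]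

variable {l} in
lemma eq_lineExpo {e : Expo Chart.plane.meetU} {k : ℕ} (h0 : e.1 0 = k) (h1 : e.1 1 = l - k) :
    e = lineExpo l k :=
  expo_ext (by rw [h0, lineExpo_zero]) (by rw [h1, lineExpo_one])

variable {l} in
lemma exists_eq_lineExpo {e : Expo Chart.plane.meetU} (h : e.1 0 + e.1 1 = l) :
    ∃ k, e = lineExpo l k := by
  have h0 := expo_nonneg e rfl
  refine ⟨(e.1 0).toNat, eq_lineExpo ?_ ?_⟩ <;> omega

lemma lineExpo_injective : Function.Injective (lineExpo l) := fun k k' h => by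
  have := lineExpo_zero l k
  rw [h, lineExpo_zero] at this
  exact_mod_cast this.symm

/-- The homogeneous elements of degree `l`: the combinations of the `x₁^k x₂^(l-k) t^s`. -/
def line : Submodule R (Lift Chart.plane R) where
  carrier := {f | ∀ e, e.1 0 + e.1 1 ≠ l → f e = 0}
  add_mem' hf hg e h := by rw [Finsupp.add_apply, hf e h, hg e h, add_zero]
  zero_mem' _ _ := rfl
  smul_mem' c f hf e h := by rw [Finsupp.smul_apply, hf e h, smul_zero]

variable {R l}

lemma single_mem_line {e : Expo Chart.plane.meetU} {z : R} (h : z ≠ 0 → e.1 0 + e.1 1 = l) :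
    Finsupp.single e z ∈ line R l := fun e' he' => by
  by_cases hz : z = 0
  · simp [hz]
  · refine Finsupp.single_eq_of_ne ?_
    rintro rfl
    exact he' (h hz)

lemma single_lineExpo_mem (k : ℕ) (z : R) : Finsupp.single (lineExpo l k) z ∈ line R l :=
  single_mem_line fun _ => by rw [lineExpo_zero, lineExpo_one]; ring

lemma line_ext {f g : Lift Chart.plane R} (hf : f ∈ line R l) (hg : g ∈ line R l)
    (h : ∀ k, f (lineExpo l k) = g (lineExpo l k)) : f = g := by
  ext e
  by_cases he : e.1 0 + e.1 1 = l
  · obtain ⟨k, rfl⟩ := exists_eq_lineExpo he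
    exact h k
  · rw [hf e he, hg e he]

/-- An additive property of homogeneous elements holds if it holds for their terms. -/
lemma mem_of_line {H : AddSubgroup (Lift Chart.plane R)} {f : Lift Chart.plane R}
    (hf : f ∈ line R l) (h : ∀ k, Finsupp.single (lineExpo l k) (f (lineExpo l k)) ∈ H) :
    f ∈ H := by
  rw [← Finsupp.sum_single f]
  refine sum_mem fun e _ => ?_
  by_cases he : e.1 0 + e.1 1 = l
  · obtain ⟨k, rfl⟩ := exists_eq_lineExpo he
    exact h k
  · rw [hf e he, Finsupp.single_zero]
    exact zero_mem _

variable [Algebra ℂ R] {s : R}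

lemma act_x_mul_d_mem_line (i j : Fin 2) {f : Lift Chart.plane R} (hf : f ∈ line R l) :
    actL Chart.plane s (x j * d i) f ∈ line R l := by
  refine mem_of_line (H := (line R l).toAddSubgroup.comap
    (actL Chart.plane s (x j * d i)).toAddMonoidHom) hf fun k => ?_
  change actL Chart.plane s (x j * d i) (Finsupp.single (lineExpo l k) _) ∈ line R l
  generalize f (lineExpo l k) = z
  have hk : (lineExpo l k).1 0 + (lineExpo l k).1 1 = l := by
    rw [lineExpo_zero, lineExpo_one]; ring
  rw [map_mul, Module.End.mul_apply, act_d (isRestriction_res _), act_x (isRestriction_res _)]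
  refine single_mem_line fun hz => ?_
  have hd : Chart.plane.meetU i = false → 1 ≤ (lineExpo l k).1 i := by
    intro hi
    obtain rfl | rfl : i = 0 ∨ i = 1 := by omega
    · by_contra hc
      have h0 := expo_nonneg (lineExpo l k) rfl
      have : (lineExpo l k).1 0 = 0 := by omega
      rw [this] at hz
      simp at hz
    · simp [Chart.meetU_one] at hi
  have hv : (((lineExpo l k).down i).up j).1 =
      (lineExpo l k).1 - Pi.single i 1 + Pi.single j 1 := by
    change ((lineExpo l k).down i).1 + Pi.single j 1 = _
    rw [Expo.down_pos hd]
  rw [hv]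
  obtain rfl | rfl : i = 0 ∨ i = 1 := by omega
  all_goals obtain rfl | rfl : j = 0 ∨ j = 1 := by omega
  all_goals simp
  all_goals linarith

lemma act_vf_eq (X : G) (v : Lift Chart.plane R) : actL Chart.plane s (vf X) v =
    -(X.1 0 0 • actL Chart.plane s (x 0 * d 0) v + X.1 0 1 • actL Chart.plane s (x 1 * d 0) v +
      (X.1 1 0 • actL Chart.plane s (x 0 * d 1) v +
        X.1 1 1 • actL Chart.plane s (x 1 * d 1) v)) := by
  rw [vf_apply]
  simp only [map_neg, map_add, map_smul, LinearMap.neg_apply, LinearMap.add_apply,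
    LinearMap.smul_apply]

lemma act_vf_mem_line (X : G) {f : Lift Chart.plane R} (hf : f ∈ line R l) :
    actL Chart.plane s (vf X) f ∈ line R l := by
  have hc : ∀ (c : ℂ) {g : Lift Chart.plane R}, g ∈ line R l → c • g ∈ line R l := fun c g hg => by
    rw [← algebraMap_smul R c g]; exact Submodule.smul_mem _ _ hg
  rw [act_vf_eq]
  have h := fun i j => act_x_mul_d_mem_line (s := s) i j hf
  exact neg_mem (add_mem (add_mem (hc _ (h _ _)) (hc _ (h _ _)))
    (add_mem (hc _ (h _ _)) (hc _ (h _ _))))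

lemma vf_e : vf G.e = -(x 1 * d 0) := by rw [vf_apply]; simp [G.e]

lemma vf_f : vf G.f = -(x 0 * d 1) := by rw [vf_apply]; simp [G.f]

lemma act_vf_f_single (k : ℕ) (z : R) :
    actL Chart.plane s (vf G.f) (Finsupp.single (lineExpo l k) z) =
      Finsupp.single (lineExpo l (k + 1)) (-(((l - k : ℤ) : R) + s) * z) := by
  rw [vf_f, map_neg, map_mul, LinearMap.neg_apply, Module.End.mul_apply,
    act_d (isRestriction_res _), act_x (isRestriction_res _), lineExpo_one, if_pos rfl,
    neg_mul, Finsupp.single_neg]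
  congr 2
  refine eq_lineExpo ?_ ?_
  · rw [up_zero_zero, down_one_zero, lineExpo_zero]; push_cast; rfl
  · rw [up_zero_one, down_one_one, lineExpo_one]; push_cast; ring

lemma act_vf_e_apply (k : ℕ) (v : Lift Chart.plane R) :
    actL Chart.plane s (vf G.e) v (lineExpo l k) = -(k + 1 : R) * v (lineExpo l (k + 1)) := by
  classical
  rw [vf_e, map_neg, LinearMap.neg_apply, Finsupp.neg_apply, neg_mul]
  congr 1
  induction v using Finsupp.induction_linear with
  | zero => simp
  | add f g hf hg => rw [map_add, Finsupp.add_apply, hf, hg, Finsupp.add_apply, mul_add]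
  | single e z =>
    rw [map_mul, Module.End.mul_apply, act_d (isRestriction_res _), act_x (isRestriction_res _)]
    by_cases h : e.1 0 = 0
    · have hne : lineExpo l (k + 1) ≠ e := by
        rintro rfl
        rw [lineExpo_zero] at h
        omega
      rw [Finsupp.single_eq_of_ne hne]
      simp [h]
    · have h0 := expo_nonneg e rfl
      have hz : (e.down 0).1 0 = e.1 0 - 1 := down_zero_zero e fun _ => by omega
      by_cases he : e = lineExpo l (k + 1)
      · have : (e.down 0).up 1 = lineExpo l k := by
          refine eq_lineExpo ?_ ?_
          · rw [up_one_zero, hz, he, lineExpo_zero]; push_cast; ring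
          · rw [up_one_one, down_zero_one, he, lineExpo_one]; push_cast; ring
        rw [this, he, Finsupp.single_eq_same, Finsupp.single_eq_same, lineExpo_zero]
        simp
      · have : lineExpo l k ≠ (e.down 0).up 1 := by
          intro h
          refine he (eq_lineExpo ?_ ?_)
          · have := congrArg (fun e => e.1 0) h
            simp only [up_one_zero, hz, lineExpo_zero] at this
            push_cast; omega
          · have := congrArg (fun e => e.1 1) h
            simp only [up_one_one, down_zero_one, lineExpo_one] at this
            push_cast; omega
        rw [Finsupp.single_eq_of_ne this, Finsupp.single_eq_of_ne (Ne.symm he), mul_zero]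

lemma act_x_zero_mul_apply (a : Diff Chart.plane) (v : Lift Chart.plane R)
    {e : Expo Chart.plane.meetU} (he : e.1 0 = 0) : actL Chart.plane s (x 0 * a) v e = 0 := by
  rw [map_mul, Module.End.mul_apply]
  generalize actL Chart.plane s a v = w
  induction w using Finsupp.induction_linear with
  | zero => simp
  | add f g hf hg => rw [map_add, Finsupp.add_apply, hf, hg, add_zero]
  | single e' z =>
    rw [act_x (isRestriction_res _)]
    refine Finsupp.single_eq_of_ne ?_
    rintro rfl
    rw [up_zero_zero] at he
    have := expo_nonneg e' rfl
    omega

/-- The effect on coefficients of the vector fields in the lower triangular Borel subalgebra, at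
the exponents of the powers of `x₂`. -/
lemma act_vf_apply_lineExpo_zero (X : G) (hX : X.1 0 1 = 0) (v : Lift Chart.plane R) :
    actL Chart.plane s (vf X) v (lineExpo l 0) = wt R s l X * v (lineExpo l 0) := by
  have h1 := act_x_mul_d_apply R s (isRestriction_res Chart.plane) 1 v (lineExpo l 0)
  have h0 : (lineExpo l 0).1 0 = 0 := lineExpo_zero l 0
  rw [lineExpo_one, if_pos rfl] at h1
  rw [act_vf_eq, hX, G.one_one, Finsupp.neg_apply, Finsupp.add_apply, Finsupp.add_apply,
    Finsupp.add_apply, Finsupp.smul_apply, Finsupp.smul_apply, Finsupp.smul_apply,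
    Finsupp.smul_apply, act_x_zero_mul_apply _ _ h0, act_x_zero_mul_apply _ _ h0, h1, wt,
    smul_zero, zero_smul, smul_zero, map_intCast, Algebra.smul_def, map_neg]
  push_cast
  ring

/-- The monomials are weight vectors. -/
lemma act_vf_single_of_diag (H : G) (h1 : H.1 0 1 = 0) (h2 : H.1 1 0 = 0)
    (e : Expo Chart.plane.meetU) (z : R) : actL Chart.plane s (vf H) (Finsupp.single e z) =
      wt R s ((e.1 1 - e.1 0 : ℤ) : ℂ) H • Finsupp.single e z := by
  classical
  ext e'
  have hx := act_x_mul_d_apply R s (isRestriction_res Chart.plane) 0 (Finsupp.single e z) e'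
  have hy := act_x_mul_d_apply R s (isRestriction_res Chart.plane) 1 (Finsupp.single e z) e'
  rw [if_pos rfl] at hy
  rw [if_neg (by decide), add_zero] at hx
  rw [act_vf_eq, h1, h2, G.one_one, Finsupp.neg_apply, Finsupp.add_apply, Finsupp.add_apply,
    Finsupp.add_apply, Finsupp.smul_apply, Finsupp.smul_apply, Finsupp.smul_apply,
    Finsupp.smul_apply, hx, hy, zero_smul, zero_smul, Finsupp.smul_apply, wt, map_intCast,
    Algebra.smul_def, Algebra.smul_def, map_neg, smul_eq_mul]
  by_cases he : e = e'
  · subst he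
    push_cast
    ring
  · rw [Finsupp.single_eq_of_ne (Ne.symm he)]
    simp only [mul_zero, add_zero, neg_zero]

end Line

/-! ### Homogeneous functions as a dual Verma module -/

section DualVerma

variable {R : Type} [CommRing R] [Algebra ℂ R] (s : R) (l : ℤ)

/-- The map from functions to the coinduced module: it sends `v` to the function that sends `u` to
the coefficient of `x₂^l` in `u v`. -/
def toCoinduced : Lift Chart.plane R →ₗ[R] (UG →ₗ[ℂ] R) where
  toFun v :=
    { toFun := fun u => actL Chart.plane s (vfHom u) v (lineExpo l 0)
      map_add' := fun u u' => by simp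
      map_smul' := fun c u => by simp }
  map_add' v v' := by ext u; simp
  map_smul' c v := by ext u; simp [act_smul]

variable {s l}

lemma toCoinduced_apply (v : Lift Chart.plane R) (u : UG) :
    toCoinduced s l v u = actL Chart.plane s (vfHom u) v (lineExpo l 0) := rfl

lemma toCoinduced_act (X : G) (v : Lift Chart.plane R) (u : UG) :
    toCoinduced s l (actL Chart.plane s (vf X) v) u = toCoinduced s l v (u * toUG X) := by
  rw [toCoinduced_apply, toCoinduced_apply, map_mul, map_mul, vfHom_toUG, Module.End.mul_apply]

lemma toCoinduced_mem_coinduced (v : Lift Chart.plane R) :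
    toCoinduced s l v ∈ coinduced R s l := fun X hX u => by
  rw [toCoinduced_apply, map_mul, map_mul, vfHom_toUG, Module.End.mul_apply,
    act_vf_apply_lineExpo_zero X hX]
  rfl

lemma toCoinduced_mem (v : Lift Chart.plane R) : toCoinduced s l v ∈ dualVerma R s l := by
  induction v using Finsupp.induction_linear with
  | zero => rw [map_zero]; exact zero_mem _
  | add f g hf hg => rw [map_add]; exact add_mem hf hg
  | single e z =>
    refine Submodule.mem_iSup_of_mem ((e.1 1 - e.1 0 : ℤ) : ℂ)
      ⟨toCoinduced_mem_coinduced _, fun H h1 h2 u => ?_⟩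
    rw [← toCoinduced_act, act_vf_single_of_diag H h1 h2, map_smul]
    rfl

/-- Up to a nonzero constant, the value on `e^k` is the coefficient of `x₁^k x₂^(l-k)`. -/
lemma exists_toCoinduced_e_pow (k : ℕ) : ∃ c : ℂ, c ≠ 0 ∧ ∀ v : Lift Chart.plane R,
    toCoinduced s l v (toUG G.e ^ k) = c • v (lineExpo l k) := by
  induction k with
  | zero => exact ⟨1, one_ne_zero, fun v => by simp [toCoinduced_apply]⟩
  | succ k ih =>
    obtain ⟨c, hc, h⟩ := ih
    refine ⟨c * -(k + 1), mul_ne_zero hc (neg_ne_zero.2 (by exact_mod_cast k.succ_ne_zero)),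
      fun v => ?_⟩
    rw [pow_succ, ← toCoinduced_act, h, act_vf_e_apply, mul_smul]
    congr 1
    rw [Algebra.smul_def]
    simp

lemma toCoinduced_injOn {v : Lift Chart.plane R} (hv : v ∈ line R l)
    (h : toCoinduced s l v = 0) : v = 0 := by
  refine line_ext hv (zero_mem _) fun k => ?_
  obtain ⟨c, hc, hk⟩ := exists_toCoinduced_e_pow (s := s) (l := l) k
  have := hk v
  rw [h, LinearMap.zero_apply] at this
  exact (smul_eq_zero.1 this.symm).resolve_left hc

/-- A weight vector of the coinduced module comes from a monomial: its value on `e^k` vanishes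
unless its weight is `l - 2k`. -/
lemma exists_toCoinduced_eq_of_weight {μ : ℂ} {φ : UG →ₗ[ℂ] R} (hφ : φ ∈ weightSpace R s l μ) :
    ∃ v ∈ line R l, toCoinduced s l v = φ := by
  have hz : ∀ k : ℕ, (l - 2 * k : ℂ) ≠ μ → φ (toUG G.e ^ k) = 0 := by
    intro k hk
    have h1 := hφ.2 G.h (by simp [G.h]) (by simp [G.h]) (toUG G.e ^ k)
    rw [e_pow_mul_h, map_sub, map_smul, hφ.1 G.h (by simp [G.h]), wt_h, wt_h,
      Algebra.smul_def] at h1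
    have h2 : (l - 2 * k - μ : ℂ) • φ (toUG G.e ^ k) = 0 := by
      rw [Algebra.smul_def]
      simp only [map_sub, map_intCast] at h1 ⊢
      linear_combination h1
    exact (smul_eq_zero.1 h2).resolve_left (sub_ne_zero.2 hk)
  have key : ∀ v ∈ line R l, (∀ k, toCoinduced s l v (toUG G.e ^ k) = φ (toUG G.e ^ k)) →
      toCoinduced s l v = φ := fun v _ h => sub_eq_zero.1
    (eq_zero_of_forall_e_pow (sub_mem (toCoinduced_mem_coinduced v) hφ.1) fun k => by
      rw [LinearMap.sub_apply, h, sub_self])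
  by_cases hμ : ∃ k : ℕ, (l - 2 * k : ℂ) = μ
  · obtain ⟨k, rfl⟩ := hμ
    obtain ⟨c, hc, h⟩ := exists_toCoinduced_e_pow (R := R) (s := s) (l := l) k
    refine ⟨Finsupp.single (lineExpo l k) (c⁻¹ • φ (toUG G.e ^ k)), single_lineExpo_mem _ _,
      key _ (single_lineExpo_mem _ _) fun k' => ?_⟩
    by_cases hk : k' = k
    · subst hk
      rw [h, Finsupp.single_eq_same, smul_inv_smul₀ hc]
    · obtain ⟨c', -, h'⟩ := exists_toCoinduced_e_pow (R := R) (s := s) (l := l) k'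
      rw [h', Finsupp.single_eq_of_ne fun h => hk (lineExpo_injective l h), smul_zero, hz]
      intro h
      refine hk ?_
      have : (k' : ℂ) = k := by linear_combination (-1 / 2 : ℂ) * h
      exact_mod_cast this
  · push Not at hμ
    exact ⟨0, zero_mem _, key 0 (zero_mem _) fun k => by
      rw [map_zero, LinearMap.zero_apply, hz k (hμ k)]⟩

variable (s l)

/-- The identification of the homogeneous elements of degree `l` with the dual Verma module. -/
def lineEquiv : line R l ≃ₗ[R] dualVerma R s l :=
  LinearEquiv.ofBijective
    (((toCoinduced s l).comp (line R l).subtype).codRestrict (dualVerma R s l)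
      fun v => toCoinduced_mem v.1) (by
    constructor
    · refine (injective_iff_map_eq_zero _).2 fun v hv => Subtype.ext ?_
      exact toCoinduced_injOn v.2 (congrArg Subtype.val hv)
    · rintro ⟨φ, hφ⟩
      suffices h : ∃ v ∈ line R l, toCoinduced s l v = φ by
        obtain ⟨v, hv, h⟩ := h
        exact ⟨⟨v, hv⟩, Subtype.ext h⟩
      refine Submodule.iSup_induction _ (motive := fun φ => ∃ v ∈ line R l,
        toCoinduced s l v = φ) hφ (fun μ φ => exists_toCoinduced_eq_of_weight)
        ⟨0, zero_mem _, map_zero _⟩ ?_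
      rintro _ _ ⟨v, hv, rfl⟩ ⟨w, hw, rfl⟩
      exact ⟨v + w, add_mem hv hw, map_add _ _ _⟩)

lemma lineEquiv_apply (v : line R l) (u : UG) :
    (lineEquiv s l v).1 u = toCoinduced s l v.1 u := rfl

end DualVerma

/-! ### The Verma module in the homogeneous functions -/

section VermaFunctions

/-- The power of `s` that is needed to move `x₂^l t^s` into the lattice. -/
def polarOrder (l : ℤ) : ℕ := if 0 ≤ l then 0 else 1

variable {R : Type} [CommRing R] [Algebra ℂ R] (s : R) (l : ℤ)

/-- The section `x₂^l t^s` is a highest weight vector of weight `l + s`. -/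
lemma exists_vermaFun : ∃ F : Verma R s l →+ Lift Chart.plane R,
    F (Verma.gen R s l) = Finsupp.single (lineExpo l 0) 1 ∧
    ∀ (b : R) (u : UG) (m : Verma R s l),
      F ((b ⊗ₜ[ℂ] u) • m) = b • actL Chart.plane s (vfHom u) (F m) := by
  let ρ : R ⊗[ℂ] UG →ₐ[ℂ] Module.End ℂ (Lift Chart.plane R) :=
    Algebra.TensorProduct.lift (Algebra.lsmul ℂ ℂ (Lift Chart.plane R))
      ((actL Chart.plane s).comp vfHom) fun b u => LinearMap.ext fun v => (act_smul R s _ b v).symm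
  have hρ : ∀ b u v, ρ (b ⊗ₜ u) • v = b • actL Chart.plane s (vfHom u) v := fun b u v => rfl
  obtain ⟨F, hF, h⟩ := Verma.exists_hom (S := Module.End ℂ (Lift Chart.plane R))
    (N := Lift Chart.plane R) (B := R) (σ := s) (lam := l) ρ.toRingHom
    (Finsupp.single (lineExpo l 0) (1 : R)) (fun X hX => by
      change ρ _ • Finsupp.single (lineExpo l 0) (1 : R) =
        ρ _ • Finsupp.single (lineExpo l 0) (1 : R)
      rw [hρ, hρ, one_smul, map_one, map_one, Module.End.one_apply, vfHom_toUG, act_vf_eq, hX]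
      have h1 := act_vf_single_of_diag (s := s) (X.1 0 0 • G.h) (by simp [smul_val, G.h])
        (by simp [smul_val, G.h]) (lineExpo l 0) (1 : R)
      have h2 : actL Chart.plane s (x 1 * d 0 : Diff Chart.plane)
          (Finsupp.single (lineExpo l 0) (1 : R)) = 0 := by
        rw [map_mul, Module.End.mul_apply, act_d (isRestriction_res _), lineExpo_zero]
        simp
      have hh : G.h.1 0 0 = 1 ∧ G.h.1 0 1 = 0 ∧ G.h.1 1 0 = 0 ∧ G.h.1 1 1 = -1 := by
        simp [G.h]
      have h4 : wt R s (((lineExpo l 0).1 1 - (lineExpo l 0).1 0 : ℤ) : ℂ) (X.1 0 0 • G.h) =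
          wt R s l X := by
        rw [lineExpo_zero, lineExpo_one, wt, wt, smul_val, hh.1]
        simp
      rw [h4, act_vf_eq, smul_val, smul_val, smul_val, smul_val, hh.1, hh.2.1, hh.2.2.1,
        hh.2.2.2] at h1
      rw [← h1, h2, G.one_one X, smul_zero, smul_zero, mul_zero, zero_smul, mul_one,
        mul_neg_one])
  exact ⟨F, hF, fun b u m => h _ m⟩

/-- The homomorphism from the deformed Verma module to the homogeneous elements of degree `l` that
sends the generator to `x₂^l t^s`. -/
def vermaFun : Verma R s l →+ Lift Chart.plane R := (exists_vermaFun s l).choose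

variable {s l}

lemma vermaFun_gen : vermaFun s l (Verma.gen R s l) = Finsupp.single (lineExpo l 0) 1 :=
  (exists_vermaFun s l).choose_spec.1

lemma vermaFun_smul (b : R) (u : UG) (m : Verma R s l) : vermaFun s l ((b ⊗ₜ[ℂ] u) • m) =
    b • actL Chart.plane s (vfHom u) (vermaFun s l m) :=
  (exists_vermaFun s l).choose_spec.2 b u m

lemma vermaFun_lie (X : G) (m : Verma R s l) :
    vermaFun s l (lieVerma X m) = actL Chart.plane s (vf X) (vermaFun s l m) := by
  rw [lieVerma, vermaFun_smul, one_smul, vfHom_toUG]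

lemma vermaFun_coeff (b : R) (m : Verma R s l) :
    vermaFun s l (coeffVerma b m) = b • vermaFun s l m := by
  rw [coeffVerma, vermaFun_smul, map_one, map_one, Module.End.one_apply]

lemma vermaFun_mem (m : Verma R s l) : vermaFun s l m ∈ line R l := by
  refine Verma.induction (p := fun m => vermaFun s l m ∈ line R l) ?_ (fun m m' hm hm' => ?_)
    (fun b m hm => ?_) (fun X m hm => ?_) m
  · rw [vermaFun_gen]; exact single_lineExpo_mem _ _
  · rw [map_add]; exact add_mem hm hm'
  · rw [vermaFun_coeff]; exact Submodule.smul_mem _ _ hm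
  · rw [vermaFun_lie]; exact act_vf_mem_line X hm

variable (s l) in
/-- The coefficient of `f^k x₂^l t^s`. -/
def fCoeff (k : ℕ) : R := ∏ j ∈ Finset.range k, -(((l - j : ℤ) : R) + s)

lemma act_f_pow (k : ℕ) : actL Chart.plane s (vfHom (toUG G.f ^ k))
    (Finsupp.single (lineExpo l 0) 1) = Finsupp.single (lineExpo l k) (fCoeff s l k) := by
  induction k with
  | zero => simp [fCoeff]
  | succ k ih =>
    rw [pow_succ', map_mul, map_mul, Module.End.mul_apply, ih, vfHom_toUG, act_vf_f_single,
      fCoeff, fCoeff, Finset.prod_range_succ, mul_comm]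

lemma vermaFun_sum (b : ℕ →₀ R) (k : ℕ) :
    vermaFun s l (Verma.sum R s l b) (lineExpo l k) = b k * fCoeff s l k := by
  classical
  induction b using Finsupp.induction_linear with
  | zero => simp
  | add b c hb hc => rw [map_add, map_add, Finsupp.add_apply, hb, hc, Finsupp.add_apply, add_mul]
  | single j z =>
    rw [Verma.sum_single, vermaFun_smul, vermaFun_gen, act_f_pow, Finsupp.smul_single,
      smul_eq_mul]
    by_cases h : j = k
    · rw [h, Finsupp.single_eq_same, Finsupp.single_eq_same]
    · rw [Finsupp.single_eq_of_ne (Ne.symm h), zero_mul,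
        Finsupp.single_eq_of_ne fun h' => h (lineExpo_injective l h').symm]

variable (P : Parameter R s)
include P

/-- The vector `f^k x₂^l t^s` generates the part of the lattice at the exponent of
`x₁^k x₂^(l-k)`, up to the power of `s` that is needed to move `x₂^l t^s` into the lattice. -/
lemma exists_unit_fCoeff (k : ℕ) : ∃ u : Rˣ, s ^ polarOrder l * fCoeff s l k =
    u * if l < k then s else 1 := by
  induction k with
  | zero =>
    refine ⟨1, ?_⟩
    by_cases h : 0 ≤ l
    · simp [polarOrder, fCoeff, h]
    · simp [polarOrder, fCoeff, h, not_le.1 h]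
  | succ k ih =>
    obtain ⟨u, hu⟩ := ih
    rw [fCoeff, Finset.prod_range_succ, ← fCoeff, ← mul_assoc, hu]
    by_cases h : l = k
    · refine ⟨-u, ?_⟩
      rw [h, if_neg (by omega), if_pos (by omega)]
      simp
    · have h1 : ((l - k : ℤ) : ℂ) ≠ 0 := by
        rw [Int.cast_ne_zero]; omega
      obtain ⟨w, hw⟩ := (P.isUnit_add_s h1).neg
      rw [map_intCast] at hw
      refine ⟨u * w, ?_⟩
      have h2 : (l < (k + 1 : ℕ)) ↔ l < k := by omega
      simp only [h2]
      rw [← hw, Units.val_mul]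
      ring

lemma s_pow_smul_vermaFun_mem (m : Verma R s l) :
    s ^ polarOrder l • vermaFun s l m ∈ lattice Chart.plane s := by
  obtain ⟨b, rfl⟩ := Verma.sum_surjective m
  intro e _ he
  rw [Finsupp.smul_apply, smul_eq_mul]
  by_cases hl : e.1 0 + e.1 1 = l
  · obtain ⟨k, rfl⟩ := exists_eq_lineExpo hl
    obtain ⟨u, hu⟩ := exists_unit_fCoeff (l := l) P k
    rw [lineExpo_one] at he
    rw [if_pos (show l < k by omega)] at hu
    rw [vermaFun_sum, mul_left_comm, hu, ← mul_assoc]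
    exact dvd_mul_left _ _
  · rw [vermaFun_mem _ e hl, mul_zero]
    exact dvd_zero _

lemma exists_vermaFun_eq {f : Lift Chart.plane R} (h1 : f ∈ lattice Chart.plane s)
    (h2 : f ∈ line R l) :
    ∃ m : Verma R s l, s ^ polarOrder l • vermaFun s l m = f := by
  let F : Verma R s l →+ Lift Chart.plane R :=
    (DistribSMul.toAddMonoidHom _ (s ^ polarOrder l)).comp (vermaFun s l)
  change f ∈ F.range
  refine mem_of_line h2 fun k => ?_
  obtain ⟨u, hu⟩ := exists_unit_fCoeff (l := l) P k
  obtain ⟨z, hz⟩ : (if l < k then s else 1) ∣ f (lineExpo l k) := by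
    split_ifs with h
    · exact h1 _ rfl (by rw [lineExpo_one]; omega)
    · exact one_dvd _
  refine ⟨Verma.sum R s l (Finsupp.single k (↑u⁻¹ * z)), ?_⟩
  change s ^ _ • vermaFun s l _ = _
  refine line_ext (Submodule.smul_mem _ _ (vermaFun_mem _)) (single_lineExpo_mem _ _) fun j => ?_
  rw [Finsupp.smul_apply, vermaFun_sum, smul_eq_mul]
  by_cases h : j = k
  · subst h
    rw [Finsupp.single_eq_same, Finsupp.single_eq_same, mul_left_comm, hu, hz, mul_comm _ z,
      mul_assoc, ← mul_assoc (↑u⁻¹ : R), Units.inv_mul, one_mul, mul_comm]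
  · rw [Finsupp.single_eq_of_ne h, zero_mul, mul_zero,
      Finsupp.single_eq_of_ne fun h' => h (lineExpo_injective l h')]

variable [IsDomain R]

lemma vermaFun_injective : Function.Injective (vermaFun s l) := by
  refine (injective_iff_map_eq_zero _).2 fun m hm => ?_
  obtain ⟨b, rfl⟩ := Verma.sum_surjective m
  suffices b = 0 by rw [this, map_zero]
  ext k
  have h := vermaFun_sum (s := s) (l := l) b k
  rw [hm, Finsupp.zero_apply, eq_comm, mul_eq_zero] at h
  refine h.resolve_right fun h0 => ?_
  obtain ⟨u, hu⟩ := exists_unit_fCoeff (l := l) P k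
  rw [h0, mul_zero, eq_comm, Units.mul_right_eq_zero] at hu
  split_ifs at hu
  · exact P.ne_zero hu
  · exact one_ne_zero hu

omit [Algebra ℂ R] P in
lemma mem_line_of_smul_mem {a : R} (ha : a ≠ 0) {f : Lift Chart.plane R} (h : a • f ∈ line R l) :
    f ∈ line R l := fun e he => by
  have := h e he
  rw [Finsupp.smul_apply, smul_eq_mul, mul_eq_zero] at this
  exact this.resolve_left ha

/-- Divisibility by `s` in the deformed Verma module is divisibility in the lattice. -/
lemma exists_coeffVerma_pow (N : ℕ) (m : Verma R s l) {g : Lift Chart.plane R}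
    (hg : g ∈ lattice Chart.plane s)
    (h : s ^ polarOrder l • vermaFun s l m = s ^ N • g) :
    ∃ m', m = coeffVerma (s ^ N) m' := by
  have hg' : g ∈ line R l := mem_line_of_smul_mem (pow_ne_zero N P.ne_zero)
    (h ▸ Submodule.smul_mem _ _ (vermaFun_mem m))
  obtain ⟨m', rfl⟩ := exists_vermaFun_eq P hg hg'
  refine ⟨m', vermaFun_injective P ?_⟩
  rw [vermaFun_coeff]
  rw [smul_comm] at h
  exact smul_right_injective _ (pow_ne_zero _ P.ne_zero) h

omit [IsDomain R] P in
/-- The canonical homomorphism from the deformed Verma module to the deformed dual Verma module. -/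
lemma isCanonicalHom_vermaFun : IsCanonicalHom R s l
    ((lineEquiv s l).toLinearMap.toAddMonoidHom.comp
      ((vermaFun s l).codRestrict (line R l).toAddSubgroup vermaFun_mem)) where
  map_coeff b m := by
    change lineEquiv s l ⟨_, _⟩ = b • lineEquiv s l ⟨_, _⟩
    rw [← map_smul]
    congr 1
    exact Subtype.ext (vermaFun_coeff b m)
  map_lie X m u := by
    change toCoinduced s l (vermaFun s l _) u = toCoinduced s l (vermaFun s l m) _
    rw [vermaFun_lie, toCoinduced_act]
  map_gen := by
    change toCoinduced s l (vermaFun s l _) 1 = 1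
    rw [vermaFun_gen, toCoinduced_apply, map_one, map_one, Module.End.one_apply,
      Finsupp.single_eq_same]

end VermaFunctions

end Jantzen

namespace Jantzen

open Diff

/-! ### Eigenvectors of the Euler operator -/

section EulerOperator

variable {R : Type} [CommRing R] [Algebra ℂ R] {s : R} {l : ℤ}

lemma act_euler_apply (f : Lift Chart.plane R) (e : Expo Chart.plane.meetU) :
    actL Chart.plane s euler f e = (((e.1 0 + e.1 1 : ℤ) : R) + s) * f e := by
  rw [euler, Fin.sum_univ_two, map_add, LinearMap.add_apply, Finsupp.add_apply,
    act_x_mul_d_apply _ _ (isRestriction_res _), act_x_mul_d_apply _ _ (isRestriction_res _),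
    if_pos rfl, if_neg (by decide)]
  push_cast
  ring

lemma act_euler_of_mem_line {f : Lift Chart.plane R} (hf : f ∈ line R l) :
    actL Chart.plane s euler f = ((l : R) + s) • f := by
  ext e
  rw [act_euler_apply, Finsupp.smul_apply, smul_eq_mul]
  by_cases he : e.1 0 + e.1 1 = l
  · rw [he]
  · rw [hf e he, mul_zero, mul_zero]

lemma act_algebraMap (W : Chart) (c : ℂ) (f : Lift W R) :
    actL W s (algebraMap ℂ (Diff W) c) f = algebraMap ℂ R c • f := by
  rw [AlgHom.commutes, Module.algebraMap_end_apply, algebraMap_smul]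

variable (P : Parameter R s) [IsDomain R]
include P

/-- An approximate eigenvector of the Euler operator is approximated by its homogeneous part: in a
degree `d ≠ l` the coefficients are divisible by `s^N`, because `d - l` is invertible. -/
lemma exists_line_part (N : ℕ) {f g : Lift Chart.plane R}
    (h : actL Chart.plane s euler f = ((l : R) + s) • f + s ^ N • g) :
    ∃ f' ∈ line R l, ∃ g', f = f' + s ^ N • g' ∧ (∀ e, f e ∣ f' e) ∧ ∀ e, g e ∣ g' e := by
  classical
  have hs : s ^ N ≠ 0 := pow_ne_zero N P.ne_zero
  have hoff : ∀ e : Expo Chart.plane.meetU, e.1 0 + e.1 1 ≠ l →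
      f e = s ^ N * (algebraMap ℂ R ((e.1 0 + e.1 1 - l : ℤ) : ℂ)⁻¹ * g e) := by
    intro e he
    have hc : ((e.1 0 + e.1 1 - l : ℤ) : ℂ) ≠ 0 := by
      rw [Int.cast_ne_zero]; exact sub_ne_zero.2 he
    have h1 := DFunLike.congr_fun h e
    rw [act_euler_apply, Finsupp.add_apply, Finsupp.smul_apply, Finsupp.smul_apply, smul_eq_mul,
      smul_eq_mul] at h1
    have h2 : algebraMap ℂ R ((e.1 0 + e.1 1 - l : ℤ) : ℂ) * f e = s ^ N * g e := by
      rw [map_intCast]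
      push_cast at h1 ⊢
      linear_combination h1
    have h3 : algebraMap ℂ R ((e.1 0 + e.1 1 - l : ℤ) : ℂ)⁻¹ *
        algebraMap ℂ R ((e.1 0 + e.1 1 - l : ℤ) : ℂ) = 1 := by
      rw [← map_mul, inv_mul_cancel₀ hc, map_one]
    linear_combination algebraMap ℂ R ((e.1 0 + e.1 1 - l : ℤ) : ℂ)⁻¹ * h2 - f e * h3
  let f' : Lift Chart.plane R := f.filter fun e => e.1 0 + e.1 1 = l
  have hon : ∀ e, e.1 0 + e.1 1 = l → f' e = f e := fun e he => Finsupp.filter_apply_pos _ _ he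
  have hf' : ∀ e, e.1 0 + e.1 1 ≠ l → f' e = 0 := fun e he => Finsupp.filter_apply_neg _ _ he
  obtain ⟨g', hg'⟩ := exists_smul_of_dvd (a := s ^ N) (f - f') fun e => by
    rw [Finsupp.sub_apply]
    by_cases he : e.1 0 + e.1 1 = l
    · rw [hon e he, sub_self]; exact dvd_zero _
    · rw [hf' e he, sub_zero, hoff e he]; exact dvd_mul_right _ _
  refine ⟨f', hf', g', ?_, fun e => ?_, fun e => ?_⟩
  · rw [← hg']; abel
  · by_cases he : e.1 0 + e.1 1 = l
    · rw [hon e he]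
    · rw [hf' e he]; exact dvd_zero _
  · have h1 := DFunLike.congr_fun hg' e
    rw [Finsupp.sub_apply, Finsupp.smul_apply, smul_eq_mul] at h1
    by_cases he : e.1 0 + e.1 1 = l
    · rw [hon e he, sub_self, eq_comm, mul_eq_zero] at h1
      rw [h1.resolve_left hs]; exact dvd_zero _
    · rw [hf' e he, sub_zero, hoff e he] at h1
      rw [← mul_left_cancel₀ hs h1]; exact dvd_mul_left _ _

end EulerOperator

lemma mem_lattice_of_dvd {W : Chart} {R : Type} [CommRing R] {s : R} {f g : Lift W R}
    (hf : f ∈ lattice W s) (h : ∀ e, f e ∣ g e) : g ∈ lattice W s :=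
  fun e h1 h2 => (hf e h1 h2).trans (h e)

/-! ### The global sections of `j_!` -/

section GlobalSections

variable {R : Type} [CommRing R] [Algebra ℂ R] {s : R} (P : Parameter R s) (n : ℕ) (l : ℤ)

/-- The deformed Verma module as the homogeneous part of the lattice. -/
def vermaToLattice : Verma R s l →+ lattice Chart.plane s :=
  AddMonoidHom.mk' (fun m => ⟨_, s_pow_smul_vermaFun_mem P m⟩) fun m m' => Subtype.ext
    ((congrArg _ (map_add (vermaFun s l) m m')).trans (smul_add _ _ _))

variable {l}

lemma coe_vermaToLattice (m : Verma R s l) :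
    (vermaToLattice P l m).1 = s ^ polarOrder l • vermaFun s l m := rfl

lemma vermaToLattice_mem_line (m : Verma R s l) : (vermaToLattice P l m).1 ∈ line R l :=
  Submodule.smul_mem _ _ (vermaFun_mem m)

lemma vermaToLattice_lie (X : G) (m : Verma R s l) :
    (vermaToLattice P l (lieVerma X m)).1 =
      actL Chart.plane s (vf X) (vermaToLattice P l m).1 := by
  rw [coe_vermaToLattice, coe_vermaToLattice, vermaFun_lie, act_smul]

lemma vermaToLattice_coeff (b : R) (m : Verma R s l) :
    vermaToLattice P l (coeffVerma b m) = b • vermaToLattice P l m := by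
  refine Subtype.ext ?_
  rw [Submodule.coe_smul, coe_vermaToLattice, coe_vermaToLattice, vermaFun_coeff, smul_comm]

variable [IsDomain R]

variable (l) in
/-- The map from the deformed Verma module to the global sections of `j_! f^s 𝒪_U^{(n)}`. -/
def vermaToShriek : Verma R s l →+ jShriek Chart.plane (fsO Chart.plane n) :=
  (latticeProj P n).comp (vermaToLattice P l)

lemma vermaToShriek_apply (m : Verma R s l) :
    vermaToShriek P n l m = latticeProj P n (vermaToLattice P l m) := rfl

lemma vermaToShriek_lie (X : G) (m : Verma R s l) :
    vermaToShriek P n l (lieVerma X m) = vf X • vermaToShriek P n l m := by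
  rw [vermaToShriek_apply, vermaToShriek_apply, ← latticeProj_act]
  congr 1
  exact Subtype.ext (vermaToLattice_lie P X m)

lemma latticeProj_algebraMap (W : Chart) (c : ℂ) (f : lattice W s) :
    latticeProj P n (algebraMap ℂ R c • f) = algebraMap ℂ (Diff W) c • latticeProj P n f := by
  rw [← latticeProj_act]
  congr 1
  exact Subtype.ext (act_algebraMap W c f.1).symm

lemma vermaToShriek_coeff_algebraMap (c : ℂ) (m : Verma R s l) :
    vermaToShriek P n l (coeffVerma (algebraMap ℂ R c) m) =
      algebraMap ℂ (Diff Chart.plane) c • vermaToShriek P n l m := by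
  rw [vermaToShriek_apply, vermaToLattice_coeff, latticeProj_algebraMap]
  rfl

lemma vermaToShriek_coeff_s (m : Verma R s l) :
    vermaToShriek P n l (coeffVerma s m) = sShriek Chart.plane n (vermaToShriek P n l m) := by
  rw [vermaToShriek_apply, vermaToLattice_coeff, latticeProj_s]
  rfl

lemma euler_smul_latticeProj_iff (f g : lattice Chart.plane s) :
    euler • latticeProj P n f =
        algebraMap ℂ (Diff Chart.plane) l • latticeProj P n f + latticeProj P n g ↔
      ∃ g' ∈ lattice Chart.plane s,
        actL Chart.plane s euler f.1 = (l : R) • f.1 + g.1 + s ^ n • g' := by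
  rw [← latticeProj_algebraMap, ← latticeProj_act, ← map_add, ← sub_eq_zero, ← map_sub,
    latticeProj_eq_zero_iff, map_intCast]
  exact exists_congr fun g' => and_congr_right fun _ => sub_eq_iff_eq_add'

/-- The image of the deformed Verma module is an eigenspace of the Euler operator. -/
lemma exists_vermaToShriek_eq_iff (v : jShriek Chart.plane (fsO Chart.plane n)) :
    (∃ m : Verma R s l, vermaToShriek P n l m = v) ↔
      euler • v = algebraMap ℂ (Diff Chart.plane) l • v + sShriek Chart.plane n v := by
  constructor
  · rintro ⟨m, rfl⟩
    rw [← vermaToShriek_coeff_s, ← vermaToShriek_coeff_algebraMap, ← map_add,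
      vermaToShriek_apply, vermaToShriek_apply, ← latticeProj_act, map_add, vermaToLattice_coeff,
      vermaToLattice_coeff, ← add_smul, map_intCast]
    congr 1
    exact Subtype.ext (act_euler_of_mem_line (vermaToLattice_mem_line P m))
  · intro h
    obtain ⟨f, rfl⟩ := latticeProj_surjective P n v
    rw [← latticeProj_s, euler_smul_latticeProj_iff] at h
    obtain ⟨g, hg, h⟩ := h
    rw [Submodule.coe_smul, ← add_smul] at h
    obtain ⟨f', hf', g', hfg, h1, h2⟩ := exists_line_part P n h
    have h1 := mem_lattice_of_dvd f.2 h1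
    obtain ⟨m, hm⟩ := exists_vermaFun_eq P h1 hf'
    refine ⟨m, ?_⟩
    rw [vermaToShriek_apply, ← sub_eq_zero, ← map_sub, latticeProj_eq_zero_iff]
    refine ⟨-g', neg_mem (mem_lattice_of_dvd hg h2), ?_⟩
    rw [AddSubgroupClass.coe_sub, coe_vermaToLattice, hm, hfg, smul_neg]
    abel

lemma vermaToShriek_eq_zero_iff (m : Verma R s l) :
    vermaToShriek P n l m = 0 ↔ ∃ m', m = coeffVerma (s ^ n) m' := by
  rw [vermaToShriek_apply, latticeProj_eq_zero_iff]
  constructor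
  · rintro ⟨g, hg, h⟩
    exact exists_coeffVerma_pow P n m hg h
  · rintro ⟨m', rfl⟩
    exact ⟨_, (vermaToLattice P l m').2, by rw [vermaToLattice_coeff]; rfl⟩

end GlobalSections

/-! ### The global sections of `j₊` -/

section DualGlobalSections

variable {R : Type} [CommRing R] [Algebra ℂ R] {s : R} (P : Parameter R s) (n : ℕ) (l : ℤ)
  (u : (Trunc n)ˣ)

/-- The map from the deformed dual Verma module to the global sections of `j₊ f^s 𝒪_U^{(n)}`,
rescaled by a unit of `ℂ[s] / s^n`. -/
def dualToPlus : dualVerma R s l →+ jPlus Chart.plane (fsO Chart.plane n) :=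
  (mulPlus Chart.plane n u).toAddMonoidHom.comp ((plusProj P n).comp
    ((line R l).subtype.comp (lineEquiv s l).symm.toLinearMap).toAddMonoidHom)

variable {l}

lemma dualToPlus_lineEquiv (v : line R l) :
    dualToPlus P n l u (lineEquiv s l v) = mulPlus Chart.plane n u (plusProj P n v.1) := by
  change mulPlus Chart.plane n u (plusProj P n ((lineEquiv s l).symm (lineEquiv s l v)).1) = _
  rw [LinearEquiv.symm_apply_apply]

lemma mulPlus_unit_injective {W : Chart} : Function.Injective (mulPlus W n u) := fun v w h => by
  rw [← mulPlus_one n v, ← mulPlus_one n w, ← u.inv_mul, mulPlus_mul, h, ← mulPlus_mul]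

lemma exists_dualToPlus_lie (X : G) (φ : dualVerma R s l) :
    ∃ φ' : dualVerma R s l, (∀ w, φ'.1 w = φ.1 (w * toUG X)) ∧
      dualToPlus P n l u φ' = vf X • dualToPlus P n l u φ := by
  obtain ⟨v, rfl⟩ := (lineEquiv s l).surjective φ
  refine ⟨lineEquiv s l ⟨actL Chart.plane s (vf X) v.1, act_vf_mem_line X v.2⟩, fun w => ?_, ?_⟩
  · rw [lineEquiv_apply, lineEquiv_apply, toCoinduced_act]
  · rw [dualToPlus_lineEquiv, dualToPlus_lineEquiv, plusProj_act, map_smul]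

lemma plusProj_algebraMap (W : Chart) (c : ℂ) (f : Lift W R) :
    plusProj P n (algebraMap ℂ R c • f) = algebraMap ℂ (Diff W) c • plusProj P n f := by
  rw [← plusProj_act, act_algebraMap]

lemma dualToPlus_algebraMap (c : ℂ) (φ : dualVerma R s l) :
    dualToPlus P n l u (algebraMap ℂ R c • φ) =
      algebraMap ℂ (Diff Chart.plane) c • dualToPlus P n l u φ := by
  obtain ⟨v, rfl⟩ := (lineEquiv s l).surjective φ
  rw [← map_smul, dualToPlus_lineEquiv, dualToPlus_lineEquiv, Submodule.coe_smul,
    plusProj_algebraMap, map_smul]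

lemma dualToPlus_s (φ : dualVerma R s l) :
    dualToPlus P n l u (s • φ) = sPlus Chart.plane n (dualToPlus P n l u φ) := by
  obtain ⟨v, rfl⟩ := (lineEquiv s l).surjective φ
  rw [← map_smul, dualToPlus_lineEquiv, dualToPlus_lineEquiv, Submodule.coe_smul, plusProj_s,
    sPlus_mulPlus]

lemma dualToPlus_s_pow (k : ℕ) (φ : dualVerma R s l) :
    dualToPlus P n l u (s ^ k • φ) = (sPlus Chart.plane n ^ k) (dualToPlus P n l u φ) := by
  induction k with
  | zero => simp
  | succ k ih => rw [pow_succ', mul_smul, dualToPlus_s, ih, pow_succ', Module.End.mul_apply]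

variable [IsDomain R]

/-- The image of the deformed dual Verma module is an eigenspace of the Euler operator. -/
lemma exists_dualToPlus_eq_iff (w : jPlus Chart.plane (fsO Chart.plane n)) :
    (∃ φ : dualVerma R s l, dualToPlus P n l u φ = w) ↔
      euler • w = algebraMap ℂ (Diff Chart.plane) l • w + sPlus Chart.plane n w := by
  constructor
  · rintro ⟨φ, rfl⟩
    obtain ⟨v, rfl⟩ := (lineEquiv s l).surjective φ
    rw [← dualToPlus_s, ← dualToPlus_algebraMap, ← map_add, ← add_smul, ← map_smul (lineEquiv s l),
      dualToPlus_lineEquiv, dualToPlus_lineEquiv, ← map_smul (mulPlus _ _ _), ← plusProj_act,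
      act_euler_of_mem_line v.2, map_intCast]
    rfl
  · intro h
    obtain ⟨f, hf⟩ := plusProj_surjective P n (mulPlus Chart.plane n ↑u⁻¹ w)
    have hw : w = mulPlus Chart.plane n u (plusProj P n f) := by
      rw [hf, ← mulPlus_mul, Units.mul_inv, mulPlus_one]
    rw [hw, sPlus_mulPlus, ← map_smul (mulPlus _ _ _), ← map_smul (mulPlus _ _ _), ← map_add] at h
    have h := mulPlus_unit_injective n u h
    rw [← plusProj_act, ← plusProj_algebraMap, ← plusProj_s, ← map_add, ← add_smul, ← sub_eq_zero,
      ← map_sub, plusProj_eq_zero_iff, map_intCast] at h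
    obtain ⟨g, hg⟩ := h
    obtain ⟨f', hf', g', hfg, -, -⟩ := exists_line_part P n (sub_eq_iff_eq_add'.1 hg)
    refine ⟨lineEquiv s l ⟨f', hf'⟩, ?_⟩
    rw [dualToPlus_lineEquiv, hw, hfg, map_add, (plusProj_eq_zero_iff P n (s ^ n • g')).2 ⟨g', rfl⟩,
      add_zero]

lemma dualToPlus_eq_zero_iff (φ : dualVerma R s l) :
    dualToPlus P n l u φ = 0 ↔ ∃ φ' : dualVerma R s l, φ = s ^ n • φ' := by
  obtain ⟨v, rfl⟩ := (lineEquiv s l).surjective φ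
  rw [dualToPlus_lineEquiv, (map_eq_zero_iff _ (mulPlus_unit_injective n u)),
    plusProj_eq_zero_iff]
  constructor
  · rintro ⟨g, hg⟩
    refine ⟨lineEquiv s l ⟨g, mem_line_of_smul_mem (pow_ne_zero n P.ne_zero) (hg ▸ v.2)⟩, ?_⟩
    rw [← map_smul]
    congr 1
    exact Subtype.ext hg
  · rintro ⟨φ', h⟩
    obtain ⟨v', rfl⟩ := (lineEquiv s l).surjective φ'
    rw [← map_smul] at h
    exact ⟨v'.1, congrArg Subtype.val ((lineEquiv s l).injective h)⟩

end DualGlobalSections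

end Jantzen

namespace Jantzen

/-! ### Reduction modulo `s` -/

section Reduction

variable {R : Type} [CommRing R] [Algebra ℂ R] {s : R} (P : Parameter R s) (n : ℕ) (l : ℤ)

/-- The reduction of the deformed Verma module modulo `s`. -/
def Parameter.red (m : Verma R s l) : M l := Verma.baseChange (l : ℂ) P.eval P.eval_s m

variable {l}

lemma red_add (m m' : Verma R s l) : P.red l (m + m') = P.red l m + P.red l m' := map_add _ _ _

lemma red_gen : P.red l (Verma.gen R s l) = Verma.gen ℂ 0 l :=
  congrArg Submodule.Quotient.mk (map_one (Algebra.TensorProduct.map P.eval (AlgHom.id ℂ UG)))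

lemma red_smul (b : R) (w : UG) (m : Verma R s l) :
    P.red l ((b ⊗ₜ[ℂ] w) • m) = (P.eval b ⊗ₜ[ℂ] w) • P.red l m :=
  map_smulₛₗ (Verma.baseChange (l : ℂ) P.eval P.eval_s) _ _

lemma red_coeff (b : R) (m : Verma R s l) :
    P.red l (coeffVerma b m) = coeffVerma (P.eval b) (P.red l m) := red_smul P b 1 m

lemma red_lie (X : G) (m : Verma R s l) : P.red l (lieVerma X m) = lieVerma X (P.red l m) := by
  rw [lieVerma, red_smul, map_one]
  rfl

lemma red_surjective : Function.Surjective (P.red l) := by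
  refine Verma.induction (p := fun m => ∃ m', P.red l m' = m) ⟨_, red_gen P⟩ ?_ ?_ ?_
  · rintro _ _ ⟨m, rfl⟩ ⟨m', rfl⟩
    exact ⟨m + m', red_add P m m'⟩
  · rintro c _ ⟨m, rfl⟩
    refine ⟨coeffVerma (algebraMap ℂ R c) m, ?_⟩
    rw [red_coeff, AlgHom.commutes]
    rfl
  · rintro X _ ⟨m, rfl⟩
    exact ⟨lieVerma X m, red_lie P X m⟩

lemma red_coeff_s (m : Verma R s l) : P.red l (coeffVerma s m) = 0 := by
  rw [red_coeff, P.eval_s, coeffVerma, TensorProduct.zero_tmul, zero_smul]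

variable [IsDomain R]

lemma mk_sShriek {W : Chart} {n : ℕ} (v : jShriek W (fsO W n)) :
    (Submodule.Quotient.mk (sShriek W n v) : ShriekModS W n) = 0 :=
  (Submodule.Quotient.mk_eq_zero _).2 ⟨v, rfl⟩

/-- The class modulo `s` of the section that corresponds to an element of the deformed Verma
module. -/
def vermaToShriekModS (m : Verma R s l) : ShriekModS Chart.plane n :=
  Submodule.Quotient.mk (vermaToShriek P n l m)

lemma vermaToShriekModS_coeff (b : R) (m : Verma R s l) :
    vermaToShriekModS P n (coeffVerma b m) =
      algebraMap ℂ (Diff Chart.plane) (P.eval b) • vermaToShriekModS P n m := by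
  obtain ⟨z, hz⟩ := (P.eval_eq_zero_iff (b - algebraMap ℂ R (P.eval b))).1 (by
    rw [map_sub, AlgHom.commutes]; exact sub_self _)
  have hb : coeffVerma b m = coeffVerma (algebraMap ℂ R (P.eval b)) m +
      coeffVerma s (coeffVerma z m) := by
    rw [coeffVerma_coeffVerma, ← hz, coeffVerma, coeffVerma, coeffVerma, ← add_smul,
      ← TensorProduct.add_tmul, add_sub_cancel]
  rw [vermaToShriekModS, hb, map_add, vermaToShriek_coeff_algebraMap, vermaToShriek_coeff_s,
    Submodule.Quotient.mk_add, mk_sShriek, add_zero]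
  rfl

lemma vermaToShriekModS_lie (X : G) (m : Verma R s l) :
    vermaToShriekModS P n (lieVerma X m) = vf X • vermaToShriekModS P n m := by
  rw [vermaToShriekModS, vermaToShriek_lie]
  rfl

/-- The map from the Verma module to the global sections of `j_! 𝒪_U`, as the reduction of the
deformed map. -/
lemma exists_reduction : ∃ Θ : M l →+ ShriekModS Chart.plane n,
    (∀ X m, Θ (lieVerma X m) = vf X • Θ m) ∧
    (∀ (c : ℂ) m, Θ (coeffVerma c m) = algebraMap ℂ (Diff Chart.plane) c • Θ m) ∧
    ∀ m, Θ (P.red l m) = vermaToShriekModS P n m := by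
  let ρ : ℂ ⊗[ℂ] UG →ₐ[ℂ] Diff Chart.plane :=
    Algebra.TensorProduct.lift (Algebra.ofId ℂ _) vfHom fun c u => Algebra.commutes c _
  have hρ : ∀ c u, ρ (c ⊗ₜ u) = algebraMap ℂ _ c * vfHom u := fun c u => rfl
  obtain ⟨Θ, hgen, h⟩ := Verma.exists_hom (B := ℂ) (σ := 0) (lam := l) ρ.toRingHom
    (vermaToShriekModS P n (Verma.gen R s l)) (fun X hX => by
      have h1 := congrArg (vermaToShriekModS P n) (lieVerma_gen (B := R) (σ := s) (lam := l) X hX)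
      rw [vermaToShriekModS_lie, vermaToShriekModS_coeff] at h1
      change ρ _ • vermaToShriekModS P n _ = ρ _ • vermaToShriekModS P n _
      rw [hρ, hρ, map_one, map_one, one_mul, mul_one, vfHom_toUG, h1]
      congr 2
      rw [wt, wt, map_mul, map_add, P.eval_s, AlgHom.commutes, AlgHom.commutes])
  have hlie : ∀ X m, Θ (lieVerma X m) = vf X • Θ m := fun X m => by
    rw [lieVerma, h]
    change ρ _ • _ = _
    rw [hρ, map_one, one_mul, vfHom_toUG]
  have hc : ∀ (c : ℂ) m, Θ (coeffVerma c m) = algebraMap ℂ (Diff Chart.plane) c • Θ m :=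
    fun c m => by
      rw [coeffVerma, h]
      change ρ _ • _ = _
      rw [hρ, map_one, mul_one]
  refine ⟨Θ, hlie, hc, ?_⟩
  refine Verma.induction (p := fun m => Θ (P.red l m) = vermaToShriekModS P n m) ?_ ?_ ?_ ?_
  · rw [red_gen, hgen]
  · intro m m' hm hm'
    rw [red_add, map_add, hm, hm', vermaToShriekModS, vermaToShriekModS, vermaToShriekModS,
      map_add, Submodule.Quotient.mk_add]
  · intro b m hm
    rw [red_coeff, hc, hm, vermaToShriekModS_coeff]
  · intro X m hm
    rw [red_lie, hlie, hm, vermaToShriekModS_lie]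

/-- A class that is an eigenvector of the Euler operator has a representative in the deformed
Verma module, whose coefficients are divisible by those of any given representative. -/
lemma exists_vermaToLattice_of_euler (hn : n ≠ 0) (f : lattice Chart.plane s)
    (h : euler • (Submodule.Quotient.mk (latticeProj P n f) : ShriekModS Chart.plane n) =
      algebraMap ℂ (Diff Chart.plane) l • Submodule.Quotient.mk (latticeProj P n f)) :
    ∃ m : Verma R s l, (∀ e, f.1 e ∣ (vermaToLattice P l m).1 e) ∧
      vermaToShriekModS P n m = Submodule.Quotient.mk (latticeProj P n f) := by
  obtain ⟨k, rfl⟩ := Nat.exists_eq_succ_of_ne_zero hn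
  rw [← Submodule.Quotient.mk_smul, ← Submodule.Quotient.mk_smul, Submodule.Quotient.eq] at h
  obtain ⟨w, hw⟩ := h
  obtain ⟨f₀, rfl⟩ := latticeProj_surjective P (k + 1) w
  rw [← latticeProj_s, eq_sub_iff_add_eq', eq_comm, euler_smul_latticeProj_iff] at hw
  obtain ⟨g, hg, hw⟩ := hw
  have h1 : actL Chart.plane s euler f.1 =
      ((l : R) + s) • f.1 + s ^ 1 • (f₀.1 + s ^ k • g - f.1) := by
    rw [hw, Submodule.coe_smul, pow_one, pow_succ', mul_smul, add_smul, smul_sub, smul_add]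
    abel
  obtain ⟨f', hf', g', hfg, h2, h3⟩ := exists_line_part P 1 h1
  obtain ⟨m, hm⟩ := exists_vermaFun_eq P (mem_lattice_of_dvd f.2 h2) hf'
  have hg' : g' ∈ lattice Chart.plane s := mem_lattice_of_dvd
    (sub_mem (add_mem f₀.2 (Submodule.smul_mem _ _ hg)) f.2) h3
  refine ⟨m, fun e => by rw [coe_vermaToLattice, hm]; exact h2 e, ?_⟩
  rw [vermaToShriekModS, Submodule.Quotient.eq]
  refine ⟨latticeProj P (k + 1) ⟨-g', neg_mem hg'⟩, ?_⟩
  rw [← latticeProj_s, vermaToShriek_apply, ← map_sub]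
  congr 1
  refine Subtype.ext ?_
  rw [AddSubgroupClass.coe_sub, coe_vermaToLattice, hm, hfg, Submodule.coe_smul, smul_neg, pow_one]
  abel

variable {Θ : M l →+ ShriekModS Chart.plane n}
  (hΘ : ∀ m, Θ (P.red l m) = vermaToShriekModS P n m)
include hΘ

lemma reduction_injective (hn : n ≠ 0) : Function.Injective Θ := by
  refine (injective_iff_map_eq_zero _).2 fun m hm => ?_
  obtain ⟨k, rfl⟩ := Nat.exists_eq_succ_of_ne_zero hn
  obtain ⟨m, rfl⟩ := red_surjective P m
  rw [hΘ, vermaToShriekModS, Submodule.Quotient.mk_eq_zero] at hm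
  obtain ⟨w, hw⟩ := hm
  obtain ⟨f, rfl⟩ := latticeProj_surjective P (k + 1) w
  rw [← latticeProj_s, vermaToShriek_apply, ← sub_eq_zero, ← map_sub, latticeProj_eq_zero_iff] at hw
  obtain ⟨g, hg, h⟩ := hw
  rw [AddSubgroupClass.coe_sub, Submodule.coe_smul, pow_succ', mul_smul, sub_eq_iff_eq_add,
    ← sub_eq_iff_eq_add', ← smul_sub] at h
  obtain ⟨m', rfl⟩ := exists_coeffVerma_pow P 1 m
    (sub_mem f.2 (Submodule.smul_mem _ (s ^ k) hg)) (by rw [pow_one, h]; rfl)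
  rw [pow_one, red_coeff_s]

lemma exists_reduction_eq_iff (hn : n ≠ 0) (v : ShriekModS Chart.plane n) :
    (∃ m, Θ m = v) ↔ euler • v = algebraMap ℂ (Diff Chart.plane) l • v := by
  constructor
  · rintro ⟨m, rfl⟩
    obtain ⟨m, rfl⟩ := red_surjective P m
    have h := (exists_vermaToShriek_eq_iff P n _).1 ⟨m, rfl⟩
    rw [hΘ, vermaToShriekModS, ← Submodule.Quotient.mk_smul, ← Submodule.Quotient.mk_smul, h,
      Submodule.Quotient.mk_add, mk_sShriek, add_zero]
  · intro h
    obtain ⟨w, rfl⟩ := Submodule.Quotient.mk_surjective _ v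
    obtain ⟨f, rfl⟩ := latticeProj_surjective P n w
    obtain ⟨m, -, hm⟩ := exists_vermaToLattice_of_euler P n hn f h
    exact ⟨P.red l m, (hΘ m).trans hm⟩

end Reduction

/-! ### The canonical map and the algebraic Jantzen filtrations -/

section JantzenFiltrations

variable {R : Type} [CommRing R] [Algebra ℂ R] {s : R} {l : ℤ}

lemma IsCanonicalHom.eq_lineEquiv {ψ : Verma R s l →+ dualVerma R s l}
    (h : IsCanonicalHom R s l ψ) (m : Verma R s l) :
    ψ m = lineEquiv s l ⟨vermaFun s l m, vermaFun_mem m⟩ := by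
  rw [h.unique isCanonicalHom_vermaFun]
  rfl

variable (P : Parameter R s) (n : ℕ) [IsDomain R] {ψ : Verma R s l →+ dualVerma R s l}
  (hψ : IsCanonicalHom R s l ψ) {can : CanonicalMap Chart.plane n} {u : (Trunc n)ˣ}
  (hu : ∀ f : lattice Chart.plane s,
    can.toLin (latticeProj P n f) = mulPlus Chart.plane n u (plusProj P n f.1))
include hψ hu

/-- In terms of Verma modules the canonical map is `s^ε ψ`. -/
lemma can_vermaToShriek (m : Verma R s l) : can.toLin (vermaToShriek P n l m) =
    (sPlus Chart.plane n ^ polarOrder l) (dualToPlus P n l u (ψ m)) := by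
  rw [hψ.eq_lineEquiv, ← dualToPlus_s_pow, ← map_smul, dualToPlus_lineEquiv, vermaToShriek_apply,
    hu]
  rfl

variable {Θ : M l →+ ShriekModS Chart.plane n}
  (hΘ : ∀ m, Θ (P.red l m) = vermaToShriekModS P n m)
include hΘ

lemma reduction_mem_algFiltration (i : ℕ) (m : Verma R s l) (φ : dualVerma R s l)
    (h : ψ m = s ^ i • φ) : Θ (P.red l m) ∈ can.algFiltration (i + polarOrder l) := by
  rw [hΘ]
  refine CanonicalMap.mem_algFiltration _ _ (dualToPlus P n l u φ) ?_
  rw [can_vermaToShriek P n hψ hu, h, dualToPlus_s_pow, ← Module.End.mul_apply, ← pow_add,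
    add_comm]

/-- An eigenvector of the Euler operator in the algebraic Jantzen filtration of `j_! 𝒪_U` comes
from the algebraic Jantzen filtration of the Verma module. -/
lemma exists_of_mem_algFiltration (hn : 2 ≤ n) (i : ℕ) (v : ShriekModS Chart.plane n)
    (hv : v ∈ can.algFiltration (i + polarOrder l))
    (h : euler • v = algebraMap ℂ (Diff Chart.plane) l • v) :
    ∃ (m : Verma R s l) (φ : dualVerma R s l), ψ m = s ^ i • φ ∧ Θ (P.red l m) = v := by
  obtain ⟨w, ⟨y, hy⟩, rfl⟩ := hv
  obtain ⟨f, rfl⟩ := latticeProj_surjective P n w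
  obtain ⟨m, hfm, hm⟩ := exists_vermaToLattice_of_euler P n (by omega) f h
  obtain ⟨y, rfl⟩ : ∃ y', y = mulPlus Chart.plane n u (plusProj P n y') := by
    obtain ⟨y', hy'⟩ := plusProj_surjective P n (mulPlus Chart.plane n ↑u⁻¹ y)
    exact ⟨y', by rw [hy', ← mulPlus_mul, Units.mul_inv, mulPlus_one]⟩
  have hcomm : ∀ (k : ℕ) (z : Lift Chart.plane R),
      (sPlus Chart.plane n ^ k) (mulPlus Chart.plane n u (plusProj P n z)) =
        mulPlus Chart.plane n u (plusProj P n (s ^ k • z)) := fun k z => by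
    induction k with
    | zero => simp
    | succ k ih => rw [pow_succ', Module.End.mul_apply, ih, sPlus_mulPlus, ← plusProj_s,
        ← mul_smul, ← pow_succ']
  rw [hu, hcomm] at hy
  have hy := mulPlus_unit_injective n u hy
  rw [← sub_eq_zero, ← map_sub, plusProj_eq_zero_iff] at hy
  obtain ⟨g, hg⟩ := hy
  rw [sub_eq_iff_eq_add', ← sub_eq_iff_eq_add] at hg
  by_cases hin : i + polarOrder l ≤ n
  · -- the coefficients of `m` are divisible by `s ^ (i + ε)`, so those of `ψ m` are by `s ^ i`
    have hd : ∀ e, s ^ i ∣ vermaFun s l m e := fun e => by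
      have h1 : s ^ (i + polarOrder l) ∣ f.1 e := by
        rw [← hg, Finsupp.sub_apply, Finsupp.smul_apply, Finsupp.smul_apply]
        exact dvd_sub (dvd_mul_right _ _) ((pow_dvd_pow s hin).mul_right _)
      have h2 := h1.trans (hfm e)
      rw [coe_vermaToLattice, Finsupp.smul_apply, smul_eq_mul, pow_add, mul_comm] at h2
      exact (mul_dvd_mul_iff_left (pow_ne_zero _ P.ne_zero)).1 h2
    obtain ⟨z, hz⟩ := exists_smul_of_dvd _ hd
    have hz' : z ∈ line R l := mem_line_of_smul_mem (pow_ne_zero i P.ne_zero)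
      (hz ▸ vermaFun_mem m)
    refine ⟨m, lineEquiv s l ⟨z, hz'⟩, ?_, (hΘ m).trans hm⟩
    rw [hψ.eq_lineEquiv, ← map_smul]
    congr 1
    exact Subtype.ext hz
  · -- the coefficients are divisible by `s ^ n`, and `s ^ (n - 1)` maps everything into the lattice
    have hd : ∀ e, s ^ n ∣ f.1 e := fun e => by
      rw [← hg, Finsupp.sub_apply, Finsupp.smul_apply, Finsupp.smul_apply]
      exact dvd_sub ((pow_dvd_pow s (by omega)).mul_right _) (dvd_mul_right _ _)
    obtain ⟨z, hz⟩ := exists_smul_of_dvd _ hd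
    have h0 : P.red l (0 : Verma R s l) = 0 := map_zero _
    refine ⟨0, 0, by rw [map_zero, smul_zero], ?_⟩
    rw [h0, map_zero, eq_comm]
    refine (Submodule.Quotient.mk_eq_zero _).2
      ⟨latticeProj P n (s ^ (n - 2) • ⟨s • z, s_smul_mem_lattice Chart.plane z⟩), ?_⟩
    rw [← latticeProj_s]
    congr 1
    refine Subtype.ext ?_
    rw [hz, Submodule.coe_smul, Submodule.coe_smul, ← mul_smul, ← mul_smul, ← pow_succ', ← pow_succ]
    congr 2
    omega

end JantzenFiltrations

end Jantzen

namespace Jantzen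

/-! ### Comparison of the Jantzen filtrations -/

section Comparison

variable {n : ℕ} {l : ℤ} {ψ : MA l →+ IA l} (hψ : IsCanonicalHom A A.s l ψ)
  {can : CanonicalMap Chart.plane n} {Θ : M l →+ ShriekModS Chart.plane n}
  (hΘ : ∀ m, Θ (redVerma l m) = vermaToShriekModS A.parameter n m)
include hψ hΘ

/-- The identification of `M(l)` with the `l`-part of `j_! 𝒪_U` shifts the algebraic Jantzen
filtration by `ε`. -/
lemma image_jantzen (hn : 2 ≤ n) (i : ℕ) : Θ '' jantzen ψ i =
    {v | v ∈ can.algFiltration (i + polarOrder l) ∧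
      euler • v = algebraMap ℂ (Diff Chart.plane) l • v} := by
  obtain ⟨u, hu⟩ := can.exists_unit_latticeProj A.parameter
  ext v
  constructor
  · rintro ⟨_, ⟨m, ⟨φ, h⟩, rfl⟩, rfl⟩
    exact ⟨reduction_mem_algFiltration A.parameter n hψ hu hΘ i m φ h,
      (exists_reduction_eq_iff A.parameter n hΘ (by omega) _).1 ⟨_, rfl⟩⟩
  · rintro ⟨h1, h2⟩
    obtain ⟨m, φ, h, hm⟩ :=
      exists_of_mem_algFiltration A.parameter n hψ hu hΘ hn i v h1 h2
    exact ⟨_, ⟨m, ⟨φ, h⟩, rfl⟩, hm⟩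

/-- In `Ξ`, the algebraic Jantzen filtration of `M(l)` is given by the monodromy filtration. -/
lemma canBar_image_jantzen (hn : 2 ≤ n) (i : ℕ) {μ : ℤ → Submodule (Diff Chart.plane) can.Xi}
    (hμ : IsMonodromyFiltration can.sXi μ) : (fun m => can.canBar (Θ m)) '' jantzen ψ i =
      {w | w ∈ LinearMap.ker can.sXi ⊓ μ (-((i + polarOrder l : ℕ) : ℤ)) ∧
        euler • w = algebraMap ℂ (Diff Chart.plane) l • w} := by
  have ht := can.tame hn
  have h : (fun m => can.canBar (Θ m)) '' jantzen ψ i = can.canBar '' (Θ '' jantzen ψ i) :=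
    (Set.image_image _ _ _).symm
  rw [h, image_jantzen (can := can) hψ hΘ hn, ht.ker_inf_monodromyFiltration hμ,
    ← ht.map_algFiltration]
  have hiff : ∀ v, euler • can.canBar v = algebraMap ℂ (Diff Chart.plane) l • can.canBar v ↔
      euler • v = algebraMap ℂ (Diff Chart.plane) l • v := fun v => by
    rw [← map_smul, ← map_smul]; exact ht.canBar_injective.eq_iff
  ext w
  constructor
  · rintro ⟨v, ⟨h1, h2⟩, rfl⟩
    exact ⟨⟨v, h1, rfl⟩, (hiff v).2 h2⟩
  · rintro ⟨⟨v, h1, rfl⟩, h2⟩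
    exact ⟨v, ⟨h1, (hiff v).1 h2⟩, rfl⟩

end Comparison

end Jantzen

theorem mainTheorem4 (n : ℕ) (hn : 2 ≤ n) :
    -- on every chart
    (∀ W : Jantzen.Chart,
      -- `j_! 𝒪_U` is the quotient of `j_! f^s 𝒪_U^{(n)}` by `s`
      (Function.Surjective (Jantzen.redShriek W n (by omega)) ∧
        LinearMap.ker (Jantzen.redShriek W n (by omega)) =
          LinearMap.range (Jantzen.sShriek W n)) ∧
      -- the canonical map exists and is unique up to units of `ℂ[s]/s^n`
      Nonempty (Jantzen.CanonicalMap W n) ∧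
      (∀ can can' : Jantzen.CanonicalMap W n, ∃ u : (Jantzen.Trunc n)ˣ,
        can'.toLin = Jantzen.mulPlus W n u ∘ₗ can.toLin) ∧
      ∀ can : Jantzen.CanonicalMap W n,
        -- the induced map is injective with image `ker s`
        Function.Injective can.canBar ∧
        LinearMap.range can.canBar = LinearMap.ker can.sXi ∧
        -- the monodromy filtration exists and is unique, and the two Jantzen filtrations agree
        IsNilpotent can.sXi ∧
        (∃! μ : ℤ → Submodule (Jantzen.Diff W) can.Xi,
          Jantzen.IsMonodromyFiltration can.sXi μ) ∧
        ∀ μ : ℤ → Submodule (Jantzen.Diff W) can.Xi, Jantzen.IsMonodromyFiltration can.sXi μ →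
          ∀ i : ℕ,
            (can.algFiltration i).map can.canBar = LinearMap.ker can.sXi ⊓ μ (-(i : ℤ)) ∧
            LinearMap.ker can.sXi ⊓ μ (-(i : ℤ)) =
              LinearMap.ker can.sXi ⊓ LinearMap.range (can.sXi ^ i)) ∧
    -- on global sections, for every integral weight `l`
    (∀ (can : Jantzen.CanonicalMap Jantzen.Chart.plane n) (l : ℤ) (ε : ℕ),
      ε = (if 0 ≤ l then 0 else 1) →
      (∃! ψ : Jantzen.MA l →+ Jantzen.IA l, Jantzen.IsCanonicalHom Jantzen.A Jantzen.A.s l ψ) ∧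
      ∀ ψ : Jantzen.MA l →+ Jantzen.IA l, Jantzen.IsCanonicalHom Jantzen.A Jantzen.A.s l ψ →
      ∃ (ΘM : Jantzen.MA l →+ Jantzen.jShriek Jantzen.Chart.plane
            (Jantzen.fsO Jantzen.Chart.plane n))
        (ΘI : Jantzen.IA l →+ Jantzen.jPlus Jantzen.Chart.plane
            (Jantzen.fsO Jantzen.Chart.plane n))
        (Θ : Jantzen.M l →+ Jantzen.ShriekModS Jantzen.Chart.plane n),
        -- `ΘM` identifies `M_A(l) / s^n` with the `l`-part of `Γ(j_! f^s 𝒪_U^{(n)})`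
        ((∀ X m, ΘM (Jantzen.lieVerma X m) = Jantzen.vf X • ΘM m) ∧
          (∀ (c : ℂ) m, ΘM (Jantzen.coeffVerma (algebraMap ℂ Jantzen.A c) m) =
            algebraMap ℂ (Jantzen.Diff Jantzen.Chart.plane) c • ΘM m) ∧
          (∀ m, ΘM (Jantzen.coeffVerma Jantzen.A.s m) =
            Jantzen.sShriek Jantzen.Chart.plane n (ΘM m)) ∧
          (∀ v, (∃ m, ΘM m = v) ↔ Jantzen.euler • v =
            algebraMap ℂ (Jantzen.Diff Jantzen.Chart.plane) l • v +
              Jantzen.sShriek Jantzen.Chart.plane n v) ∧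
          (∀ m, ΘM m = 0 ↔ ∃ m', m = Jantzen.coeffVerma (Jantzen.A.s ^ n) m')) ∧
        -- `ΘI` identifies `I_A(l) / s^n` with the `l`-part of `Γ(j₊ f^s 𝒪_U^{(n)})`
        ((∀ X φ, ∃ φ' : Jantzen.IA l, (∀ u, φ'.1 u = φ.1 (u * Jantzen.toUG X)) ∧
            ΘI φ' = Jantzen.vf X • ΘI φ) ∧
          (∀ (c : ℂ) φ, ΘI (algebraMap ℂ Jantzen.A c • φ) =
            algebraMap ℂ (Jantzen.Diff Jantzen.Chart.plane) c • ΘI φ) ∧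
          (∀ φ, ΘI (Jantzen.A.s • φ) = Jantzen.sPlus Jantzen.Chart.plane n (ΘI φ)) ∧
          (∀ w, (∃ φ, ΘI φ = w) ↔ Jantzen.euler • w =
            algebraMap ℂ (Jantzen.Diff Jantzen.Chart.plane) l • w +
              Jantzen.sPlus Jantzen.Chart.plane n w) ∧
          (∀ φ, ΘI φ = 0 ↔ ∃ φ' : Jantzen.IA l, φ = Jantzen.A.s ^ n • φ')) ∧
        -- under these identifications `can` is `ψ` for `0 ≤ l` and `s ∘ ψ` for `l < 0`
        (∀ m, can.toLin (ΘM m) = (Jantzen.sPlus Jantzen.Chart.plane n ^ ε) (ΘI (ψ m))) ∧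
        -- `Θ`, the reduction of `ΘM`, identifies `M(l)` with the `l`-part of `Γ(j_! 𝒪_U)`
        ((∀ X m, Θ (Jantzen.lieVerma X m) = Jantzen.vf X • Θ m) ∧
          (∀ (c : ℂ) m, Θ (Jantzen.coeffVerma c m) =
            algebraMap ℂ (Jantzen.Diff Jantzen.Chart.plane) c • Θ m) ∧
          (∀ m, Θ (Jantzen.redVerma l m) = Submodule.Quotient.mk (ΘM m)) ∧
          Function.Injective Θ ∧
          (∀ v, (∃ m, Θ m = v) ↔ Jantzen.euler • v =
            algebraMap ℂ (Jantzen.Diff Jantzen.Chart.plane) l • v)) ∧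
        -- the algebraic Jantzen filtration of `M(l)` is the `l`-part of the two filtrations
        ∀ i : ℕ,
          (Θ '' Jantzen.jantzen ψ i = {v | v ∈ can.algFiltration (i + ε) ∧
            Jantzen.euler • v = algebraMap ℂ (Jantzen.Diff Jantzen.Chart.plane) l • v}) ∧
          ∀ μ : ℤ → Submodule (Jantzen.Diff Jantzen.Chart.plane) can.Xi,
            Jantzen.IsMonodromyFiltration can.sXi μ →
            (fun m => can.canBar (Θ m)) '' Jantzen.jantzen ψ i =
              {w | w ∈ LinearMap.ker can.sXi ⊓ μ (-((i + ε : ℕ) : ℤ)) ∧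
                Jantzen.euler • w =
                  algebraMap ℂ (Jantzen.Diff Jantzen.Chart.plane) l • w}) := by
  refine ⟨fun W => ⟨⟨Jantzen.redShriek_surjective W n _, Jantzen.ker_redShriek W n _⟩,
    Jantzen.nonempty_canonicalMap Jantzen.A.parameter W n,
    Jantzen.exists_unit_mulPlus Jantzen.A.parameter, fun can => ?_⟩, ?_⟩
  · have ht := can.tame hn
    refine ⟨ht.canBar_injective, ht.range_canBar, ht.isNilpotent_sXi,
      ht.existsUnique_monodromyFiltration, fun μ hμ i => ?_⟩
    have h := ht.ker_inf_monodromyFiltration hμ i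
    exact ⟨(ht.map_algFiltration i).trans h.symm, h⟩
  · intro can l ε hε
    obtain rfl : ε = Jantzen.polarOrder l := hε
    refine ⟨⟨_, Jantzen.isCanonicalHom_vermaFun,
      fun ψ hψ => hψ.unique Jantzen.isCanonicalHom_vermaFun⟩, fun ψ hψ => ?_⟩
    obtain ⟨u, hu⟩ := can.exists_unit_latticeProj Jantzen.A.parameter
    obtain ⟨Θ, hΘ1, hΘ2, hΘ⟩ := Jantzen.exists_reduction Jantzen.A.parameter n (l := l)
    exact ⟨Jantzen.vermaToShriek Jantzen.A.parameter n l,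
      Jantzen.dualToPlus Jantzen.A.parameter n l u, Θ,
      ⟨Jantzen.vermaToShriek_lie _ n, Jantzen.vermaToShriek_coeff_algebraMap _ n,
        Jantzen.vermaToShriek_coeff_s _ n, Jantzen.exists_vermaToShriek_eq_iff _ n,
        Jantzen.vermaToShriek_eq_zero_iff _ n⟩,
      ⟨Jantzen.exists_dualToPlus_lie _ n u, Jantzen.dualToPlus_algebraMap _ n u,
        Jantzen.dualToPlus_s _ n u, Jantzen.exists_dualToPlus_eq_iff _ n u,
        Jantzen.dualToPlus_eq_zero_iff _ n u⟩,
      Jantzen.can_vermaToShriek _ n hψ hu,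
      ⟨hΘ1, hΘ2, hΘ, Jantzen.reduction_injective _ n hΘ (by omega),
        Jantzen.exists_reduction_eq_iff _ n hΘ (by omega)⟩,
      fun i => ⟨Jantzen.image_jantzen hψ hΘ hn i,
        fun μ hμ => Jantzen.canBar_image_jantzen hψ hΘ hn i hμ⟩⟩
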